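/- For a permutation $\sigma\in S_n$ (permutations composed from right to left), a *transitive factorization of $\sigma$ in 3-cycles* is a tuple $(\delta_1,\dots,\delta_k)$ of 3-cycles in $S_n$ with $\delta_1\cdots\delta_k=\sigma$ such that the group generated by $\delta_1,\dots,\delta_k$ is transitive on $\{1,\dots,n\}$ (the empty tuple, $k=0$, is allowed, and is such a factorization only for $n=1$); it is *minimal* if $k$ is least possible for $\sigma$. The least $k$ depends only on the cycle type $\alpha\vdash n$ of $\sigma$ and is denoted $\mu^3(\alpha)$. (It is undefined if no transitive factorization exists, but then the sets below are empty and the corresponding terms are read as $0$.) Let $\mathcal A^3(\alpha)$ be the set of tuples $(\delta_1,\dots,\delta_k,\sigma)$ with $\sigma$ of type $\alpha$ and $(\delta_1,\dots,\delta_k)$ a minimal transitive factorization of $\sigma$ in 3-cycles. For $k\ge 1$ such a tuple is of type $1$, $2$ or $3$ if one can write $\delta_1=(j_3\,j_2\,j_1)$ so that the disjoint cycle decomposition of $\sigma$ has the form, respectively, 1. $\sigma=(j_3\dots j_2\dots j_1\dots)\cdots$ (then $\delta_1$ joins three cycles of $\delta_1^{-1}\sigma$ into one); 2. $\sigma=(j_1\dots)(j_2\dots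 j_3\dots)\cdots$; 3. $\sigma=(j_1\dots)(j_2\dots)(j_3\dots)\cdots$ (then $\delta_1$ cuts one cycle of $\delta_1^{-1}\sigma$ into three). Let $\tilde{\mathcal A}^3_i(\alpha)$ be the set of tuples $(\delta_2,\dots,\delta_k,\sigma)$ such that $(\sigma\delta_k^{-1}\cdots\delta_2^{-1},\delta_2,\dots,\delta_k,\sigma)$ is an element of $\mathcal A^3(\alpha)$ of type $i$. With $p_\alpha=p_{\alpha_1}\cdots p_{\alpha_l}$, define formal power series in $z,u,p_1,p_2,\dots$ over a field of characteristic $0$ by $$\widetilde F_3=\sum_{n\ge1}\sum_{\alpha\vdash n}|\mathcal A^3(\alpha)|\frac{z^n}{n!}\frac{u^{\mu^3(\alpha)}}{\mu^3(\alpha)!}\,p_\alpha,\qquad \Big(\frac{\partial\widetilde F_3}{\partial u}\Big)_i=\sum_{n\ge1}\sum_{\alpha\vdash n}|\tilde{\mathcal A}^3_i(\alpha)|\frac{z^n}{n!}\frac{u^{\mu^3(\alpha)-1}}{(\mu^3(\alpha)-1)!}\,p_\alpha\quad(i=1,2,3),$$ where terms with $\tilde{\mathcal A}^3_i(\alpha)=\emptyset$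 are $0$. **Lemma.** We have $$\frac{\partial\widetilde F_3}{\partial u}=\Big(\frac{\partial\widetilde F_3}{\partial u}\Big)_1+\Big(\frac{\partial\widetilde F_3}{\partial u}\Big)_2+\Big(\frac{\partial\widetilde F_3}{\partial u}\Big)_3,$$ and $$\Big(\frac{\partial\widetilde F_3}{\partial u}\Big)_1=\frac13\sum_{i,j,k\ge1}ijk\,p_{i+j+k}\frac{\partial\widetilde F_3}{\partial p_i}\frac{\partial\widetilde F_3}{\partial p_j}\frac{\partial\widetilde F_3}{\partial p_k},$$ $$\Big(\frac{\partial\widetilde F_3}{\partial u}\Big)_2=\sum_{i,j,k\ge1}i(j+k)\,p_{i+k}\,p_j\frac{\partial\widetilde F_3}{\partial p_i}\frac{\partial\widetilde F_3}{\partial p_{j+k}},$$ $$\Big(\frac{\partial\widetilde F_3}{\partial u}\Big)_3=\frac13\sum_{i,j,k\ge1}(i+j+k)\,p_i\,p_j\,p_k\frac{\partial\widetilde F_3}{\partial p_{i+j+k}},$$ where each of the three families on the right is formally summable (every monomial occurs in only finitely many summands). Consequently $$\frac{\partial\widetilde F_3}{\partial u}=\frac13\sum_{i,j,k\ge1}ijk\,p_{i+j+k}\frac{\partial\widetilde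 F_3}{\partial p_i}\frac{\partial\widetilde F_3}{\partial p_j}\frac{\partial\widetilde F_3}{\partial p_k}+\sum_{i,j,k\ge1}i(j+k)\,p_{i+k}\,p_j\frac{\partial\widetilde F_3}{\partial p_i}\frac{\partial\widetilde F_3}{\partial p_{j+k}}+\frac13\sum_{i,j,k\ge1}(i+j+k)\,p_i\,p_j\,p_k\frac{\partial\widetilde F_3}{\partial p_{i+j+k}}.$$ -/

import Mathlib

/-! ### Minimal transitive factorizations into 3-cycles

The vertex set `{1, …, n}` is `Fin n`, a tuple of permutations is a list, and products of
permutations are composed from right to left. -/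

/-- `σ` is of type `α`: the cycle lengths of `σ`, fixed points included, are the parts of `α`. -/
def HasType {n : ℕ} (σ : Equiv.Perm (Fin n)) (α : Nat.Partition n) : Prop :=
  σ.partition.parts = α.parts

/-- `δ = (δ₁, …, δₖ)` is a tuple of 3-cycles with `δ₁ ⋯ δₖ = σ` that generates a transitive
subgroup. The empty tuple is allowed; it is transitive for `n = 1`. -/
def IsTransitiveFactorization {n : ℕ} (δ : List (Equiv.Perm (Fin n)))
    (σ : Equiv.Perm (Fin n)) : Prop :=
  (∀ ω ∈ δ, ω.IsThreeCycle) ∧ δ.prod = σ ∧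
    MulAction.IsPretransitive (Subgroup.closure {ω | ω ∈ δ}) (Fin n)

/-- A transitive factorization with the least possible number of 3-cycles. -/
def IsMinimalTransitiveFactorization {n : ℕ} (δ : List (Equiv.Perm (Fin n)))
    (σ : Equiv.Perm (Fin n)) : Prop :=
  IsTransitiveFactorization δ σ ∧
    ∀ δ' : List (Equiv.Perm (Fin n)), IsTransitiveFactorization δ' σ → δ.length ≤ δ'.length

/-- `μ³(α)`: the least number of 3-cycles in a transitive factorization of a permutation of type
`α` (this number is the same for all permutations of type `α`). It is `0` if there is no such
factorization; then `setA α` below is empty. -/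
noncomputable def mu3 {n : ℕ} (α : Nat.Partition n) : ℕ :=
  sInf {k | ∃ (δ : List (Equiv.Perm (Fin n))) (σ : Equiv.Perm (Fin n)),
    HasType σ α ∧ IsTransitiveFactorization δ σ ∧ δ.length = k}

/-- `𝒜³(α)`: the pairs of a permutation `σ` of type `α` and a minimal transitive factorization
`(δ₁, …, δₖ)` of it. Here `k = μ³(α)`, so that this set is finite. -/
def setA {n : ℕ} (α : Nat.Partition n) :
    Set (List (Equiv.Perm (Fin n)) × Equiv.Perm (Fin n)) :=
  {x | HasType x.2 α ∧ IsMinimalTransitiveFactorization x.1 x.2}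

/-- `σ = (a … b … c …) ⋯`: the points `a, b, c` are distinct, lie on one cycle of `σ` and occur
on it in this cyclic order. -/
def InCyclicOrder {n : ℕ} (σ : Equiv.Perm (Fin n)) (a b c : Fin n) : Prop :=
  ∃ s t : ℕ, 0 < s ∧ s < t ∧ t < Function.minimalPeriod σ a ∧ (σ ^ s) a = b ∧ (σ ^ t) a = c

/-- The three ways in which a 3-cycle `ω = (j₃ j₂ j₁)` can split off from `σ = ω σ'` when `ω` is
the first factor of a minimal transitive factorization of `σ`:
* type 1: `σ = (j₃ … j₂ … j₁ …) ⋯`, where `ω` joins three cycles of `σ'`;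
* type 2: `σ = (j₁ …)(j₂ … j₃ …) ⋯`;
* type 3: `σ = (j₁ …)(j₂ …)(j₃ …) ⋯`, where `ω` cuts one cycle of `σ'` into three. -/
def IsOfType {n : ℕ} (i : Fin 3) (σ ω : Equiv.Perm (Fin n)) : Prop :=
  ∃ j₁ j₂ j₃ : Fin n, [j₃, j₂, j₁].Nodup ∧ ω = [j₃, j₂, j₁].formPerm ∧
    match i with
    | 0 => InCyclicOrder σ j₃ j₂ j₁
    | 1 => σ.SameCycle j₂ j₃ ∧ ¬ σ.SameCycle j₁ j₂
    | 2 => ¬ σ.SameCycle j₁ j₂ ∧ ¬ σ.SameCycle j₂ j₃ ∧ ¬ σ.SameCycle j₁ j₃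

/-- `𝒜³ᵢ(α)`: the elements `(δ₁, …, δₖ, σ)` of `𝒜³(α)` such that `(σ, δ₁)` is of type `i`; the
indices `0, 1, 2` of `Fin 3` stand for the types 1, 2, 3. -/
def setAi {n : ℕ} (i : Fin 3) (α : Nat.Partition n) :
    Set (List (Equiv.Perm (Fin n)) × Equiv.Perm (Fin n)) :=
  {x | x ∈ setA α ∧ ∃ ω τ, x.1 = ω :: τ ∧ IsOfType i x.2 ω}

/-- `𝒜̃³ᵢ(α)`: the tuples `(δ₂, …, δₖ, σ)` such that `(σ δₖ⁻¹ ⋯ δ₂⁻¹, δ₂, …, δₖ, σ)` belongs to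
`𝒜³ᵢ(α)`. -/
def setAtildei {n : ℕ} (i : Fin 3) (α : Nat.Partition n) :
    Set (List (Equiv.Perm (Fin n)) × Equiv.Perm (Fin n)) :=
  {x | ((x.2 * x.1.prod⁻¹) :: x.1, x.2) ∈ setAi i α}

/-! ### Formal power series in `z, u, p₁, p₂, …` -/

/-- The variables `z, u, p₁, p₂, …`. -/
inductive Var : Type
  | z : Var
  | u : Var
  | p (i : ℕ+) : Var

/-- Formal power series in `z, u, p₁, p₂, …` over `K`. -/
abbrev Series (K : Type*) [Field K] : Type _ := MvPowerSeries Var K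

/-- A family of power series is formally summable if every monomial occurs in only finitely many
members of the family. -/
def FormallySummable {K : Type*} [Field K] {ι : Type*} (f : ι → Series K) : Prop :=
  ∀ m : Var →₀ ℕ, (Function.support fun i => MvPowerSeries.coeff m (f i)).Finite

/-- The coefficientwise sum of a formally summable family of power series. -/
noncomputable def formalSum {K : Type*} [Field K] {ι : Type*} (f : ι → Series K) : Series K :=
  fun m => ∑ᶠ i, MvPowerSeries.coeff m (f i)

/-- The variable `pᵢ` as a power series. -/
noncomputable def pVar (K : Type*) [Field K] (i : ℕ+) : Series K := MvPowerSeries.X (Var.p i)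

/-- `p_α = p_{α₁} ⋯ p_{αₗ}` (`Nat.toPNat'` only regards the positive integer `αⱼ` as an element
of `ℕ+`). -/
noncomputable def pPart (K : Type*) [Field K] {n : ℕ} (α : Nat.Partition n) : Series K :=
  (α.parts.map fun a => pVar K a.toPNat').prod

/-- The summand `c zⁿ / n! · uᵉ / e! · p_α`. -/
noncomputable def genTerm (K : Type*) [Field K] {n : ℕ} (c e : ℕ) (α : Nat.Partition n) :
    Series K :=
  ((c : K) / ((n.factorial : K) * (e.factorial : K))) •
    (MvPowerSeries.X Var.z ^ n * MvPowerSeries.X Var.u ^ e * pPart K α)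

/-- `F̃₃ = ∑_{n ≥ 1} ∑_{α ⊢ n} |𝒜³(α)| zⁿ / n! · u^{μ³(α)} / μ³(α)! · p_α`. -/
noncomputable def Ftilde3 (K : Type*) [Field K] : Series K :=
  formalSum fun x : (n : ℕ+) × Nat.Partition (n : ℕ) =>
    genTerm K (setA x.2).ncard (mu3 x.2) x.2

/-- `(∂F̃₃/∂u)ᵢ = ∑_{n ≥ 1} ∑_{α ⊢ n} |𝒜̃³ᵢ(α)| zⁿ / n! · u^{μ³(α)-1} / (μ³(α)-1)! · p_α`.
If `μ³(α) = 0`, there is no first 3-cycle and `𝒜̃³ᵢ(α)` is empty. -/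
noncomputable def dFtilde3 (K : Type*) [Field K] (i : Fin 3) : Series K :=
  formalSum fun x : (n : ℕ+) × Nat.Partition (n : ℕ) =>
    genTerm K (setAtildei i x.2).ncard (mu3 x.2 - 1) x.2

/-- `∂F̃₃/∂pᵢ`. -/
noncomputable def Fp (K : Type*) [Field K] (i : ℕ+) : Series K :=
  MvPowerSeries.pderiv K (Var.p i) (Ftilde3 K)

/-- `i j k p_{i+j+k} F̃_{pᵢ} F̃_{pⱼ} F̃_{pₖ}`. -/
noncomputable def summand1 (K : Type*) [Field K] (x : ℕ+ × ℕ+ × ℕ+) : Series K :=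
  let (i, j, k) := x
  ((i * j * k : ℕ+) : ℕ) • (pVar K (i + j + k) * Fp K i * Fp K j * Fp K k)

/-- `i (j+k) p_{i+k} pⱼ F̃_{pᵢ} F̃_{p_{j+k}}`. -/
noncomputable def summand2 (K : Type*) [Field K] (x : ℕ+ × ℕ+ × ℕ+) : Series K :=
  let (i, j, k) := x
  ((i * (j + k) : ℕ+) : ℕ) • (pVar K (i + k) * pVar K j * Fp K i * Fp K (j + k))

/-- `(i+j+k) pᵢ pⱼ pₖ F̃_{p_{i+j+k}}`. -/
noncomputable def summand3 (K : Type*) [Field K] (x : ℕ+ × ℕ+ × ℕ+) : Series K :=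
  let (i, j, k) := x
  ((i + j + k : ℕ+) : ℕ) • (pVar K i * pVar K j * pVar K k * Fp K (i + j + k))

/-! For a list `τ` of 3-cycles, `defect τ` is twice the length plus twice the number of orbits,
minus the number of points, minus the number of cycles of the product; for a transitive list it is
twice the genus of the associated branched covering of the sphere. A 3-cycle is a product of two
transpositions, and a transposition put in front costs defect only if it joins two cycles that lie
in one orbit (`swap_step`). So the defect is nonnegative and never drops when a 3-cycle is put in
front. Every even permutation of at least three points has a transitive factorization of defect 0
(`exists_factorization`), hence a transitive factorization is minimal exactly if its defect is 0
(`isMinimal_iff`).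

Defect 0 is inherited when the first 3-cycle `(a b c)` is removed. What remains has three orbits,
with one of the three points in each, and three cycles are joined; or two orbits, and an arc of a
cycle in one orbit is moved to a cycle in the other; or it is already transitive and one cycle is
cut into three. These are the types 1, 2, 3 (`step_join`, `step_exchange`, `step_cut`). They are
exhaustive (`exists_type`) and exclusive (`HasForm.type_unique`), and every such configuration does
come from a minimal transitive factorization.

It remains to count configurations. A list of defect 0 with several orbits is a shuffle of lists of
defect 0 on the orbits, which amounts to multiplying series that are exponential in `z` (points) and
`u` (length); see `Represents.conv` and `egf_mul`. Choosing a point on a cycle of length `i` is the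
operator `i ∂/∂pᵢ` (`markOp_mon_expo`), and choosing further points on the same cycle is a splitting
of its length as `j + k` or `i + j + k`. A 3-cycle can be written in three ways, all of which are
admissible in types 1 and 3 and exactly one in type 2; this explains the factors 1/3. -/

namespace ThreeCycles

open Equiv Equiv.Perm Finset

set_option linter.unusedSectionVars false

/-! ### Equivalence relations on a finite set, and sums over their classes. -/

section Classes

variable {V : Type*} [Fintype V] [DecidableEq V]

open Classical in
/-- The class of `x` as a finset. -/
noncomputable def cls (s : Setoid V) (x : V) : Finset V := {y | s x y}

@[simp] lemma mem_cls {s : Setoid V} {x y : V} : y ∈ cls s x ↔ s x y := by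
  simp [cls]

lemma self_mem_cls (s : Setoid V) (x : V) : x ∈ cls s x := mem_cls.2 (s.refl x)

lemma cls_eq_iff {s : Setoid V} {x y : V} : cls s x = cls s y ↔ s x y := by
  constructor
  · intro h
    exact mem_cls.1 (h ▸ self_mem_cls s y)
  · intro h
    ext z
    simp only [mem_cls]
    exact ⟨fun h' => s.trans (s.symm h) h', fun h' => s.trans h h'⟩

/-- The setoid obtained by merging the classes of `a` and `b`. -/
def join (s : Setoid V) (a b : V) : Setoid V where
  r x y := s x y ∨ (s x a ∧ s b y) ∨ (s x b ∧ s a y)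
  iseqv := by
    refine ⟨fun x => Or.inl (s.refl x), ?_, ?_⟩
    · rintro x y (h | ⟨h, h'⟩ | ⟨h, h'⟩)
      · exact Or.inl (s.symm h)
      · exact Or.inr (Or.inr ⟨s.symm h', s.symm h⟩)
      · exact Or.inr (Or.inl ⟨s.symm h', s.symm h⟩)
    · have tr : ∀ {x y z}, s x y → s y z → s x z := fun h h' => s.trans h h'
      have sy : ∀ {x y}, s x y → s y x := fun h => s.symm h
      rintro x y z (h | ⟨h, h'⟩ | ⟨h, h'⟩) (k | ⟨k, k'⟩ | ⟨k, k'⟩)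
      · exact Or.inl (tr h k)
      · exact Or.inr (Or.inl ⟨tr h k, k'⟩)
      · exact Or.inr (Or.inr ⟨tr h k, k'⟩)
      · exact Or.inr (Or.inl ⟨h, tr h' k⟩)
      · exact Or.inl (tr h (tr (sy (tr h' k)) k'))
      · exact Or.inl (tr h k')
      · exact Or.inr (Or.inr ⟨h, tr h' k⟩)
      · exact Or.inl (tr h k')
      · exact Or.inl (tr h (tr (sy (tr h' k)) k'))

lemma join_apply {s : Setoid V} {a b x y : V} :
    join s a b x y ↔ s x y ∨ (s x a ∧ s b y) ∨ (s x b ∧ s a y) := Iff.rfl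

lemma le_join (s : Setoid V) (a b : V) : s ≤ join s a b := fun _ _ h => Or.inl h

lemma join_pair (s : Setoid V) (a b : V) : join s a b a b := Or.inr (Or.inl ⟨s.refl _, s.refl _⟩)

lemma join_le {s t : Setoid V} {a b : V} : join s a b ≤ t ↔ s ≤ t ∧ t a b := by
  constructor
  · exact fun h => ⟨(le_join s a b).trans h, h (join_pair s a b)⟩
  · rintro ⟨h, hab⟩ x y (h1 | ⟨h1, h2⟩ | ⟨h1, h2⟩)
    · exact h h1
    · exact t.trans (h h1) (t.trans hab (h h2))
    · exact t.trans (h h1) (t.trans (t.symm hab) (h h2))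

lemma join_eq_self {s : Setoid V} {a b : V} (h : s a b) : join s a b = s :=
  le_antisymm (join_le.2 ⟨le_rfl, h⟩) (le_join s a b)

/-- The sum of `w |C|` over the classes `C` that meet `S`. -/
noncomputable def wsum {M : Type*} [AddCommMonoid M] (S : Finset V) (s : Setoid V) (w : ℕ → M) :
    M :=
  ∑ C ∈ S.image (cls s), w #C

variable {M : Type*} [AddCommMonoid M]

lemma wsum_congr {S : Finset V} {s t : Setoid V} (h : ∀ x ∈ S, cls s x = cls t x) (w : ℕ → M) :
    wsum S s w = wsum S t w := by
  unfold wsum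
  rw [Finset.image_congr (g := cls t)]
  exact fun x hx => h x hx

lemma wsum_union {S T : Finset V} {s : Setoid V} (h : ∀ x ∈ S, ∀ y ∈ T, ¬ s x y) (w : ℕ → M) :
    wsum (S ∪ T) s w = wsum S s w + wsum T s w := by
  unfold wsum
  rw [image_union, sum_union]
  rw [disjoint_left]
  intro C hC hC'
  obtain ⟨x, hx, rfl⟩ := mem_image.1 hC
  obtain ⟨y, hy, hxy⟩ := mem_image.1 hC'
  exact h x hx y hy (cls_eq_iff.1 hxy.symm)

lemma wsum_cls (s : Setoid V) (a : V) (w : ℕ → M) : wsum (cls s a) s w = w #(cls s a) := by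
  have : (cls s a).image (cls s) = {cls s a} := by
    ext C
    simp only [mem_image, mem_cls, mem_singleton]
    constructor
    · rintro ⟨x, hx, rfl⟩
      exact (cls_eq_iff.2 hx).symm
    · rintro rfl
      exact ⟨a, s.refl a, rfl⟩
  rw [wsum, this, sum_singleton]

lemma wsum_singletons {S : Finset V} {s : Setoid V} (h : ∀ x ∈ S, cls s x = {x}) (w : ℕ → M) :
    wsum S s w = #S • w 1 := by
  unfold wsum
  rw [Finset.image_congr (g := fun x => {x}) (fun x hx => h x hx),
    sum_image (fun x _ y _ hxy => singleton_injective hxy)]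
  simp

/-- Each class of size `i` contributes its `i` points. This is the source of the factor `i` in the
operator `i ∂/∂pᵢ`. -/
lemma card_filter_card_cls (S : Finset V) (s : Setoid V) (hS : ∀ x ∈ S, cls s x ⊆ S) (i : ℕ) :
    #{x ∈ S | #(cls s x) = i} = i * wsum S s (fun j => if j = i then 1 else 0) := by
  have hmaps : Set.MapsTo (cls s) ({x ∈ S | #(cls s x) = i} : Finset V)
      (S.image (cls s) : Finset (Finset V)) := fun x hx =>
    Finset.mem_coe.2 (mem_image_of_mem _ (mem_filter.1 (Finset.mem_coe.1 hx)).1)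
  rw [card_eq_sum_card_fiberwise hmaps, wsum, mul_sum]
  apply sum_congr rfl
  intro C hC
  obtain ⟨x, hx, rfl⟩ := mem_image.1 hC
  split_ifs with h
  · rw [mul_one, ← h]
    congr 1
    ext y
    simp only [mem_filter, mem_cls, cls_eq_iff]
    constructor
    · exact fun h => s.symm h.2
    · intro hy
      exact ⟨⟨hS x hx (mem_cls.2 hy), by rw [cls_eq_iff.2 (s.symm hy)]⟩, s.symm hy⟩
  · rw [mul_zero, card_eq_zero, filter_eq_empty_iff]
    rintro y hy hyx
    rw [mem_filter, hyx] at hy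
    exact h hy.2

lemma cls_join_of_not {s : Setoid V} {a b x : V} (ha : ¬ s x a) (hb : ¬ s x b) :
    cls (join s a b) x = cls s x := by
  ext y
  simp only [mem_cls, join_apply]
  tauto

lemma cls_join_left (s : Setoid V) (a b : V) : cls (join s a b) a = cls s a ∪ cls s b := by
  ext y
  simp only [mem_cls, join_apply, mem_union]
  have := s.refl a
  tauto

lemma disjoint_cls {s : Setoid V} {a b : V} (h : ¬ s a b) : Disjoint (cls s a) (cls s b) := by
  rw [disjoint_left]
  intro x hx hx'
  exact h (s.trans (mem_cls.1 hx) (s.symm (mem_cls.1 hx')))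

lemma card_cls_join {s : Setoid V} {a b : V} (h : ¬ s a b) :
    #(cls (join s a b) a) = #(cls s a) + #(cls s b) := by
  rw [cls_join_left, card_union_of_disjoint (disjoint_cls h)]

/-- Only the classes of `a` and `b` change. The identity is written without subtraction so that it
serves both for counting classes and for exponent vectors. -/
lemma wsum_join {s : Setoid V} {a b : V} (h : ¬ s a b) (w : ℕ → M) :
    wsum univ (join s a b) w + w #(cls s a) + w #(cls s b) =
      wsum univ s w + w (#(cls s a) + #(cls s b)) := by
  set S := univ \ (cls s a ∪ cls s b) with hS
  have hu : (univ : Finset V) = S ∪ (cls s a ∪ cls s b) := by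
    rw [hS, sdiff_union_of_subset (subset_univ _)]
  have hmem : ∀ x ∈ S, ¬ s x a ∧ ¬ s x b := by
    intro x hx
    simp only [hS, mem_sdiff, mem_union, mem_cls, mem_univ, true_and, not_or] at hx
    exact ⟨fun h => hx.1 (s.symm h), fun h => hx.2 (s.symm h)⟩
  have e1 : wsum univ s w = wsum S s w + (w #(cls s a) + w #(cls s b)) := by
    rw [hu, wsum_union, wsum_union, wsum_cls, wsum_cls]
    · intro x hx y hy hxy
      exact h (s.trans (mem_cls.1 hx) (s.trans hxy (s.symm (mem_cls.1 hy))))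
    · intro x hx y hy hxy
      rcases mem_union.1 hy with hy | hy
      · exact (hmem x hx).1 (s.trans hxy (s.symm (mem_cls.1 hy)))
      · exact (hmem x hx).2 (s.trans hxy (s.symm (mem_cls.1 hy)))
  have e2 : wsum univ (join s a b) w = wsum S s w + w (#(cls s a) + #(cls s b)) := by
    rw [← card_cls_join h, ← wsum_cls (join s a b) a w,
      ← wsum_congr (s := join s a b) (fun x hx => cls_join_of_not (hmem x hx).1 (hmem x hx).2),
      ← wsum_union, cls_join_left, ← hu]
    intro x hx y hy hxy
    have hay : join s a b x a := (join s a b).trans hxy ((join s a b).symm (mem_cls.1 hy))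
    have := mem_cls.2 hay
    rw [cls_join_of_not (hmem x hx).1 (hmem x hx).2, mem_cls] at this
    exact (hmem x hx).1 this
  rw [e1, e2]
  abel

/-- The number of classes. -/
noncomputable def numCls (s : Setoid V) : ℕ := wsum univ s fun _ => 1

lemma numCls_join {s : Setoid V} {a b : V} (h : ¬ s a b) :
    numCls (join s a b) + 1 = numCls s := by
  have := wsum_join h (fun _ => 1)
  unfold numCls
  omega

lemma numCls_bot : numCls (⊥ : Setoid V) = Fintype.card V := by
  unfold numCls
  rw [wsum_singletons]
  · simp [Finset.card_univ]
  · intro x _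
    ext y
    simp [eq_comm]

lemma numCls_eq_one_of_top [Nonempty V] : numCls (⊤ : Setoid V) = 1 := by
  obtain ⟨a⟩ := ‹Nonempty V›
  have : (univ : Finset V) = cls ⊤ a := by
    ext; simp [Setoid.top_def]
  unfold numCls
  rw [this, wsum_cls]

end Classes

/-! ### Cycles of a permutation, and the effect of multiplying by a transposition. -/

section Cycles

variable {V : Type*} [Fintype V] [DecidableEq V]

/-- The setoid whose classes are the cycles of `σ`. -/
abbrev sc (σ : Perm V) : Setoid V := SameCycle.setoid σ

lemma sc_apply {σ : Perm V} {x y : V} : sc σ x y ↔ σ.SameCycle x y := Iff.rfl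

/-- On a finite set nonnegative powers of `σ` reach the whole cycle, so single steps suffice. -/
lemma sc_le {σ : Perm V} {s : Setoid V} : sc σ ≤ s ↔ ∀ x, s x (σ x) := by
  constructor
  · intro h x
    exact h (sc_apply.2 (sameCycle_apply_right.2 (SameCycle.refl σ x)))
  · intro h x y hxy
    obtain ⟨i, hi⟩ := SameCycle.exists_nat_pow_eq hxy
    subst hi
    clear hxy
    induction i with
    | zero => exact s.refl x
    | succ i ih => rw [pow_succ', mul_apply]; exact s.trans ih (h _)

lemma sc_self_apply (σ : Perm V) (x : V) : sc σ x (σ x) := sc_le.1 le_rfl x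

lemma sc_pow_apply (σ : Perm V) (x : V) (i : ℕ) : sc σ x ((σ ^ i) x) :=
  sameCycle_pow_right.2 (SameCycle.refl σ x)

/-- The length of the cycle of `σ` through `x`. -/
noncomputable def len (σ : Perm V) (x : V) : ℕ := Function.minimalPeriod σ x

lemma len_pos (σ : Perm V) (x : V) : 0 < len σ x :=
  Function.minimalPeriod_pos_of_mem_periodicPts
    (Function.Injective.mem_periodicPts σ.injective x)

lemma pow_len_apply (σ : Perm V) (x : V) : (σ ^ len σ x) x = x := by
  rw [← iterate_eq_pow]
  exact Function.iterate_minimalPeriod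

lemma pow_apply_injOn {σ : Perm V} {x : V} {i j : ℕ} (hi : i < len σ x) (hj : j < len σ x)
    (h : (σ ^ i) x = (σ ^ j) x) : i = j := by
  rw [← iterate_eq_pow, ← iterate_eq_pow] at h
  exact (Function.iterate_eq_iterate_iff_of_lt_minimalPeriod hi hj).1 h

lemma pow_mod_len (σ : Perm V) (x : V) (i : ℕ) : (σ ^ (i % len σ x)) x = (σ ^ i) x := by
  rw [← iterate_eq_pow, ← iterate_eq_pow]
  exact Function.iterate_mod_minimalPeriod_eq

lemma exists_pow_lt_len {σ : Perm V} {x y : V} (h : sc σ x y) :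
    ∃ i < len σ x, (σ ^ i) x = y := by
  obtain ⟨i, rfl⟩ := SameCycle.exists_nat_pow_eq h
  exact ⟨i % len σ x, Nat.mod_lt _ (len_pos σ x), pow_mod_len σ x i⟩

lemma cls_sc (σ : Perm V) (x : V) :
    cls (sc σ) x = (range (len σ x)).image fun i => (σ ^ i) x := by
  ext y
  simp only [mem_cls, mem_image, mem_range]
  constructor
  · exact exists_pow_lt_len
  · rintro ⟨i, -, rfl⟩
    exact sc_pow_apply σ x i

lemma card_cls_sc (σ : Perm V) (x : V) : #(cls (sc σ) x) = len σ x := by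
  rw [cls_sc, card_image_of_injOn, card_range]
  intro i hi j hj h
  exact pow_apply_injOn (mem_range.1 hi) (mem_range.1 hj) h

lemma len_eq_of_sc {σ : Perm V} {x y : V} (h : sc σ x y) : len σ x = len σ y := by
  rw [← card_cls_sc, ← card_cls_sc, cls_eq_iff.2 h]

lemma len_eq_of {σ : Perm V} {x : V} {L : ℕ} (hL : 0 < L) (h : (σ ^ L) x = x)
    (hn : ∀ i, 0 < i → i < L → (σ ^ i) x ≠ x) : len σ x = L := by
  refine le_antisymm ?_ ?_
  · apply Function.IsPeriodicPt.minimalPeriod_le hL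
    rw [Function.IsPeriodicPt, Function.IsFixedPt, iterate_eq_pow]
    exact h
  · by_contra! hlt
    exact hn _ (len_pos σ x) hlt (pow_len_apply σ x)

lemma pow_apply_sub {σ : Perm V} {a b : V} {s : ℕ} (hs : s < len σ a) (h : (σ ^ s) a = b) :
    (σ ^ (len σ a - s)) b = a := by
  rw [← h, ← mul_apply, ← pow_add, Nat.sub_add_cancel hs.le, pow_len_apply]

/-- Multiplication by `swap a b` does not change an initial segment of an orbit that avoids
`a` and `b`. -/
lemma swap_mul_pow_apply {σ : Perm V} {a b x : V} {L : ℕ}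
    (h : ∀ i, 0 < i → i < L → (σ ^ i) x ≠ a ∧ (σ ^ i) x ≠ b) {i : ℕ} (hi : i < L) :
    ((swap a b * σ) ^ i) x = (σ ^ i) x := by
  induction i with
  | zero => rfl
  | succ i ih =>
    have := h (i + 1) (Nat.succ_pos _) hi
    rw [pow_succ', mul_apply, ih (by omega), mul_apply, ← mul_apply σ, ← pow_succ',
      swap_apply_of_ne_of_ne this.1 this.2]

lemma swap_mul_pow_apply_end {σ : Perm V} {a b x : V} {L : ℕ} (hL : 0 < L)
    (h : ∀ i, 0 < i → i < L → (σ ^ i) x ≠ a ∧ (σ ^ i) x ≠ b) :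
    ((swap a b * σ) ^ L) x = swap a b ((σ ^ L) x) := by
  obtain ⟨L, rfl⟩ : ∃ k, L = k + 1 := ⟨L - 1, by omega⟩
  rw [pow_succ', mul_apply, swap_mul_pow_apply h (Nat.lt_succ_self L), mul_apply, ← mul_apply σ,
    ← pow_succ']

section Cut

variable {σ : Perm V} {a b : V} {s : ℕ}

lemma cut_avoid (hs' : s < len σ a) (hb : (σ ^ s) a = b) :
    ∀ i, 0 < i → i < s → (σ ^ i) a ≠ a ∧ (σ ^ i) a ≠ b := by
  intro i hi his
  constructor
  · intro h
    have := pow_apply_injOn (i := i) (j := 0) (by omega) (len_pos σ a) h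
    omega
  · intro h
    have := pow_apply_injOn (i := i) (j := s) (by omega) (by omega) (h.trans hb.symm)
    omega

lemma cut_pow_apply (hs' : s < len σ a) (hb : (σ ^ s) a = b) {i : ℕ}
    (hi : i < s) : ((swap a b * σ) ^ i) a = (σ ^ i) a :=
  swap_mul_pow_apply (cut_avoid hs' hb) hi

/-- The last point of the arc from `a` to `b` is sent back to `a` instead of to `b`, so this arc
closes up. -/
lemma cut_len_left (hs : 0 < s) (hs' : s < len σ a) (hb : (σ ^ s) a = b) :
    len (swap a b * σ) a = s := by
  apply len_eq_of hs
  · rw [swap_mul_pow_apply_end hs (cut_avoid hs' hb), hb, swap_apply_right]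
  · intro i hi his
    rw [cut_pow_apply hs' hb his]
    exact (cut_avoid hs' hb i hi his).1

/-- The situation is symmetric in `a` and `b`: going on from `b`, the point `a` comes after `len σ a
- s` steps. -/
lemma cut_pow_apply_right (hs : 0 < s) (hs' : s < len σ a) (hb : (σ ^ s) a = b) {i : ℕ}
    (hi : i < len σ a - s) : ((swap a b * σ) ^ i) b = (σ ^ i) b := by
  have hl : len σ a = len σ b := len_eq_of_sc (hb ▸ sc_pow_apply σ a s)
  rw [swap_comm]
  exact cut_pow_apply (by omega) (pow_apply_sub hs' hb) hi

lemma cut_len_right (hs : 0 < s) (hs' : s < len σ a) (hb : (σ ^ s) a = b) :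
    len (swap a b * σ) b = len σ a - s := by
  have hl : len σ a = len σ b := len_eq_of_sc (hb ▸ sc_pow_apply σ a s)
  rw [swap_comm]
  exact cut_len_left (by omega) (by omega) (pow_apply_sub hs' hb)

lemma cut_not_sc (hs : 0 < s) (hs' : s < len σ a) (hb : (σ ^ s) a = b) :
    ¬ sc (swap a b * σ) a b := by
  intro h
  obtain ⟨i, hi, hib⟩ := exists_pow_lt_len h
  rw [cut_len_left hs hs' hb] at hi
  rw [cut_pow_apply hs' hb hi, ← hb] at hib
  have := pow_apply_injOn (by omega) hs' hib
  omega

end Cut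

lemma swap_mul_not_sc {σ : Perm V} {a b : V} (hab : a ≠ b) (h : sc σ a b) :
    ¬ sc (swap a b * σ) a b := by
  obtain ⟨i, hi, hib⟩ := exists_pow_lt_len h
  have : 0 < i := by
    rcases Nat.eq_zero_or_pos i with rfl | h
    · exact absurd hib hab
    · exact h
  exact cut_not_sc this hi hib

lemma sc_swap_mul_le (σ : Perm V) (a b : V) : sc (swap a b * σ) ≤ join (sc σ) a b := by
  rw [sc_le]
  intro x
  rw [mul_apply]
  by_cases ha : σ x = a
  · rw [ha, swap_apply_left]
    exact Or.inr (Or.inl ⟨ha ▸ sc_self_apply σ x, (sc σ).refl b⟩)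
  · by_cases hb : σ x = b
    · rw [hb, swap_apply_right]
      exact Or.inr (Or.inr ⟨hb ▸ sc_self_apply σ x, (sc σ).refl a⟩)
    · rw [swap_apply_of_ne_of_ne ha hb]
      exact Or.inl (sc_self_apply σ x)

section Join

variable {σ : Perm V} {a b : V}

lemma join_avoid (h : ¬ sc σ a b) :
    ∀ i, 0 < i → i < len σ a → (σ ^ i) a ≠ a ∧ (σ ^ i) a ≠ b := by
  intro i hi hil
  constructor
  · intro h
    have := pow_apply_injOn (i := i) (j := 0) hil (len_pos σ a) h
    omega
  · rintro rfl
    exact h (sc_pow_apply σ a i)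

lemma join_pow_apply (h : ¬ sc σ a b) {i : ℕ} (hi : i < len σ a) :
    ((swap a b * σ) ^ i) a = (σ ^ i) a :=
  swap_mul_pow_apply (join_avoid h) hi

lemma join_pow_apply_right (h : ¬ sc σ a b) {i : ℕ} (hi : i < len σ b) :
    ((swap a b * σ) ^ i) b = (σ ^ i) b := by
  rw [swap_comm]
  exact join_pow_apply (fun h' => h ((sc σ).symm h')) hi

/-- After one turn around the old cycle of `a`, the return to `a` is redirected to `b`. -/
lemma join_pow_len (h : ¬ sc σ a b) : ((swap a b * σ) ^ len σ a) a = b := by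
  rw [swap_mul_pow_apply_end (len_pos σ a) (join_avoid h), pow_len_apply, swap_apply_left]

lemma sc_le_of_join (h : ¬ sc σ a b) {x : V} (hx : σ x = a) : sc (swap a b * σ) x a := by
  have hax : sc σ a x := by
    have := sc_self_apply σ x
    rw [hx] at this
    exact (sc σ).symm this
  obtain ⟨i, hi, rfl⟩ := exists_pow_lt_len hax
  rw [← join_pow_apply h hi]
  exact (sc _).symm (sc_pow_apply _ _ _)

/-- The inclusion `≤` needs no hypothesis. For the other one only the predecessors of `a` and `b`
matter, and each of them is still reached from `a` or `b` along its old cycle. -/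
lemma sc_swap_mul (h : ¬ sc σ a b) : sc (swap a b * σ) = join (sc σ) a b := by
  refine le_antisymm (sc_swap_mul_le σ a b) (join_le.2 ⟨sc_le.2 fun x => ?_, ?_⟩)
  · by_cases ha : σ x = a
    · rw [ha]
      exact sc_le_of_join h ha
    · by_cases hb : σ x = b
      · rw [hb, swap_comm]
        exact sc_le_of_join (fun h' => h ((sc σ).symm h')) hb
      · have := sc_self_apply (swap a b * σ) x
        rwa [mul_apply, swap_apply_of_ne_of_ne ha hb] at this
  · have := sc_pow_apply (swap a b * σ) a (len σ a)
    rwa [join_pow_len h] at this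

lemma join_len (h : ¬ sc σ a b) : len (swap a b * σ) a = len σ a + len σ b := by
  rw [← card_cls_sc, sc_swap_mul h, card_cls_join h, card_cls_sc, card_cls_sc]

/-- Cutting is undone by joining: the swap is an involution, and after the cut `a` and `b` are on
different cycles. -/
lemma join_sc_swap_mul (hab : a ≠ b) (h : sc σ a b) : sc σ = join (sc (swap a b * σ)) a b := by
  rw [← sc_swap_mul (swap_mul_not_sc hab h), swap_mul_self_mul]

end Join

end Cycles

/-! ### Multiplication by a 3-cycle: cutting, joining and exchanging cycles. -/

section Triples

variable {V : Type*} [Fintype V] [DecidableEq V]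

/-- The 3-cycle `a ↦ b ↦ c ↦ a`. -/
def tri (a b c : V) : Perm V := swap a b * swap b c

lemma formPerm_eq_tri (a b c : V) : [a, b, c].formPerm = tri a b c := by
  simp [tri, List.formPerm_cons_cons]

lemma tri_inv (a b c : V) : (tri a b c)⁻¹ = tri c b a := by
  simp [tri, swap_comm]

lemma tri_apply_left {a b c : V} (hab : a ≠ b) (hac : a ≠ c) : tri a b c a = b := by
  rw [tri, mul_apply, swap_apply_of_ne_of_ne hab hac, swap_apply_left]

lemma tri_apply_mid {a b c : V} (hac : a ≠ c) (hbc : b ≠ c) : tri a b c b = c := by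
  rw [tri, mul_apply, swap_apply_left, swap_apply_of_ne_of_ne hac.symm hbc.symm]

lemma tri_apply_right (a b c : V) : tri a b c c = a := by
  rw [tri, mul_apply, swap_apply_right, swap_apply_right]

lemma tri_apply_of_ne {a b c x : V} (ha : x ≠ a) (hb : x ≠ b) (hc : x ≠ c) : tri a b c x = x := by
  rw [tri, mul_apply, swap_apply_of_ne_of_ne hb hc, swap_apply_of_ne_of_ne ha hb]

lemma isThreeCycle_tri {a b c : V} (hab : a ≠ b) (hac : a ≠ c) (hbc : b ≠ c) :
    (tri a b c).IsThreeCycle := by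
  rw [tri, swap_comm a b]
  exact isThreeCycle_swap_mul_swap_same hab.symm hbc hac

lemma exists_tri {ω : Perm V} (h : ω.IsThreeCycle) :
    ∃ a b c : V, a ≠ b ∧ a ≠ c ∧ b ≠ c ∧ ω = tri a b c := by
  have hne : ω.support.Nonempty := by
    rw [← card_pos, h.card_support]
    norm_num
  obtain ⟨a, ha⟩ := hne
  have hn := h.nodup_iff_mem_support.2 ha
  simp only [List.nodup_cons, List.mem_cons, List.not_mem_nil, or_false, not_or] at hn
  exact ⟨a, ω a, ω (ω a), hn.1.1, hn.1.2, hn.2.1, h.eq_swap_mul_swap_iff_mem_support.2 ha⟩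

lemma tri_rotate {a b c : V} (hab : a ≠ b) (hac : a ≠ c) (hbc : b ≠ c) :
    tri a b c = tri b c a := by
  ext x
  by_cases ha : x = a
  · subst ha; rw [tri_apply_left hab hac, tri_apply_right]
  by_cases hb : x = b
  · subst hb; rw [tri_apply_mid hac hbc, tri_apply_left hbc hab.symm]
  by_cases hc : x = c
  · subst hc; rw [tri_apply_right, tri_apply_mid hab.symm hac.symm]
  rw [tri_apply_of_ne ha hb hc, tri_apply_of_ne hb hc ha]

lemma mem_support_tri {a b c : V} (hab : a ≠ b) (hac : a ≠ c) (hbc : b ≠ c) {x : V} :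
    x ∈ (tri a b c).support ↔ x = a ∨ x = b ∨ x = c := by
  rw [mem_support]
  constructor
  · intro h
    by_contra! h'
    exact h (tri_apply_of_ne h'.1 h'.2.1 h'.2.2)
  · rintro (rfl | rfl | rfl)
    · rw [tri_apply_left hab hac]; exact hab.symm
    · rw [tri_apply_mid hac hbc]; exact hbc.symm
    · rw [tri_apply_right]; exact hac

lemma tri_eq_tri {a b c x y z : V} (hab : a ≠ b) (hac : a ≠ c) (hbc : b ≠ c) (hxy : x ≠ y)
    (hxz : x ≠ z) (hyz : y ≠ z) (h : tri x y z = tri a b c) :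
    (x = a ∧ y = b ∧ z = c) ∨ (x = b ∧ y = c ∧ z = a) ∨ (x = c ∧ y = a ∧ z = b) := by
  have hx : x = a ∨ x = b ∨ x = c := by
    rw [← mem_support_tri hab hac hbc, ← h, mem_support_tri hxy hxz hyz]
    exact Or.inl rfl
  have h1 := tri_apply_left hxy hxz
  have h2 := tri_apply_mid hxz hyz
  rw [h] at h1 h2
  rcases hx with rfl | rfl | rfl
  · rw [tri_apply_left hab hac] at h1
    subst h1
    rw [tri_apply_mid hac hbc] at h2
    exact Or.inl ⟨rfl, rfl, h2.symm⟩
  · rw [tri_apply_mid hac hbc] at h1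
    subst h1
    rw [tri_apply_right] at h2
    exact Or.inr (Or.inl ⟨rfl, rfl, h2.symm⟩)
  · rw [tri_apply_right] at h1
    subst h1
    rw [tri_apply_left hab hac] at h2
    exact Or.inr (Or.inr ⟨rfl, rfl, h2.symm⟩)

/-- The points `a, b, c` are distinct, lie on one cycle of `σ` and occur on it in this order. -/
def CyclicOrder (σ : Perm V) (a b c : V) : Prop :=
  ∃ s t : ℕ, 0 < s ∧ s < t ∧ t < len σ a ∧ (σ ^ s) a = b ∧ (σ ^ t) a = c

lemma pow_apply_sub' {σ : Perm V} {a b c : V} {s t : ℕ} (hst : s < t) (hb : (σ ^ s) a = b)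
    (hc : (σ ^ t) a = c) : (σ ^ (t - s)) b = c := by
  rw [← hb, ← hc, ← mul_apply, ← pow_add, Nat.sub_add_cancel hst.le]

/-- A 3-cycle cuts a cycle into three. -/
lemma tri_cut {σ : Perm V} {a b c : V} {s t : ℕ} (hs : 0 < s) (hst : s < t) (ht : t < len σ a)
    (hb : (σ ^ s) a = b) (hc : (σ ^ t) a = c) :
    (¬ sc (tri c b a * σ) a b ∧ ¬ sc (tri c b a * σ) b c ∧ ¬ sc (tri c b a * σ) a c) ∧
    len (tri c b a * σ) a = s ∧ len (tri c b a * σ) b = t - s ∧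
      len (tri c b a * σ) c = len σ a - t := by
  -- Two cuts in succession: the first separates the arc from `a` to `b`; then `c` lies on the
  -- remaining cycle, `t - s` steps after `b`, and the second cut splits that cycle.
  have hσ : tri c b a * σ = swap b c * (swap a b * σ) := by
    rw [tri, mul_assoc, swap_comm b a, swap_comm c b]
  rw [hσ]
  set σ₁ := swap a b * σ with hσ₁
  have n1 : ¬ sc σ₁ a b := cut_not_sc hs (hst.trans ht) hb
  have l1 : len σ₁ a = s := cut_len_left hs (hst.trans ht) hb
  have l2 : len σ₁ b = len σ a - s := cut_len_right hs (hst.trans ht) hb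
  have p1 : (σ₁ ^ (t - s)) b = c := by
    rw [hσ₁, cut_pow_apply_right hs (hst.trans ht) hb (by omega)]
    exact pow_apply_sub' hst hb hc
  have n2 : ¬ sc (swap b c * σ₁) b c := cut_not_sc (by omega) (by omega) p1
  have hbc : b ≠ c := by
    rintro rfl
    exact n2 ((sc _).refl b)
  have hj := join_sc_swap_mul hbc (p1 ▸ sc_pow_apply σ₁ b _)
  have n3 : ¬ sc σ₁ a c := fun h => n1 ((sc _).trans h ((sc _).symm (p1 ▸ sc_pow_apply σ₁ b _)))
  have hle : sc (swap b c * σ₁) ≤ sc σ₁ := by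
    conv_rhs => rw [hj]
    exact le_join _ _ _
  refine ⟨⟨fun h => n1 (hle h), n2, fun h => n3 (hle h)⟩, ?_,
    cut_len_left (by omega) (by omega) p1, ?_⟩
  · rw [← l1, ← card_cls_sc, ← card_cls_sc]
    conv_rhs => rw [hj]
    rw [cls_join_of_not (fun h => n1 (hle h)) (fun h => n3 (hle h))]
  · rw [cut_len_right (by omega) (by omega) p1]
    omega

lemma sc_tri_mul {σ : Perm V} {a b c : V} (hab : ¬ sc σ a b) (hbc : ¬ sc σ b c)
    (hac : ¬ sc σ a c) : sc (tri a b c * σ) = join (join (sc σ) b c) a b := by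
  rw [tri, mul_assoc, sc_swap_mul, sc_swap_mul hbc]
  rw [sc_swap_mul hbc]
  rintro (h | ⟨h, -⟩ | ⟨h, -⟩) <;> tauto

lemma not_join_of_not {s : Setoid V} {a b c : V} (hab : ¬ s a b) (hac : ¬ s a c) :
    ¬ join s b c a b := by
  rintro (h | ⟨h, -⟩ | ⟨h, -⟩) <;> tauto

/-- A 3-cycle joins three cycles into one. -/
lemma tri_join {σ : Perm V} {a b c : V} (hab : ¬ sc σ a b) (hbc : ¬ sc σ b c)
    (hac : ¬ sc σ a c) : CyclicOrder (tri a b c * σ) a b c := by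
  rw [tri, mul_assoc]
  set σ₁ := swap b c * σ with hσ₁
  have hsc : sc σ₁ = join (sc σ) b c := sc_swap_mul hbc
  have n1 : ¬ sc σ₁ a b := by
    rw [hsc]
    exact not_join_of_not hab hac
  have l1 : len σ₁ b = len σ b + len σ c := join_len hbc
  have p1 : (σ₁ ^ len σ b) b = c := join_pow_len hbc
  have l2 := join_len n1
  have hb := len_pos σ b
  have hc := len_pos σ c
  refine ⟨len σ₁ a, len σ b + len σ₁ a, len_pos _ _, by omega, by omega, join_pow_len n1, ?_⟩
  rw [pow_add, mul_apply, join_pow_len n1, join_pow_apply_right n1 (by omega), p1]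

/-- `tri c b a` is the inverse of `tri a b c`, so `tri_cut` and `tri_join` are converse to each
other. -/
lemma cyclicOrder_tri_mul {σ : Perm V} {a b c : V} :
    CyclicOrder (tri a b c * σ) a b c ↔ ¬ sc σ a b ∧ ¬ sc σ b c ∧ ¬ sc σ a c := by
  constructor
  · rintro ⟨s, t, hs, hst, ht, hb, hc⟩
    have := (tri_cut hs hst ht hb hc).1
    rwa [← tri_inv, inv_mul_cancel_left] at this
  · rintro ⟨h1, h2, h3⟩
    exact tri_join h1 h2 h3

lemma cyclicOrder_iff {σ : Perm V} {a b c : V} :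
    CyclicOrder σ c b a ↔ ¬ sc (tri a b c * σ) a b ∧ ¬ sc (tri a b c * σ) b c ∧
      ¬ sc (tri a b c * σ) a c := by
  have := cyclicOrder_tri_mul (σ := tri a b c * σ) (a := c) (b := b) (c := a)
  rw [← tri_inv, inv_mul_cancel_left] at this
  rw [this]
  have sy : ∀ {x y}, sc (tri a b c * σ) x y ↔ sc (tri a b c * σ) y x :=
    ⟨(sc _).symm, (sc _).symm⟩
  rw [sy (x := c) (y := b), sy (x := b) (y := a), sy (x := c) (y := a)]
  tauto

variable {M : Type*} [AddCommMonoid M] [IsCancelAdd M]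

/-- Two joins in succession. The intermediate cycle of length `len σ b + len σ c` is created and
used up again, which is why cancellation is assumed. -/
lemma wsum_tri_of_not {σ : Perm V} {a b c : V} (hab : ¬ sc σ a b) (hbc : ¬ sc σ b c)
    (hac : ¬ sc σ a c) (w : ℕ → M) :
    wsum univ (sc (tri a b c * σ)) w + w (len σ a) + w (len σ b) + w (len σ c) =
      wsum univ (sc σ) w + w (len σ a + len σ b + len σ c) := by
  rw [sc_tri_mul hab hbc hac]
  have h1 := wsum_join hbc w
  have h2 := wsum_join (not_join_of_not hab hac) w
  rw [cls_join_of_not hab hac, card_cls_join hbc] at h2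
  simp only [card_cls_sc] at h1 h2
  apply add_right_cancel (b := w (len σ b + len σ c))
  calc _ = (wsum univ (join (join (sc σ) b c) a b) w + w (len σ a) + w (len σ b + len σ c)) +
        (w (len σ b) + w (len σ c)) := by abel
    _ = (wsum univ (join (sc σ) b c) w + w (len σ b) + w (len σ c)) +
        w (len σ a + (len σ b + len σ c)) := by rw [h2]; abel
    _ = _ := by rw [h1, add_assoc (len σ a)]; abel

/-- The identity for joining, applied to the permutation after the cut and read backwards. -/
lemma wsum_tri_cut {σ : Perm V} {a b c : V} {s t : ℕ} (hs : 0 < s) (hst : s < t)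
    (ht : t < len σ a) (hb : (σ ^ s) a = b) (hc : (σ ^ t) a = c) (w : ℕ → M) :
    wsum univ (sc (tri c b a * σ)) w + w (len σ a) =
      wsum univ (sc σ) w + w s + w (t - s) + w (len σ a - t) := by
  obtain ⟨⟨h1, h2, h3⟩, l1, l2, l3⟩ := tri_cut hs hst ht hb hc
  have := wsum_tri_of_not h1 h2 h3 w
  rw [← tri_inv c b a, inv_mul_cancel_left, l1, l2, l3,
    show s + (t - s) + (len σ a - t) = len σ a by omega] at this
  exact this.symm

lemma sc_swap_mul_le_self {σ : Perm V} {a b : V} (h : sc σ a b) : sc (swap a b * σ) ≤ sc σ := by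
  have := sc_swap_mul_le σ a b
  rwa [join_eq_self h] at this

/-- A 3-cycle moves a part of one cycle to another cycle. -/
lemma sc_tri_mul_exchange {σ : Perm V} {a b c : V} (hbc : b ≠ c) :
    (sc (tri a b c * σ) b a ∧ ¬ sc (tri a b c * σ) c b) ∧ a ≠ b ↔ sc σ c b ∧ ¬ sc σ c a := by
  constructor
  · rintro ⟨⟨h1, h2⟩, hab⟩
    have hσ : σ = swap b c * (swap a b * (tri a b c * σ)) := by
      rw [tri, mul_assoc, swap_mul_self_mul, swap_mul_self_mul]
    set ρ := tri a b c * σ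
    have h1' : sc ρ a b := (sc ρ).symm h1
    have hle := sc_swap_mul_le_self h1'
    have n1 := swap_mul_not_sc hab h1'
    have n2 : ¬ sc (swap a b * ρ) b c := fun h => h2 ((sc ρ).symm (hle h))
    rw [hσ, sc_swap_mul n2]
    refine ⟨(join _ _ _).symm (join_pair _ _ _), ?_⟩
    rintro (h | ⟨h, -⟩ | ⟨-, h⟩)
    · exact h2 ((sc ρ).trans (hle h) h1')
    · exact n2 ((sc _).symm h)
    · exact n1 ((sc _).symm h)
  -- `swap b c` cuts the common cycle of `b` and `c`; `swap a b` then attaches the piece of `b` to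
  -- the cycle of `a`. The other direction undoes these two steps.
  · rintro ⟨h1, h2⟩
    have hab : a ≠ b := by
      rintro rfl
      exact h2 h1
    refine ⟨?_, hab⟩
    have h1' : sc σ b c := (sc σ).symm h1
    rw [tri, mul_assoc]
    have hle := sc_swap_mul_le_self h1'
    have n1 := swap_mul_not_sc hbc h1'
    have n2 : ¬ sc (swap b c * σ) a b :=
      fun h => h2 ((sc σ).trans h1 ((sc σ).symm (hle h)))
    rw [sc_swap_mul n2]
    refine ⟨(join _ _ _).symm (join_pair _ _ _), ?_⟩
    rintro (h | ⟨h, -⟩ | ⟨h, -⟩)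
    · exact n1 ((sc _).symm h)
    · exact h2 (hle h)
    · exact n1 ((sc _).symm h)

/-- The arc from `c` to `b`, of length `s`, closes up, and the other arc, of length `len σ c - s`,
goes to the cycle of `a`. -/
lemma wsum_tri_exchange {σ : Perm V} {a b c : V} {s : ℕ} (hs : 0 < s)
    (hsc : s < len σ c) (hb : (σ ^ s) c = b) (hac : ¬ sc σ c a) (w : ℕ → M) :
    wsum univ (sc (tri a b c * σ)) w + w (len σ a) + w (len σ c) =
      wsum univ (sc σ) w + w s + w (len σ a + (len σ c - s)) := by
  have h1 : sc σ c b := hb ▸ sc_pow_apply σ c s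
  have hcb : c ≠ b := by
    rintro rfl
    have := pow_apply_injOn (i := s) (j := 0) hsc (len_pos _ _) hb
    omega
  rw [tri, mul_assoc, swap_comm b c]
  have hle := sc_swap_mul_le_self h1
  have n1 := swap_mul_not_sc hcb h1
  have n2 : ¬ sc (swap c b * σ) a b :=
    fun h => hac ((sc σ).trans h1 ((sc σ).symm (hle h)))
  have n3 : ¬ sc (swap c b * σ) a c := fun h => hac ((sc σ).symm (hle h))
  have hj := join_sc_swap_mul hcb h1
  rw [sc_swap_mul n2]
  have e1 := wsum_join n2 w
  have e2 := wsum_join n1 w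
  rw [← hj, card_cls_sc, card_cls_sc, cut_len_left hs hsc hb, cut_len_right hs hsc hb] at e2
  have ha : #(cls (sc (swap c b * σ)) a) = len σ a := by
    rw [← card_cls_sc σ]
    conv_rhs => rw [hj]
    rw [cls_join_of_not n3 n2]
  rw [ha, card_cls_sc, cut_len_right hs hsc hb] at e1
  rw [show s + (len σ c - s) = len σ c by omega] at e2
  apply add_right_cancel (b := w (len σ c - s))
  calc _ = (wsum univ (join (sc (swap c b * σ)) a b) w + w (len σ a) + w (len σ c - s)) +
        w (len σ c) := by abel
    _ = (wsum univ (sc (swap c b * σ)) w + w (len σ c)) + w (len σ a + (len σ c - s)) := by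
      rw [e1]; abel
    _ = _ := by rw [← e2]; abel

end Triples

/-! ### The defect of a list of 3-cycles and its monotonicity. -/

section Defect

variable {V : Type*} [Fintype V] [DecidableEq V]

/-- The orbits of the group generated by the members of a list. -/
def orb : List (Perm V) → Setoid V
  | [] => ⊥
  | g :: τ => orb τ ⊔ sc g

lemma sc_mul_le (g h : Perm V) : sc (g * h) ≤ sc h ⊔ sc g := by
  rw [sc_le]
  intro x
  exact (sc h ⊔ sc g).trans (le_sup_left (a := sc h) (sc_self_apply h x))
    (le_sup_right (a := sc h) (sc_self_apply g (h x)))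

lemma sc_prod_le_orb (τ : List (Perm V)) : sc τ.prod ≤ orb τ := by
  induction τ with
  | nil =>
    rw [sc_le]
    exact fun x => Setoid.refl' _ x
  | cons g τ ih =>
    rw [List.prod_cons]
    exact (sc_mul_le _ _).trans (sup_le_sup_right ih _)

lemma sup_sc_tri {a b c : V} (hab : a ≠ b) (hac : a ≠ c) (hbc : b ≠ c) (s : Setoid V) :
    s ⊔ sc (tri a b c) = join (join s b c) a b := by
  apply le_antisymm
  · refine sup_le ((le_join _ _ _).trans (le_join _ _ _)) (sc_le.2 fun x => ?_)
    have h1 : join (join s b c) a b a b := join_pair _ _ _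
    have h2 : join (join s b c) a b b c := le_join _ _ _ (join_pair _ _ _)
    by_cases ha : x = a
    · subst ha; rwa [tri_apply_left hab hac]
    by_cases hb : x = b
    · subst hb; rwa [tri_apply_mid hac hbc]
    by_cases hc : x = c
    · subst hc; rw [tri_apply_right]; exact Setoid.symm' _ (Setoid.trans' _ h1 h2)
    rw [tri_apply_of_ne ha hb hc]
  · refine join_le.2 ⟨join_le.2 ⟨le_sup_left, le_sup_right (a := s) ?_⟩,
      le_sup_right (a := s) ?_⟩
    · have := sc_self_apply (tri a b c) b
      rwa [tri_apply_mid hac hbc] at this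
    · have := sc_self_apply (tri a b c) a
      rwa [tri_apply_left hab hac] at this

lemma orb_tri_cons {a b c : V} (hab : a ≠ b) (hac : a ≠ c) (hbc : b ≠ c) (τ : List (Perm V)) :
    orb (tri a b c :: τ) = join (join (orb τ) b c) a b := sup_sc_tri hab hac hbc _

/-- Twice the defect in the Riemann-Hurwitz inequality for a list of 3-cycles. -/
noncomputable def defect (τ : List (Perm V)) : ℤ :=
  2 * τ.length + 2 * numCls (orb τ) - Fintype.card V - numCls (sc τ.prod)

lemma defect_nil : defect ([] : List (Perm V)) = 0 := by
  have : sc (1 : Perm V) = ⊥ := by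
    rw [eq_bot_iff, sc_le]
    exact fun x => Setoid.refl' _ x
  simp only [defect, orb, List.length_nil, List.prod_nil, this, numCls_bot]
  push_cast
  ring

/-- A 3-cycle can be put in front of a factorization without increasing the defect. -/
def Tight (s : Setoid V) (σ : Perm V) (a b c : V) : Prop :=
  (s b c → sc σ b c) ∧ (join s b c a b → sc (swap b c * σ) a b)

/-- A cut adds a cycle and keeps the classes of `s`; joining cycles from two classes loses one cycle
and one class. Both give equality. Joining two cycles inside one class makes the two sides differ by
2. -/
lemma swap_step {s : Setoid V} {σ : Perm V} (hs : sc σ ≤ s) {a b : V} (hab : a ≠ b) :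
    2 * (numCls s : ℤ) - numCls (sc σ) ≤
      2 * (numCls (join s a b) : ℤ) - numCls (sc (swap a b * σ)) + 1 ∧
    (2 * (numCls s : ℤ) - numCls (sc σ) =
      2 * (numCls (join s a b) : ℤ) - numCls (sc (swap a b * σ)) + 1 ↔ (s a b → sc σ a b)) := by
  by_cases h : sc σ a b
  · have h1 := numCls_join (swap_mul_not_sc hab h)
    rw [← join_sc_swap_mul hab h] at h1
    rw [join_eq_self (hs h)]
    constructor
    · omega
    · constructor
      · intro _ _
        exact h
      · omega
  · have h1 := numCls_join h
    rw [← sc_swap_mul h] at h1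
    by_cases h' : s a b
    · rw [join_eq_self h']
      constructor
      · omega
      · constructor
        · omega
        · intro h''
          exact absurd (h'' h') h
    · have h2 := numCls_join h'
      constructor
      · omega
      · constructor
        · intro _ h''
          exact absurd h'' h'
        · omega

/-- The new member adds 2 through the length, and each of its two transpositions takes back at most
1. The two clauses of `Tight` are the two cases of equality in `swap_step`. -/
lemma defect_tri_cons {a b c : V} (hab : a ≠ b) (hac : a ≠ c) (hbc : b ≠ c)
    (τ : List (Perm V)) : defect τ ≤ defect (tri a b c :: τ) ∧
      (defect τ = defect (tri a b c :: τ) ↔ Tight (orb τ) τ.prod a b c) := by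
  have h1 := swap_step (sc_prod_le_orb τ) hbc
  have hle : sc (swap b c * τ.prod) ≤ join (orb τ) b c :=
    (sc_swap_mul_le _ _ _).trans
      (join_le.2 ⟨(sc_prod_le_orb τ).trans (le_join _ _ _), join_pair _ _ _⟩)
  have h2 := swap_step hle hab
  have hσ : (tri a b c :: τ).prod = swap a b * (swap b c * τ.prod) := by
    rw [List.prod_cons, tri, mul_assoc]
  simp only [Tight, ← h1.2, ← h2.2, defect, orb_tri_cons hab hac hbc, hσ, List.length_cons]
  have h3 := h1.1
  have h4 := h2.1
  push_cast
  constructor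
  · linarith
  · constructor
    · intro h
      constructor <;> linarith
    · rintro ⟨h5, h6⟩
      linarith

lemma defect_nonneg {τ : List (Perm V)} (h : ∀ ω ∈ τ, ω.IsThreeCycle) : 0 ≤ defect τ := by
  induction τ with
  | nil => rw [defect_nil]
  | cons g τ ih =>
    obtain ⟨a, b, c, hab, hac, hbc, rfl⟩ := exists_tri (h g List.mem_cons_self)
    exact (ih fun ω hω => h ω (List.mem_cons_of_mem _ hω)).trans
      (defect_tri_cons hab hac hbc τ).1

lemma defect_cons_eq_zero {a b c : V} (hab : a ≠ b) (hac : a ≠ c) (hbc : b ≠ c)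
    {τ : List (Perm V)} (h : ∀ ω ∈ τ, ω.IsThreeCycle) :
    defect (tri a b c :: τ) = 0 ↔ defect τ = 0 ∧ Tight (orb τ) τ.prod a b c := by
  have h1 := defect_tri_cons hab hac hbc τ
  have h2 := defect_nonneg h
  rw [← h1.2]
  constructor
  · intro h3
    constructor <;> linarith [h1.1]
  · rintro ⟨h3, h4⟩
    linarith

lemma orb_eq_top_iff (τ : List (Perm V)) :
    MulAction.IsPretransitive (Subgroup.closure {ω | ω ∈ τ}) V ↔ orb τ = ⊤ := by
  have key : ∀ x y, orb τ x y ↔ ∃ g ∈ Subgroup.closure {ω | ω ∈ τ}, g x = y := by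
    intro x y
    constructor
    · intro h
      let t : Setoid V := MulAction.orbitRel (Subgroup.closure {ω | ω ∈ τ}) V
      have hle : ∀ τ' : List (Perm V), (∀ ω ∈ τ', ω ∈ τ) → orb τ' ≤ t := by
        intro τ' h'
        induction τ' with
        | nil => exact bot_le
        | cons g τ' ih =>
          refine sup_le (ih fun ω hω => h' ω (List.mem_cons_of_mem _ hω)) (sc_le.2 fun x => ?_)
          refine Setoid.symm' _ ?_
          exact ⟨⟨g, Subgroup.subset_closure (h' g List.mem_cons_self)⟩, rfl⟩
      obtain ⟨⟨g, hg⟩, hgx⟩ := Setoid.symm' _ (hle τ (fun _ h => h) h)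
      exact ⟨g, hg, hgx⟩
    · rintro ⟨g, hg, rfl⟩
      have hmem : ∀ (τ' : List (Perm V)), ∀ ω ∈ τ', ∀ x, orb τ' x (ω x) := by
        intro τ'
        induction τ' with
        | nil => simp
        | cons g τ' ih =>
          intro ω hω x
          rcases List.mem_cons.1 hω with rfl | hω
          · exact le_sup_right (a := orb τ') (sc_self_apply _ x)
          · exact le_sup_left (b := sc g) (ih ω hω x)
      induction hg using Subgroup.closure_induction generalizing x with
      | mem g hg => exact hmem τ g hg x
      | one => exact Setoid.refl' _ x
      | mul g h _ _ ih1 ih2 => exact Setoid.trans' _ (ih2 x) (ih1 (h x))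
      | inv g _ ih =>
        have := ih (g⁻¹ x)
        rw [show g (g⁻¹ x) = x from g.apply_symm_apply x] at this
        exact Setoid.symm' _ this
  constructor
  · intro h
    rw [eq_top_iff]
    intro x y _
    obtain ⟨⟨g, hg⟩, hgx⟩ := h.exists_smul_eq x y
    exact (key x y).2 ⟨g, hg, hgx⟩
  · intro h
    constructor
    intro x y
    have : orb τ x y := by rw [h]; trivial
    obtain ⟨g, hg, hgx⟩ := (key x y).1 this
    exact ⟨⟨g, hg⟩, hgx⟩

end Defect

/-! ### Transitive factorizations of defect 0 exist for even permutations. -/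

section Existence

variable {V : Type*} [Fintype V] [DecidableEq V]

/-- After the cut at `a` and `b`, the point `c` lies on the arc that starts at `b`. This is the
second clause of `Tight` when a 3-cycle cuts a cycle into three. -/
lemma CyclicOrder.sc_swap {σ : Perm V} {a b c : V} (h : CyclicOrder σ a b c) :
    sc (swap a b * σ) b c := by
  obtain ⟨s, t, hs, hst, ht, hb, hc⟩ := h
  have p1 : ((swap a b * σ) ^ (t - s)) b = c := by
    rw [cut_pow_apply_right hs (hst.trans ht) hb (by omega)]
    exact pow_apply_sub' hst hb hc
  exact p1 ▸ sc_pow_apply _ b _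

lemma CyclicOrder.sc_left {σ : Perm V} {a b c : V} (h : CyclicOrder σ a b c) : sc σ a b := by
  obtain ⟨s, t, hs, hst, ht, hb, hc⟩ := h
  exact hb ▸ sc_pow_apply _ a _

lemma CyclicOrder.sc_right {σ : Perm V} {a b c : V} (h : CyclicOrder σ a b c) : sc σ a c := by
  obtain ⟨s, t, hs, hst, ht, hb, hc⟩ := h
  exact hc ▸ sc_pow_apply _ a _

lemma sign_tri_mul {a b c : V} (hab : a ≠ b) (hbc : b ≠ c) (σ : Perm V) :
    sign (tri a b c * σ) = sign σ := by
  simp [tri, sign_swap hab, sign_swap hbc]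

lemma eq_of_sc_of_fixed {σ : Perm V} {x y : V} (hx : σ x = x) (h : sc σ x y) : x = y := by
  obtain ⟨i, hi⟩ := SameCycle.exists_nat_pow_eq h
  rw [← hi, pow_apply_eq_self_of_apply_eq_self hx]

lemma tri_mul_cancel (a b c : V) (σ : Perm V) : tri a b c * (tri c b a * σ) = σ := by
  rw [← tri_inv a b c, mul_inv_cancel_left]

/-- A cycle on a set `S`, if it is an even permutation, has a factorization of defect 0 that is
transitive on `S`. -/
lemma exists_factorization_of_cycle (S : Finset V) : ∀ (σ : Perm V), S.Nonempty →
    (∀ x ∉ S, σ x = x) → (∀ x ∈ S, ∀ y ∈ S, sc σ x y) → sign σ = 1 →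
    ∃ τ : List (Perm V), (∀ ω ∈ τ, ω.IsThreeCycle) ∧ τ.prod = σ ∧ defect τ = 0 ∧
      (∀ x ∈ S, ∀ y ∈ S, orb τ x y) ∧ ∀ x ∉ S, ∀ y, orb τ x y → x = y := by
  induction S using Finset.strongInduction with
  | H S ih =>
  intro σ hne hfix hcyc hsign
  obtain ⟨a, ha⟩ := hne
  by_cases hfa : σ a = a
  · have hS : ∀ x ∈ S, x = a := fun x hx => (eq_of_sc_of_fixed hfa (hcyc a ha x hx)).symm
    refine ⟨[], by simp, ?_, defect_nil, ?_, fun x _ y h => h⟩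
    · ext x
      by_cases hx : x ∈ S
      · rw [hS x hx, hfa]; rfl
      · rw [hfix x hx]; rfl
    · intro x hx y hy
      rw [hS x hx, hS y hy]
  have mem : ∀ {x}, x ∈ S → σ x ∈ S := by
    intro x hx
    by_contra h
    have h' := hfix _ h
    exact h (by rwa [σ.injective h'])
  -- A cycle of length 2 is a transposition, which is odd.
  by_cases hfb : σ (σ a) = a
  · exfalso
    have hS : ∀ x ∈ S, x = a ∨ x = σ a := by
      intro x hx
      obtain ⟨i, rfl⟩ := SameCycle.exists_nat_pow_eq (hcyc a ha x hx)
      clear hx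
      induction i with
      | zero => exact Or.inl rfl
      | succ i ih =>
        rw [pow_succ', mul_apply]
        rcases ih with h | h <;> rw [h]
        · exact Or.inr rfl
        · exact Or.inl hfb
    have : σ = swap a (σ a) := by
      ext x
      by_cases hx : x ∈ S
      · rcases hS x hx with rfl | rfl
        · rw [swap_apply_left]
        · rw [swap_apply_right, hfb]
      · rw [hfix x hx, swap_apply_of_ne_of_ne]
        · rintro rfl; exact hx ha
        · rintro rfl; exact hx (mem ha)
    rw [this, sign_swap (Ne.symm hfa)] at hsign
    exact absurd hsign (by decide)
  set b := σ a with hb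
  set c := σ b with hc
  have hab : a ≠ b := Ne.symm hfa
  have hac : a ≠ c := Ne.symm hfb
  have hbc : b ≠ c := fun h => hab (σ.injective h)
  have hl : 2 < len σ a := by
    have h0 := len_pos σ a
    have h1 := pow_len_apply σ a
    by_contra! h
    interval_cases hla : len σ a
    · exact hfa h1
    · exact hfb h1
  -- Cutting at `a`, `σ a`, `σ² a`, that is with `s = 1` and `t = 2`, turns `a` and `b` into fixed
  -- points and leaves one cycle through `c`. The induction hypothesis applies to `S` without `a`
  -- and `b`.
  obtain ⟨⟨n1, n2, n3⟩, l1, l2, -⟩ :=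
    tri_cut (σ := σ) (a := a) (b := b) (c := c) one_pos one_lt_two hl rfl rfl
  have hσ' := sc_tri_mul n1 n2 n3
  rw [tri_mul_cancel] at hσ'
  set σ' := tri c b a * σ with hσ'_def
  have fa : σ' a = a := by
    have := pow_len_apply σ' a
    rwa [l1, pow_one] at this
  have fb : σ' b = b := by
    have := pow_len_apply σ' b
    rwa [l2, show 2 - 1 = 1 from rfl, pow_one] at this
  have ea : ∀ {x}, sc σ' x a → x = a := fun h => (eq_of_sc_of_fixed fa ((sc σ').symm h)).symm
  have eb : ∀ {x}, sc σ' x b → x = b := fun h => (eq_of_sc_of_fixed fb ((sc σ').symm h)).symm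
  have ea' : ∀ {x}, sc σ' a x → x = a := fun h => (eq_of_sc_of_fixed fa h).symm
  have eb' : ∀ {x}, sc σ' b x → x = b := fun h => (eq_of_sc_of_fixed fb h).symm
  have hb_mem : b ∈ S := mem ha
  have hc_mem : c ∈ S := mem hb_mem
  obtain ⟨τ, h3, hprod, hdef, htr, hiso⟩ := ih ((S.erase a).erase b)
    ((erase_ssubset ha).trans_le' (erase_subset _ _)) σ'
    ⟨c, by simp [hc_mem, hac.symm, hbc.symm]⟩ (by
      intro x hx
      by_cases hxa : x = a
      · rw [hxa, fa]
      by_cases hxb : x = b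
      · rw [hxb, fb]
      have hxS : x ∉ S := by
        simpa [hxa, hxb] using hx
      have hxc : x ≠ c := by
        rintro rfl; exact hxS hc_mem
      rw [hσ'_def, mul_apply, hfix x hxS, tri_apply_of_ne hxc hxb hxa]) (by
      intro x hx y hy
      simp only [mem_erase] at hx hy
      have := hcyc x hx.2.2 y hy.2.2
      rw [hσ'] at this
      simp only [join_apply] at this
      have k1 : ¬ sc σ' x a := fun h => hx.2.1 (ea h)
      have k2 : ¬ sc σ' x b := fun h => hx.1 (eb h)
      have k3 : ¬ sc σ' a y := fun h => hy.2.1 (ea' h)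
      have k4 : ¬ sc σ' b y := fun h => hy.1 (eb' h)
      have k5 : ¬ sc σ' c a := fun h => hac (ea h).symm
      have k6 : ¬ sc σ' c b := fun h => hbc (eb h).symm
      have k7 : ¬ sc σ' b a := fun h => n1 ((sc σ').symm h)
      tauto) (by rw [hσ'_def, sign_tri_mul hbc.symm hab.symm, hsign])
  have ha' : a ∉ (S.erase a).erase b := by simp
  have hb' : b ∉ (S.erase a).erase b := by simp
  have m1 : ¬ orb τ b c := fun h => hbc (hiso b hb' c h)
  have m2 : ¬ orb τ a b := fun h => hab (hiso a ha' b h)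
  have m3 : ¬ orb τ a c := fun h => hac (hiso a ha' c h)
  refine ⟨tri a b c :: τ, ?_, ?_, ?_, ?_, ?_⟩
  · intro ω hω
    rcases List.mem_cons.1 hω with rfl | hω
    · exact isThreeCycle_tri hab hac hbc
    · exact h3 ω hω
  · rw [List.prod_cons, hprod, hσ'_def, tri_mul_cancel]
  · rw [defect_cons_eq_zero hab hac hbc h3]
    -- Both clauses of `Tight` hold vacuously, since `a`, `b`, `c` are in different orbits of `τ`.
    exact ⟨hdef, fun h => absurd h m1, fun h => absurd h (not_join_of_not m2 m3)⟩
  · rw [orb_tri_cons hab hac hbc]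
    set J := join (join (orb τ) b c) a b
    have j1 : J a b := join_pair _ _ _
    have j2 : J b c := le_join _ _ _ (join_pair _ _ _)
    have j3 : ∀ x ∈ S, J x c := by
      intro x hx
      by_cases hxa : x = a
      · rw [hxa]; exact J.trans j1 j2
      by_cases hxb : x = b
      · rwa [hxb]
      exact le_join _ _ _ (le_join _ _ _
        (htr x (by simp [hx, hxa, hxb]) c (by simp [hc_mem, hac.symm, hbc.symm])))
    exact fun x hx y hy => J.trans (j3 x hx) (J.symm (j3 y hy))
  · rw [orb_tri_cons hab hac hbc]
    intro x hx y hxy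
    have hx' : x ∉ (S.erase a).erase b := fun h => hx (mem_of_mem_erase (mem_of_mem_erase h))
    simp only [join_apply] at hxy
    have k1 : ¬ orb τ x a := fun h => hx (by rwa [hiso x hx' a h])
    have k2 : ¬ orb τ x b := fun h => hx (by rwa [hiso x hx' b h])
    have k3 : ¬ orb τ x c := fun h => hx (by rwa [hiso x hx' c h])
    exact hiso x hx' y (by tauto)

lemma orb_cons_eq_top {τ : List (Perm V)} (h : orb τ = ⊤) (g : Perm V) : orb (g :: τ) = ⊤ := by
  rw [orb, h, top_sup_eq]

/-- An even permutation of at least three points has a transitive factorization of defect 0. -/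
lemma exists_factorization (hV : 3 ≤ Fintype.card V) : ∀ (n : ℕ) (σ : Perm V),
    numCls (sc σ) = n → sign σ = 1 →
    ∃ τ : List (Perm V), (∀ ω ∈ τ, ω.IsThreeCycle) ∧ τ.prod = σ ∧ defect τ = 0 ∧ orb τ = ⊤ := by
  intro n
  induction n using Nat.strong_induction_on with
  | _ n ih =>
  intro σ hn hsign
  by_cases hall : ∀ x y, sc σ x y
  · have : Nonempty V := Fintype.card_pos_iff.1 (by omega)
    obtain ⟨τ, h1, h2, h3, h4, -⟩ := exists_factorization_of_cycle univ σ univ_nonempty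
      (fun x hx => absurd (mem_univ x) hx) (fun x _ y _ => hall x y) hsign
    exact ⟨τ, h1, h2, h3, eq_top_iff.2 fun x y _ => h4 x (mem_univ _) y (mem_univ _)⟩
  push Not at hall
  obtain ⟨a, b, hab⟩ := hall
  have hab' : a ≠ b := by rintro rfl; exact hab ((sc σ).refl a)
  -- With three cycles available, joining them lowers the number of cycles by two. The inverse
  -- 3-cycle put in front then makes two cuts and so costs no defect.
  by_cases hc : ∃ c, ¬ sc σ a c ∧ ¬ sc σ b c
  · obtain ⟨c, hac, hbc⟩ := hc
    have hac' : a ≠ c := by rintro rfl; exact hac ((sc σ).refl a)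
    have hbc' : b ≠ c := by rintro rfl; exact hbc ((sc σ).refl b)
    have hσ' := sc_tri_mul hab hbc hac
    have h1 := numCls_join hbc
    have h2 := numCls_join (not_join_of_not hab hac)
    rw [← hσ'] at h2
    have hcyc := tri_join hab hbc hac
    obtain ⟨τ, h3, hprod, hdef, htop⟩ := ih _ (by omega) (tri a b c * σ) rfl
      (by rw [sign_tri_mul hab' hbc', hsign])
    refine ⟨tri c b a :: τ, ?_, ?_, ?_, orb_cons_eq_top htop _⟩
    · intro ω hω
      rcases List.mem_cons.1 hω with rfl | hω
      · exact isThreeCycle_tri hbc'.symm hac'.symm hab'.symm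
      · exact h3 ω hω
    · rw [List.prod_cons, hprod, tri_mul_cancel]
    · rw [defect_cons_eq_zero hbc'.symm hac'.symm hab'.symm h3, hprod]
      refine ⟨hdef, fun _ => (sc _).symm hcyc.sc_left, fun _ => ?_⟩
      rw [swap_comm]
      exact (sc _).symm hcyc.sc_swap
  · push Not at hc
    -- Now there are exactly two cycles. They cannot both be fixed points because there are at least
    -- three points, so the roles can be chosen such that `a` is not fixed.
    have two : ∃ a b : V, ¬ sc σ a b ∧ (∀ x, ¬ sc σ a x → sc σ b x) ∧ σ a ≠ a := by
      by_cases hfa : σ a = a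
      · refine ⟨b, a, fun h => hab ((sc σ).symm h), fun x hx => ?_, fun hfb => ?_⟩
        · by_contra h
          exact hx (hc x h)
        · have : (univ : Finset V) ⊆ {a, b} := by
            intro x _
            rw [mem_insert, mem_singleton]
            by_cases hx : sc σ a x
            · exact Or.inl (eq_of_sc_of_fixed hfa hx).symm
            · exact Or.inr (eq_of_sc_of_fixed hfb (hc x hx)).symm
          have := card_le_card this
          rw [card_univ] at this
          have := this.trans card_le_two
          omega
      · exact ⟨a, b, hab, hc, hfa⟩
    clear hc hab' hab
    obtain ⟨a, d, had, hc, hfa⟩ := two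
    set b := σ a with hb
    have hab : a ≠ b := Ne.symm hfa
    have hab_sc : sc σ a b := sc_self_apply σ a
    have had' : a ≠ d := by rintro rfl; exact had ((sc σ).refl a)
    have hbd : ¬ sc σ b d := fun h => had ((sc σ).trans hab_sc h)
    have hbd' : b ≠ d := by rintro rfl; exact hbd ((sc σ).refl b)
    have hj := join_sc_swap_mul hab hab_sc
    have hle := sc_swap_mul_le_self hab_sc
    set σ₁ := swap a b * σ with hσ₁
    have fa₁ : σ₁ a = a := by rw [hσ₁, mul_apply, ← hb, swap_apply_right]
    have n1 : ¬ sc σ₁ d b := fun h => hbd ((sc σ).symm (hle h))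
    -- `σ₁` has `a` split off as a fixed point; joining at `d` and `b` makes everything else one
    -- cycle. That cycle is even, so it has a factorization of defect 0 on the complement of `a`,
    -- and `tri a b d` then brings `a` back.
    have hσ'_eq : tri d b a * σ = swap d b * σ₁ := by
      rw [tri, mul_assoc, swap_comm b a]
    have hj' := sc_swap_mul n1
    rw [← hσ'_eq] at hj'
    set σ' := tri d b a * σ with hσ'
    have fa' : σ' a = a := by
      rw [hσ'_eq, mul_apply, fa₁, swap_apply_of_ne_of_ne had' hab]
    have ea : ∀ {x}, sc σ₁ x a → x = a := fun h => (eq_of_sc_of_fixed fa₁ ((sc σ₁).symm h)).symm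
    have key : ∀ x, x ≠ a → sc σ' x b := by
      intro x hx
      have k1 : ¬ sc σ₁ x a := fun h => hx (ea h)
      have k2 : ¬ sc σ₁ d a := fun h => had' (ea h).symm
      have k3 := Setoid.refl' (sc σ₁) b
      rw [hj', join_apply]
      by_cases h : sc σ a x
      · have h := Setoid.symm' _ h
        rw [hj, join_apply] at h
        tauto
      · have h := Setoid.symm' _ (hc x h)
        rw [hj, join_apply] at h
        have k4 : ¬ sc σ₁ a d := fun h => k2 ((sc σ₁).symm h)
        tauto
    obtain ⟨τ, h3, hprod, hdef, htr, hiso⟩ := exists_factorization_of_cycle (univ.erase a) σ'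
      ⟨b, by simp [hab.symm]⟩ (by
        intro x hx
        have : x = a := by simpa using hx
        rw [this, fa']) (by
        intro x hx y hy
        exact (sc σ').trans (key x (by simpa using hx)) ((sc σ').symm (key y (by simpa using hy))))
      (by rw [hσ', sign_tri_mul hbd'.symm hab.symm, hsign])
    have m1 : ∀ x, x ≠ a → ¬ orb τ a x := fun x hx h => hx (hiso a (by simp) x h).symm
    have m2 : orb τ b d := htr b (by simp [hab.symm]) d (by simp [had'.symm])
    refine ⟨tri a b d :: τ, ?_, ?_, ?_, ?_⟩
    · intro ω hω
      rcases List.mem_cons.1 hω with rfl | hω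
      · exact isThreeCycle_tri hab had' hbd'
      · exact h3 ω hω
    · rw [List.prod_cons, hprod, tri_mul_cancel]
    · rw [defect_cons_eq_zero hab had' hbd' h3, hprod]
      exact ⟨hdef, fun _ => (sc σ').symm (key d had'.symm),
        fun h => absurd h (not_join_of_not (m1 b hab.symm) (m1 d had'.symm))⟩
    · rw [orb_tri_cons hab had' hbd', join_eq_self m2, eq_top_iff]
      have j1 : ∀ x, join (orb τ) a b x b := by
        intro x
        by_cases hx : x = a
        · rw [hx]; exact join_pair _ _ _
        · exact le_join _ _ _ (htr x (by simp [hx]) b (by simp [hab.symm]))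
      exact fun x y _ => Setoid.trans' _ (j1 x) (Setoid.symm' _ (j1 y))

end Existence

/-! ### Minimality is the vanishing of the defect. -/

section Minimal

lemma IsTransitiveFactorization.iff_orb {n : ℕ} (δ : List (Perm (Fin n))) (σ : Perm (Fin n)) :
    IsTransitiveFactorization δ σ ↔
      (∀ ω ∈ δ, ω.IsThreeCycle) ∧ δ.prod = σ ∧ orb δ = ⊤ := by
  rw [IsTransitiveFactorization, orb_eq_top_iff]

/-- Minimal transitive factorizations are those of defect 0. -/
lemma isMinimal_iff {n : ℕ} (hn : 0 < n) (δ : List (Perm (Fin n))) (σ : Perm (Fin n)) :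
    IsMinimalTransitiveFactorization δ σ ↔
      (∀ ω ∈ δ, ω.IsThreeCycle) ∧ δ.prod = σ ∧ orb δ = ⊤ ∧ defect δ = 0 := by
  have : Nonempty (Fin n) := ⟨⟨0, hn⟩⟩
  have hd : ∀ δ' : List (Perm (Fin n)), δ'.prod = σ → orb δ' = ⊤ →
      defect δ' = 2 * δ'.length + 2 - n - numCls (sc σ) := by
    intro δ' h1 h2
    rw [defect, h1, h2, numCls_eq_one_of_top]
    simp
  unfold IsMinimalTransitiveFactorization
  simp only [IsTransitiveFactorization.iff_orb]
  constructor
  · rintro ⟨⟨h1, h2, h3⟩, h4⟩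
    refine ⟨h1, h2, h3, le_antisymm ?_ (defect_nonneg h1)⟩
    -- The empty list has defect 0 anyway. A nonempty list contains a 3-cycle, so there are at least
    -- three points, and its product is even; thus a competitor of defect 0 exists. For transitive
    -- factorizations of one permutation, comparing defects is comparing lengths.
    cases δ with
    | nil => rw [defect_nil]
    | cons ω τ =>
      have hω := h1 ω List.mem_cons_self
      have hV : 3 ≤ Fintype.card (Fin n) := by
        rw [← hω.card_support]
        exact card_le_univ _
      have hsign : sign σ = 1 := by
        rw [← h2, map_list_prod]
        apply List.prod_eq_one
        intro x hx
        obtain ⟨g, hg, rfl⟩ := List.mem_map.1 hx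
        exact (h1 g hg).sign
      obtain ⟨δ', k1, k2, k3, k4⟩ := exists_factorization hV _ σ rfl hsign
      have := h4 δ' ⟨k1, k2, k4⟩
      have e1 := hd _ h2 h3
      have e2 := hd _ k2 k4
      omega
  · rintro ⟨h1, h2, h3, h4⟩
    refine ⟨⟨h1, h2, h3⟩, ?_⟩
    rintro δ' ⟨k1, k2, k3⟩
    have e1 := hd _ h2 h3
    have e2 := hd _ k2 k3
    have := defect_nonneg k1
    omega

end Minimal

/-! ### The three ways in which a 3-cycle extends a list of defect 0 to a transitive one. -/

section Steps

variable {V : Type*} [Fintype V] [DecidableEq V]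

/-- Lists of 3-cycles of defect 0. -/
def Planar (τ : List (Perm V)) : Prop := (∀ ω ∈ τ, ω.IsThreeCycle) ∧ defect τ = 0

variable {a b c : V} {τ : List (Perm V)}

lemma planar_tri_cons (hab : a ≠ b) (hac : a ≠ c) (hbc : b ≠ c) :
    Planar (tri a b c :: τ) ↔ Planar τ ∧ Tight (orb τ) τ.prod a b c := by
  unfold Planar
  constructor
  · rintro ⟨h1, h2⟩
    have h3 : ∀ ω ∈ τ, ω.IsThreeCycle := fun ω hω => h1 ω (List.mem_cons_of_mem _ hω)
    rw [defect_cons_eq_zero hab hac hbc h3] at h2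
    exact ⟨⟨h3, h2.1⟩, h2.2⟩
  · rintro ⟨⟨h1, h2⟩, h3⟩
    refine ⟨?_, (defect_cons_eq_zero hab hac hbc h1).2 ⟨h2, h3⟩⟩
    intro ω hω
    rcases List.mem_cons.1 hω with rfl | hω
    · exact isThreeCycle_tri hab hac hbc
    · exact h1 ω hω

lemma join_join_eq_top {s : Setoid V} :
    join (join s b c) a b = ⊤ ↔ ∀ x, s a x ∨ s b x ∨ s c x := by
  constructor
  · intro h x
    have : join (join s b c) a b a x := by rw [h]; trivial
    simp only [join_apply] at this
    tauto
  · intro h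
    rw [eq_top_iff]
    have j1 : join (join s b c) a b a b := join_pair _ _ _
    have j2 : join (join s b c) a b b c := le_join _ _ _ (join_pair _ _ _)
    have hle : s ≤ join (join s b c) a b := (le_join _ _ _).trans (le_join _ _ _)
    have key : ∀ x, join (join s b c) a b a x := by
      intro x
      rcases h x with h | h | h
      · exact hle h
      · exact Setoid.trans' _ j1 (hle h)
      · exact Setoid.trans' _ j1 (Setoid.trans' _ j2 (hle h))
    exact fun x y _ => Setoid.trans' _ (Setoid.symm' _ (key x)) (key y)

/-- Both transpositions join cycles, so without loss of defect both must join orbits: the three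
points are in three orbits of `τ`, and transitivity means that there are no others. -/
lemma step_join (hab : a ≠ b) (hac : a ≠ c) (hbc : b ≠ c) :
    (Planar (tri a b c :: τ) ∧ orb (tri a b c :: τ) = ⊤) ∧
        CyclicOrder (tri a b c * τ.prod) a b c ↔
      Planar τ ∧ (¬ orb τ a b ∧ ¬ orb τ b c ∧ ¬ orb τ a c) ∧
        ∀ x, orb τ a x ∨ orb τ b x ∨ orb τ c x := by
  rw [planar_tri_cons hab hac hbc, orb_tri_cons hab hac hbc, join_join_eq_top,
    cyclicOrder_tri_mul]
  have hle := sc_prod_le_orb τ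
  constructor
  · rintro ⟨⟨⟨h1, h2, h3⟩, h4⟩, h5, h6, h7⟩
    refine ⟨h1, ?_, h4⟩
    have n1 : ¬ orb τ b c := fun h => h6 (h2 h)
    have n2 : ¬ join (orb τ) b c a b := by
      intro h
      have := h3 h
      rw [sc_swap_mul h6] at this
      exact not_join_of_not h5 h7 this
    simp only [join_apply] at n2
    have := Setoid.refl' (orb τ) b
    tauto
  · rintro ⟨h1, ⟨h2, h3, h4⟩, h5⟩
    exact ⟨⟨⟨h1, fun h => absurd h h3, fun h => absurd h (not_join_of_not h2 h4)⟩, h5⟩,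
      fun h => h2 (hle h), fun h => h3 (hle h), fun h => h4 (hle h)⟩

/-- `swap b c` cuts, which is free; `swap a b` joins cycles and therefore has to join two orbits,
that of `a` and that of `b` and `c`. -/
lemma step_exchange (hab : a ≠ b) (hac : a ≠ c) (hbc : b ≠ c) :
    (Planar (tri a b c :: τ) ∧ orb (tri a b c :: τ) = ⊤) ∧
        (sc (tri a b c * τ.prod) b a ∧ ¬ sc (tri a b c * τ.prod) c b) ↔
      Planar τ ∧ sc τ.prod c b ∧ ¬ orb τ a c ∧ ∀ x, orb τ a x ∨ orb τ c x := by
  have h0 := sc_tri_mul_exchange (σ := τ.prod) (a := a) hbc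
  rw [and_iff_left hab] at h0
  rw [planar_tri_cons hab hac hbc, orb_tri_cons hab hac hbc, join_join_eq_top, h0]
  have hle := sc_prod_le_orb τ
  constructor
  · rintro ⟨⟨⟨h1, h2, h3⟩, h4⟩, h5, h6⟩
    have h5' := Setoid.symm' _ h5
    rw [join_eq_self (hle h5')] at h3
    have n1 : ¬ orb τ a b := by
      intro h
      exact h6 (Setoid.trans' _ h5 (Setoid.symm' _ (sc_swap_mul_le_self h5' (h3 h))))
    refine ⟨h1, h5, fun h => n1 (Setoid.trans' _ h (hle h5)), fun x => ?_⟩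
    rcases h4 x with h | h | h
    · exact Or.inl h
    · exact Or.inr (Setoid.trans' _ (hle h5) h)
    · exact Or.inr h
  · rintro ⟨h1, h2, h3, h4⟩
    have h2' := Setoid.symm' _ h2
    refine ⟨⟨⟨h1, fun _ => h2', ?_⟩, fun x => ?_⟩, h2, fun h => h3 (Setoid.symm' _ (hle h))⟩
    · rw [join_eq_self (hle h2')]
      exact fun h => absurd (Setoid.trans' _ h (hle h2')) h3
    · have := h4 x
      tauto

/-- Both transpositions cut, so the orbits do not change and `τ` is already transitive. -/
lemma step_cut (hab : a ≠ b) (hac : a ≠ c) (hbc : b ≠ c) :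
    (Planar (tri a b c :: τ) ∧ orb (tri a b c :: τ) = ⊤) ∧
        (¬ sc (tri a b c * τ.prod) a b ∧ ¬ sc (tri a b c * τ.prod) b c ∧
          ¬ sc (tri a b c * τ.prod) a c) ↔
      (Planar τ ∧ orb τ = ⊤) ∧ CyclicOrder τ.prod c b a := by
  rw [planar_tri_cons hab hac hbc, orb_tri_cons hab hac hbc, join_join_eq_top,
    ← cyclicOrder_iff]
  have hle := sc_prod_le_orb τ
  constructor
  · rintro ⟨⟨⟨h1, -⟩, h4⟩, h5⟩
    refine ⟨⟨h1, ?_⟩, h5⟩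
    have h6 := hle h5.sc_left
    have h7 := hle h5.sc_right
    rw [eq_top_iff]
    have key : ∀ x, orb τ c x := by
      intro x
      rcases h4 x with h | h | h
      · exact Setoid.trans' _ h7 h
      · exact Setoid.trans' _ h6 h
      · exact h
    exact fun x y _ => Setoid.trans' _ (Setoid.symm' _ (key x)) (key y)
  · rintro ⟨⟨h1, h2⟩, h3⟩
    refine ⟨⟨⟨h1, fun _ => Setoid.symm' _ h3.sc_left, fun _ => ?_⟩, fun x => ?_⟩, h3⟩
    · rw [swap_comm]
      exact Setoid.symm' _ h3.sc_swap
    · rw [h2]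
      exact Or.inl trivial

/-- The three points lie on three cycles, on two (one alternative for each rotation of the 3-cycle),
or on one. In the last case the opposite cyclic order is excluded: `swap b c` would separate `a`
from `b`, and `swap a b` would rejoin two cycles of one orbit. -/
lemma tight_cases {s : Setoid V} {σ : Perm V} (hσ : sc σ ≤ s) (hab : a ≠ b)
    (hbc : b ≠ c) (h : Tight s σ a b c) :
    (¬ sc σ a b ∧ ¬ sc σ b c ∧ ¬ sc σ a c) ∨ (sc σ c b ∧ ¬ sc σ c a) ∨
      (sc σ a c ∧ ¬ sc σ a b) ∨ (sc σ b a ∧ ¬ sc σ b c) ∨ CyclicOrder σ c b a := by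
  obtain ⟨h1, h2⟩ := h
  have sy : ∀ {x y}, sc σ x y ↔ sc σ y x := ⟨Setoid.symm' _, Setoid.symm' _⟩
  have tr : ∀ {x y z}, sc σ x y → sc σ y z → sc σ x z := fun h h' => Setoid.trans' _ h h'
  by_cases hr : sc σ b c
  · by_cases hra : sc σ c a
    · have hr' := sy.1 hr
      have hs : join s b c a b := le_join _ _ _ (hσ (tr (sy.1 hra) hr'))
      have h3 := h2 hs
      obtain ⟨k, hk, hkb⟩ := exists_pow_lt_len hr'
      have hk0 : 0 < k := by
        rcases Nat.eq_zero_or_pos k with rfl | h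
        · exact absurd hkb hbc.symm
        · exact h
      rw [swap_comm] at h3
      obtain ⟨l, hl, hla⟩ := exists_pow_lt_len (Setoid.symm' _ h3)
      rw [cut_len_right hk0 hk hkb] at hl
      rw [cut_pow_apply_right hk0 hk hkb hl] at hla
      have hl0 : 0 < l := by
        rcases Nat.eq_zero_or_pos l with rfl | h
        · exact absurd hla hab.symm
        · exact h
      refine Or.inr (Or.inr (Or.inr (Or.inr ⟨k, l + k, hk0, by omega, by omega, hkb, ?_⟩)))
      rw [pow_add, mul_apply, hkb, hla]
    · exact Or.inr (Or.inl ⟨sy.1 hr, hra⟩)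
  · by_cases h3 : sc σ a b
    · exact Or.inr (Or.inr (Or.inr (Or.inl ⟨sy.1 h3, hr⟩)))
    · by_cases h4 : sc σ a c
      · exact Or.inr (Or.inr (Or.inl ⟨h4, h3⟩))
      · exact Or.inl ⟨h3, hr, h4⟩

end Steps

/-! ### From sums over triples of points to sums over 3-cycles. -/

section SumOverThreeCycles

variable {V : Type*} [Fintype V] [DecidableEq V] {M : Type*} [AddCommMonoid M]

/-- `a, b, c` are distinct. -/
def Distinct (a b c : V) : Prop := a ≠ b ∧ a ≠ c ∧ b ≠ c

/-- Some way of writing `ω` as `(a b c)` has the property `Q`. -/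
def HasForm (Q : V → V → V → Prop) (ω : Perm V) : Prop :=
  ∃ a b c, Distinct a b c ∧ ω = tri a b c ∧ Q a b c

-- A 3-cycle has exactly three writings `(a b c)`, and a rotation-invariant condition holds for all
-- of them or for none. The factor 1/3 in types 1 and 3 comes from here.
open Classical in
lemma sum_triples_of_rotate {Q : V → V → V → Prop}
    (hQ : ∀ a b c, Distinct a b c → Q a b c → Q b c a) (F : Perm V → M) :
    (∑ a, ∑ b, ∑ c, if Distinct a b c ∧ Q a b c then F (tri a b c) else 0) =
      3 • ∑ ω, if HasForm Q ω then F ω else 0 := by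
  have e1 : (∑ a, ∑ b, ∑ c, if Distinct a b c ∧ Q a b c then F (tri a b c) else 0) =
      ∑ x ∈ ({x | Distinct x.1 x.2.1 x.2.2 ∧ Q x.1 x.2.1 x.2.2} : Finset (V × V × V)),
        F (tri x.1 x.2.1 x.2.2) := by
    simp only [sum_filter, Fintype.sum_prod_type]
  rw [e1, sum_comp F fun x : V × V × V => tri x.1 x.2.1 x.2.2, ← sum_filter, smul_sum]
  have himg : image (fun x : V × V × V => tri x.1 x.2.1 x.2.2)
      {x | Distinct x.1 x.2.1 x.2.2 ∧ Q x.1 x.2.1 x.2.2} =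
        ({ω | HasForm Q ω} : Finset (Perm V)) := by
    ext ω
    simp only [mem_image, mem_filter, mem_univ, true_and]
    constructor
    · rintro ⟨⟨a, b, c⟩, ⟨h1, h2⟩, rfl⟩
      exact ⟨a, b, c, h1, rfl, h2⟩
    · rintro ⟨a, b, c, h1, rfl, h2⟩
      exact ⟨(a, b, c), ⟨h1, h2⟩, rfl⟩
  rw [himg]
  refine sum_congr rfl fun ω hω => ?_
  obtain ⟨a, b, c, ⟨hab, hac, hbc⟩, rfl, hq⟩ := (mem_filter.1 hω).2
  congr 1
  have : ({x ∈ ({x | Distinct x.1 x.2.1 x.2.2 ∧ Q x.1 x.2.1 x.2.2} : Finset (V × V × V)) |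
      tri x.1 x.2.1 x.2.2 = tri a b c} : Finset (V × V × V)) =
      {(a, b, c), (b, c, a), (c, a, b)} := by
    ext ⟨x, y, z⟩
    simp only [mem_filter, mem_univ, true_and, mem_insert, mem_singleton, Prod.mk.injEq]
    have d2 : Distinct b c a := ⟨hbc, hab.symm, hac.symm⟩
    have d3 : Distinct c a b := ⟨hac.symm, hbc.symm, hab⟩
    constructor
    · rintro ⟨⟨⟨h1, h2, h3⟩, -⟩, h4⟩
      exact tri_eq_tri hab hac hbc h1 h2 h3 h4
    · have q2 := hQ _ _ _ ⟨hab, hac, hbc⟩ hq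
      rintro (⟨rfl, rfl, rfl⟩ | ⟨rfl, rfl, rfl⟩ | ⟨rfl, rfl, rfl⟩)
      · exact ⟨⟨⟨hab, hac, hbc⟩, hq⟩, rfl⟩
      · exact ⟨⟨d2, q2⟩, (tri_rotate hab hac hbc).symm⟩
      · exact ⟨⟨d3, hQ _ _ _ d2 q2⟩, tri_rotate hac.symm hbc.symm hab⟩
  rw [this, card_insert_of_notMem, card_pair]
  · simp [hbc]
  · simp [hab, hac]

-- Here the condition singles out one of the three writings, as in type 2, so no factor appears.
open Classical in
lemma sum_triples_of_unique {Q : V → V → V → Prop}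
    (hQ : ∀ a b c, Distinct a b c → Q a b c → ¬ Q b c a ∧ ¬ Q c a b) (F : Perm V → M) :
    (∑ a, ∑ b, ∑ c, if Distinct a b c ∧ Q a b c then F (tri a b c) else 0) =
      ∑ ω, if HasForm Q ω then F ω else 0 := by
  have e1 : (∑ a, ∑ b, ∑ c, if Distinct a b c ∧ Q a b c then F (tri a b c) else 0) =
      ∑ x ∈ ({x | Distinct x.1 x.2.1 x.2.2 ∧ Q x.1 x.2.1 x.2.2} : Finset (V × V × V)),
        F (tri x.1 x.2.1 x.2.2) := by
    simp only [sum_filter, Fintype.sum_prod_type]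
  rw [e1, ← sum_filter]
  refine sum_bij (fun x _ => tri x.1 x.2.1 x.2.2) ?_ ?_ ?_ fun _ _ => rfl
  · rintro ⟨a, b, c⟩ hx
    obtain ⟨h1, h2⟩ := (mem_filter.1 hx).2
    exact mem_filter.2 ⟨mem_univ _, a, b, c, h1, rfl, h2⟩
  · rintro ⟨a, b, c⟩ hx ⟨x, y, z⟩ hy h
    obtain ⟨⟨h1, h2, h3⟩, h4⟩ := (mem_filter.1 hx).2
    obtain ⟨⟨k1, k2, k3⟩, k4⟩ := (mem_filter.1 hy).2
    have := hQ _ _ _ ⟨k1, k2, k3⟩ k4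
    rcases tri_eq_tri k1 k2 k3 h1 h2 h3 h with ⟨rfl, rfl, rfl⟩ | ⟨rfl, rfl, rfl⟩ | ⟨rfl, rfl, rfl⟩
    · rfl
    · exact absurd h4 this.1
    · exact absurd h4 this.2
  · rintro ω hω
    obtain ⟨a, b, c, h1, rfl, h2⟩ := (mem_filter.1 hω).2
    exact ⟨(a, b, c), mem_filter.2 ⟨mem_univ _, h1, h2⟩, rfl⟩

end SumOverThreeCycles

/-! ### Sums over all lists of given length. -/

section ListSum

variable {α : Type*} [Fintype α] {M : Type*} [AddCommMonoid M]

/-- The sum of `f` over all lists of length `m`. -/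
def listSum : ℕ → (List α → M) → M
  | 0, f => f []
  | m + 1, f => ∑ a, listSum m fun l => f (a :: l)

lemma listSum_congr {m : ℕ} {f g : List α → M} (h : ∀ l, f l = g l) :
    listSum m f = listSum m g := by
  rw [funext h]

lemma listSum_zero (m : ℕ) : listSum m (fun _ : List α => (0 : M)) = 0 := by
  induction m with
  | zero => rfl
  | succ m ih => simp [listSum, ih]

lemma listSum_add (m : ℕ) (f g : List α → M) :
    listSum m (fun l => f l + g l) = listSum m f + listSum m g := by
  induction m generalizing f g with
  | zero => rfl
  | succ m ih => simp only [listSum, ih, sum_add_distrib]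

lemma listSum_sum {ι : Type*} (m : ℕ) (s : Finset ι) (f : ι → List α → M) :
    listSum m (fun l => ∑ i ∈ s, f i l) = ∑ i ∈ s, listSum m (f i) := by
  induction m generalizing f with
  | zero => rfl
  | succ m ih => simp only [listSum, ih]; rw [sum_comm]

lemma map_listSum {N : Type*} [AddCommMonoid N] (φ : M →+ N) (m : ℕ) (f : List α → M) :
    φ (listSum m f) = listSum m fun l => φ (f l) := by
  induction m generalizing f with
  | zero => rfl
  | succ m ih => simp only [listSum, map_sum, ih]

lemma listSum_eq_sum (m : ℕ) (f : List α → M) :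
    listSum m f = ∑ l ∈ (List.finite_length_eq α m).toFinset, f l := by
  classical
  induction m generalizing f with
  | zero =>
    have : (List.finite_length_eq α 0).toFinset = {[]} := by
      ext l; simp
    rw [this, sum_singleton, listSum]
  | succ m ih =>
    simp only [listSum, ih]
    rw [← sum_product']
    refine sum_bij' (fun x _ => x.1 :: x.2) (fun l h => (l.head (by rintro rfl; simp at h), l.tail))
      ?_ ?_ ?_ ?_ ?_
    · rintro ⟨a, l⟩ h
      simpa using h
    · intro l h
      simp at h ⊢
      omega
    · rintro ⟨a, l⟩ h; rfl
    · intro l h; simp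
    · rintro ⟨a, l⟩ h; rfl

open Classical in
lemma listSum_ite_eq_ncard (m : ℕ) (p : List α → Prop) (r : M) :
    listSum m (fun l => if p l then r else 0) = {l | l.length = m ∧ p l}.ncard • r := by
  rw [listSum_eq_sum, ← sum_filter, sum_const]
  congr 1
  rw [← Set.ncard_coe_finset]
  congr 1
  ext l
  simp

/-- Reindexing along an injection, for a summand that vanishes off its image. -/
lemma listSum_map {β : Type*} [Fintype β] {e : β → α} (he : Function.Injective e) (m : ℕ)
    {f : List α → M} (hf : ∀ l, (∃ a ∈ l, a ∉ Set.range e) → f l = 0) :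
    listSum m f = listSum m fun l : List β => f (l.map e) := by
  classical
  induction m generalizing f with
  | zero => rfl
  | succ m ih =>
    simp only [listSum]
    rw [← sum_subset (s₁ := univ.image e) (subset_univ _), sum_image fun x _ y _ h => he h]
    · refine sum_congr rfl fun b _ => ?_
      rw [ih]
      · rfl
      · rintro l ⟨a, hal, ha⟩
        exact hf _ ⟨a, List.mem_cons_of_mem _ hal, ha⟩
    · intro a _ ha
      have : ∀ l, f (a :: l) = 0 := fun l => hf _ ⟨a, List.mem_cons_self, by simpa using ha⟩
      simp only [this, listSum_zero]

end ListSum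

/-! ### Shuffles and binomial convolution. -/

section Shuffle

variable {α : Type*} [Fintype α] {R : Type*} [CommSemiring R]

/-- The binomial convolution of two sequences. -/
def binConv (a b : ℕ → R) (m : ℕ) : R :=
  ∑ x ∈ antidiagonal m, m.choose x.1 • (a x.1 * b x.2)

/-- Pascal's rule; in terms of exponential generating functions, the Leibniz rule for the derivative
of a product. -/
lemma binConv_succ (a b : ℕ → R) (m : ℕ) : binConv a b (m + 1) =
    binConv (fun k => a (k + 1)) b m + binConv a (fun k => b (k + 1)) m := by
  unfold binConv
  rw [sum_antidiagonal_choose_succ_nsmul (fun i j => a i * b j) m, add_comm]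
  congr 1
  refine sum_congr rfl fun x hx => ?_
  rw [← mem_antidiagonal.1 hx, Nat.choose_symm_add]

open Classical in
/-- Shuffling lists over two disjoint alphabets corresponds to binomial convolution. -/
lemma listSum_shuffle {X Y : α → Prop} (hXY : ∀ a, X a → ¬ Y a) (m : ℕ) {f g : List α → R}
    (hf : ∀ l, (∃ a ∈ l, ¬ X a) → f l = 0) (hg : ∀ l, (∃ a ∈ l, ¬ Y a) → g l = 0) :
    listSum m (fun l => if ∀ a ∈ l, X a ∨ Y a then
      f (l.filter fun a => X a) * g (l.filter fun a => Y a) else 0) =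
      binConv (fun k => listSum k f) (fun k => listSum k g) m := by
  induction m generalizing f g with
  | zero => simp [listSum, binConv]
  | succ m ih =>
    -- The first letter lies in one of the two alphabets, which corresponds to the two terms of the
    -- Leibniz rule; a letter in neither contributes nothing.
    rw [binConv_succ, listSum]
    have hconv : ∀ f' g' : α → List α → R,
        binConv (fun k => ∑ a, listSum k (f' a)) (fun k => listSum k g) m =
          ∑ a, binConv (fun k => listSum k (f' a)) (fun k => listSum k g) m ∧
        binConv (fun k => listSum k f) (fun k => ∑ a, listSum k (g' a)) m =
          ∑ a, binConv (fun k => listSum k f) (fun k => listSum k (g' a)) m := by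
      intro f' g'
      unfold binConv
      constructor
      · rw [sum_comm]
        refine sum_congr rfl fun x _ => ?_
        rw [sum_mul, smul_sum]
      · rw [sum_comm]
        refine sum_congr rfl fun x _ => ?_
        rw [mul_sum, smul_sum]
    have h1 := (hconv (fun a l => f (a :: l)) (fun a l => g (a :: l))).1
    have h2 := (hconv (fun a l => f (a :: l)) (fun a l => g (a :: l))).2
    simp only [listSum] at h1 h2 ⊢
    rw [h1, h2, ← sum_add_distrib]
    refine sum_congr rfl fun a _ => ?_
    have zf : ¬ X a → ∀ l, f (a :: l) = 0 := fun h l => hf _ ⟨a, List.mem_cons_self, h⟩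
    have zg : ¬ Y a → ∀ l, g (a :: l) = 0 := fun h l => hg _ ⟨a, List.mem_cons_self, h⟩
    have zl : ∀ b : ℕ → R, binConv (fun _ => 0) b m = 0 := by
      intro b; simp [binConv]
    have zr : ∀ b : ℕ → R, binConv b (fun _ => 0) m = 0 := by
      intro b; simp [binConv]
    by_cases hX : X a
    · have hY := hXY a hX
      simp only [zg hY, listSum_zero, zr, add_zero]
      rw [← ih (f := fun l => f (a :: l)) (g := g)]
      · refine listSum_congr fun l => ?_
        simp [hX, hY]
      · rintro l ⟨b, hb, hb'⟩
        exact hf _ ⟨b, List.mem_cons_of_mem _ hb, hb'⟩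
      · exact hg
    · simp only [zf hX, listSum_zero, zl, zero_add]
      by_cases hY : Y a
      · rw [← ih (f := f) (g := fun l => g (a :: l))]
        · refine listSum_congr fun l => ?_
          simp [hX, hY]
        · exact hf
        · rintro l ⟨b, hb, hb'⟩
          exact hg _ ⟨b, List.mem_cons_of_mem _ hb, hb'⟩
      · simp only [zg hY, listSum_zero, zr]
        refine (listSum_congr fun l => if_neg fun h => ?_).trans (listSum_zero m)
        have := h a List.mem_cons_self
        tauto

end Shuffle

/-! ### Lists of 3-cycles on two disjoint blocks. -/

section Blocks

variable {V : Type*} [Fintype V] [DecidableEq V]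

/-- `s` is trivial outside `T`. -/
def SupportedOn (s : Setoid V) (T : Finset V) : Prop := ∀ x y, s x y → x = y ∨ x ∈ T ∧ y ∈ T

lemma SupportedOn.sup {s t : Setoid V} {T : Finset V} (hs : SupportedOn s T)
    (ht : SupportedOn t T) : SupportedOn (s ⊔ t) T := by
  let u : Setoid V :=
    { r := fun x y => x = y ∨ x ∈ T ∧ y ∈ T
      iseqv := ⟨fun x => Or.inl rfl, by grind, by grind⟩ }
  have : s ⊔ t ≤ u := sup_le (fun x y h => hs x y h) fun x y h => ht x y h
  exact fun x y h => this h

lemma supportedOn_sc {σ : Perm V} {T : Finset V} (h : ∀ x ∉ T, σ x = x) :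
    SupportedOn (sc σ) T := by
  intro x y hxy
  by_cases hx : x ∈ T
  · by_cases hy : y ∈ T
    · exact Or.inr ⟨hx, hy⟩
    · exact Or.inl (eq_of_sc_of_fixed (h y hy) (Setoid.symm' _ hxy)).symm
  · exact Or.inl (eq_of_sc_of_fixed (h x hx) hxy)

lemma cls_of_notMem {s : Setoid V} {T : Finset V} (hs : SupportedOn s T) {x : V} (hx : x ∉ T) :
    cls s x = {x} := by
  ext y
  rw [mem_cls, mem_singleton]
  constructor
  · intro h
    rcases hs x y h with h | h
    · exact h.symm
    · exact absurd h.1 hx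
  · rintro rfl
    exact Setoid.refl' _ _

/-- The union of the two relations is already transitive, because nontrivial pairs of `s` lie in `S`
and those of `t` in `T`. -/
lemma sup_apply_of_disjoint {s t : Setoid V} {S T : Finset V} (hST : Disjoint S T)
    (hs : SupportedOn s S) (ht : SupportedOn t T) {x y : V} : (s ⊔ t) x y ↔ s x y ∨ t x y := by
  let u : Setoid V :=
    { r := fun x y => s x y ∨ t x y
      iseqv := by
        refine ⟨fun x => Or.inl (Setoid.refl' _ x), fun h => h.imp (Setoid.symm' _) (Setoid.symm' _), ?_⟩
        rintro x y z (h | h) (h' | h')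
        · exact Or.inl (Setoid.trans' _ h h')
        · rcases hs _ _ h with rfl | ⟨-, h1⟩
          · exact Or.inr h'
          · rcases ht _ _ h' with rfl | ⟨h2, -⟩
            · exact Or.inl h
            · exact absurd h2 (disjoint_left.1 hST h1)
        · rcases hs _ _ h' with rfl | ⟨h1, -⟩
          · exact Or.inr h
          · rcases ht _ _ h with rfl | ⟨-, h2⟩
            · exact Or.inl h'
            · exact absurd h2 (disjoint_left.1 hST h1)
        · exact Or.inr (Setoid.trans' _ h h') }
  constructor
  · intro h
    exact (sup_le (fun x y h => Or.inl h) (fun x y h => Or.inr h) : s ⊔ t ≤ u) h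
  · rintro (h | h)
    · exact le_sup_left (b := t) h
    · exact le_sup_right (a := s) h

lemma cls_sup_left {s t : Setoid V} {S T : Finset V} (hST : Disjoint S T)
    (hs : SupportedOn s S) (ht : SupportedOn t T) {x : V} (hx : x ∉ T) :
    cls (s ⊔ t) x = cls s x := by
  ext y
  rw [mem_cls, mem_cls, sup_apply_of_disjoint hST hs ht]
  constructor
  · rintro (h | h)
    · exact h
    · rcases ht _ _ h with rfl | h
      · exact Setoid.refl' _ _
      · exact absurd h.1 hx
  · exact Or.inl

/-- The points off the block of each relation are counted as singletons; over both relations this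
surplus amounts to `Fintype.card V`. -/
lemma numCls_sup {s t : Setoid V} {S T : Finset V} (hST : Disjoint S T)
    (hs : SupportedOn s S) (ht : SupportedOn t T) :
    numCls (s ⊔ t) + Fintype.card V = numCls s + numCls t := by
  have hu : (univ : Finset V) = S ∪ Sᶜ := (union_compl S).symm
  have split : ∀ r : Setoid V, (∀ x ∈ S, cls r x ⊆ S) →
      numCls r = wsum S r (fun _ => 1) + wsum Sᶜ r (fun _ => 1) := by
    intro r hr
    rw [numCls, hu, wsum_union]
    intro x hx y hy hxy
    exact (mem_compl.1 hy) (hr x hx (mem_cls.2 hxy))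
  have hsub : ∀ {r : Setoid V} {T}, SupportedOn r T → ∀ x ∈ T, cls r x ⊆ T := by
    intro r T hr x hx y hy
    rcases hr x y (mem_cls.1 hy) with rfl | h
    · exact hx
    · exact h.2
  have hT : ∀ x ∈ S, x ∉ T := fun x hx => disjoint_left.1 hST hx
  have e1 : ∀ x ∈ S, cls (s ⊔ t) x = cls s x := fun x hx => cls_sup_left hST hs ht (hT x hx)
  have e2 : ∀ x ∈ Sᶜ, cls (s ⊔ t) x = cls t x := by
    intro x hx
    rw [sup_comm]
    exact cls_sup_left hST.symm ht hs (mem_compl.1 hx)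
  have e3 : ∀ x ∈ S, cls t x = {x} := fun x hx => cls_of_notMem ht (hT x hx)
  rw [split (s ⊔ t) (fun x hx => e1 x hx ▸ hsub hs x hx), split s (hsub hs),
    split t (fun x hx => by rw [e3 x hx]; simpa using hx), wsum_congr e1, wsum_congr e2,
    wsum_singletons e3, wsum_singletons (S := Sᶜ) (s := s)
      (fun x hx => cls_of_notMem hs (mem_compl.1 hx)), ← card_add_card_compl S]
  simp only [smul_eq_mul, mul_one]
  ring

/-- `ω` is a 3-cycle on points of `S`. -/
def ThreeCycleOn (S : Finset V) (ω : Perm V) : Prop := ω.IsThreeCycle ∧ ω.support ⊆ S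

lemma ThreeCycleOn.apply_of_notMem {S : Finset V} {ω : Perm V} (h : ThreeCycleOn S ω) {x : V}
    (hx : x ∉ S) : ω x = x := by
  by_contra h'
  exact hx (h.2 (mem_support.2 h'))

lemma ThreeCycleOn.mono {S T : Finset V} {ω : Perm V} (h : ThreeCycleOn S ω) (hST : S ⊆ T) :
    ThreeCycleOn T ω := ⟨h.1, h.2.trans hST⟩

lemma ThreeCycleOn.not_of_disjoint {S T : Finset V} (hST : Disjoint S T) {ω : Perm V}
    (h : ThreeCycleOn S ω) : ¬ ThreeCycleOn T ω := by
  intro h'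
  have : ω.support = ∅ := by
    rw [← subset_empty]
    intro x hx
    exact absurd (h'.2 hx) (disjoint_left.1 hST (h.2 hx))
  have h3 := h.1.card_support
  rw [this] at h3
  simp at h3

lemma supportedOn_orb {S : Finset V} {τ : List (Perm V)} (h : ∀ ω ∈ τ, ThreeCycleOn S ω) :
    SupportedOn (orb τ) S := by
  induction τ with
  | nil => exact fun x y h => Or.inl h
  | cons ω τ ih =>
    exact (ih fun ω hω => h ω (List.mem_cons_of_mem _ hω)).sup
      (supportedOn_sc fun x hx => (h ω List.mem_cons_self).apply_of_notMem hx)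

lemma prod_apply_of_notMem {S : Finset V} {τ : List (Perm V)} (h : ∀ ω ∈ τ, ThreeCycleOn S ω)
    {x : V} (hx : x ∉ S) : τ.prod x = x := by
  induction τ with
  | nil => rfl
  | cons ω τ ih =>
    rw [List.prod_cons, mul_apply, ih fun ω hω => h ω (List.mem_cons_of_mem _ hω)]
    exact (h ω List.mem_cons_self).apply_of_notMem hx

lemma prod_apply_mem {S : Finset V} {τ : List (Perm V)} (h : ∀ ω ∈ τ, ThreeCycleOn S ω)
    {x : V} (hx : x ∈ S) : τ.prod x ∈ S := by
  by_contra h'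
  have := prod_apply_of_notMem h h'
  exact h' (by rwa [τ.prod.injective this])

section TwoBlocks

variable {S T : Finset V} {τ : List (Perm V)}

open Classical in
/-- The members of a list that are 3-cycles on points of `S`. -/
noncomputable def restrictList (S : Finset V) (τ : List (Perm V)) : List (Perm V) :=
  τ.filter fun ω => ThreeCycleOn S ω

lemma mem_restrictList {ω : Perm V} :
    ω ∈ restrictList S τ ↔ ω ∈ τ ∧ ThreeCycleOn S ω := by
  simp [restrictList]

lemma threeCycleOn_of_mem_restrictList : ∀ ω ∈ restrictList S τ, ThreeCycleOn S ω :=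
  fun _ h => (mem_restrictList.1 h).2

variable (hST : Disjoint S T) (hτ : ∀ ω ∈ τ, ThreeCycleOn S ω ∨ ThreeCycleOn T ω)

include hST hτ

lemma orb_eq_sup : orb τ = orb (restrictList S τ) ⊔ orb (restrictList T τ) := by
  induction τ with
  | nil => simp [restrictList, orb]
  | cons ω τ ih =>
    have ih := ih fun ω hω => hτ ω (List.mem_cons_of_mem _ hω)
    rcases hτ ω List.mem_cons_self with h | h
    · have h' := h.not_of_disjoint hST
      have e1 : restrictList S (ω :: τ) = ω :: restrictList S τ := by simp [restrictList, h]
      have e2 : restrictList T (ω :: τ) = restrictList T τ := by simp [restrictList, h']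
      rw [e1, e2, orb, orb, ih, sup_right_comm]
    · have h' := h.not_of_disjoint hST.symm
      have e1 : restrictList S (ω :: τ) = restrictList S τ := by simp [restrictList, h']
      have e2 : restrictList T (ω :: τ) = ω :: restrictList T τ := by simp [restrictList, h]
      rw [e1, e2, orb, orb, ih, sup_assoc]

lemma length_eq_add : τ.length = (restrictList S τ).length + (restrictList T τ).length := by
  induction τ with
  | nil => simp [restrictList]
  | cons ω τ ih =>
    have ih := ih fun ω hω => hτ ω (List.mem_cons_of_mem _ hω)
    rcases hτ ω List.mem_cons_self with h | h
    · have h' := h.not_of_disjoint hST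
      have e1 : restrictList S (ω :: τ) = ω :: restrictList S τ := by simp [restrictList, h]
      have e2 : restrictList T (ω :: τ) = restrictList T τ := by simp [restrictList, h']
      rw [e1, e2, List.length_cons, List.length_cons, ih]
      ring
    · have h' := h.not_of_disjoint hST.symm
      have e1 : restrictList S (ω :: τ) = restrictList S τ := by simp [restrictList, h']
      have e2 : restrictList T (ω :: τ) = ω :: restrictList T τ := by simp [restrictList, h]
      rw [e1, e2, List.length_cons, List.length_cons, ih]
      ring

/-- Members on `T` fix every point of `S`, and members on `S` map `S` to itself. -/
lemma prod_apply_eq {x : V} (hx : x ∈ S) : τ.prod x = (restrictList S τ).prod x := by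
  induction τ with
  | nil => simp [restrictList]
  | cons ω τ ih =>
    have ih := ih fun ω hω => hτ ω (List.mem_cons_of_mem _ hω)
    rw [List.prod_cons, mul_apply, ih]
    rcases hτ ω List.mem_cons_self with h | h
    · have e1 : restrictList S (ω :: τ) = ω :: restrictList S τ := by simp [restrictList, h]
      rw [e1, List.prod_cons, mul_apply]
    · have h' := h.not_of_disjoint hST.symm
      have e1 : restrictList S (ω :: τ) = restrictList S τ := by simp [restrictList, h']
      rw [e1]
      exact h.apply_of_notMem (disjoint_left.1 hST
        (prod_apply_mem threeCycleOn_of_mem_restrictList hx))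

lemma sc_prod_eq_sup :
    sc τ.prod = sc (restrictList S τ).prod ⊔ sc (restrictList T τ).prod := by
  have hτ' : ∀ ω ∈ τ, ThreeCycleOn T ω ∨ ThreeCycleOn S ω := fun ω hω => (hτ ω hω).symm
  have hS : ∀ x ∉ S, (restrictList S τ).prod x = x :=
    fun x hx => prod_apply_of_notMem threeCycleOn_of_mem_restrictList hx
  have hT : ∀ x ∉ T, (restrictList T τ).prod x = x :=
    fun x hx => prod_apply_of_notMem threeCycleOn_of_mem_restrictList hx
  apply le_antisymm
  · rw [sc_le]
    intro x
    by_cases hxS : x ∈ S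
    · rw [prod_apply_eq hST hτ hxS]
      exact le_sup_left (b := sc (restrictList T τ).prod) (sc_self_apply _ x)
    · by_cases hxT : x ∈ T
      · rw [prod_apply_eq hST.symm hτ' hxT]
        exact le_sup_right (a := sc (restrictList S τ).prod) (sc_self_apply _ x)
      · rw [prod_apply_of_notMem (S := S ∪ T) (fun ω hω => ?_) (by simp [hxS, hxT])]
        · rcases hτ ω hω with h | h
          · exact h.mono subset_union_left
          · exact h.mono subset_union_right
  · refine sup_le (sc_le.2 fun x => ?_) (sc_le.2 fun x => ?_)
    · by_cases hxS : x ∈ S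
      · rw [← prod_apply_eq hST hτ hxS]
        exact sc_self_apply _ x
      · rw [hS x hxS]
    · by_cases hxT : x ∈ T
      · rw [← prod_apply_eq hST.symm hτ' hxT]
        exact sc_self_apply _ x
      · rw [hT x hxT]

lemma cls_orb_restrictList {x : V} (hx : x ∈ S) :
    cls (orb τ) x = cls (orb (restrictList S τ)) x := by
  rw [orb_eq_sup hST hτ]
  exact cls_sup_left hST (supportedOn_orb threeCycleOn_of_mem_restrictList)
    (supportedOn_orb threeCycleOn_of_mem_restrictList) (disjoint_left.1 hST hx)

lemma cls_sc_restrictList {x : V} (hx : x ∈ S) :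
    cls (sc τ.prod) x = cls (sc (restrictList S τ).prod) x := by
  rw [sc_prod_eq_sup hST hτ]
  exact cls_sup_left hST
    (supportedOn_sc fun _ hx => prod_apply_of_notMem threeCycleOn_of_mem_restrictList hx)
    (supportedOn_sc fun _ hx => prod_apply_of_notMem threeCycleOn_of_mem_restrictList hx)
    (disjoint_left.1 hST hx)

/-- Both restricted lists still act on all of `V`. This is harmless: a point that a list does not
move is an orbit and a cycle, and contributes 2 − 1 − 1 = 0. -/
lemma defect_eq_add : defect τ = defect (restrictList S τ) + defect (restrictList T τ) := by
  have h1 := numCls_sup hST (s := orb (restrictList S τ)) (t := orb (restrictList T τ))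
    (supportedOn_orb threeCycleOn_of_mem_restrictList)
    (supportedOn_orb threeCycleOn_of_mem_restrictList)
  have h2 := numCls_sup hST (s := sc (restrictList S τ).prod) (t := sc (restrictList T τ).prod)
    (supportedOn_sc fun _ hx => prod_apply_of_notMem threeCycleOn_of_mem_restrictList hx)
    (supportedOn_sc fun _ hx => prod_apply_of_notMem threeCycleOn_of_mem_restrictList hx)
  rw [← orb_eq_sup hST hτ] at h1
  rw [← sc_prod_eq_sup hST hτ] at h2
  have h3 := length_eq_add hST hτ
  unfold defect
  omega

end TwoBlocks

/-- Lists of 3-cycles of defect 0 on points of `S`. -/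
def PlanarOn (S : Finset V) (τ : List (Perm V)) : Prop :=
  (∀ ω ∈ τ, ThreeCycleOn S ω) ∧ defect τ = 0

lemma planarOn_univ {τ : List (Perm V)} : PlanarOn univ τ ↔ Planar τ := by
  simp [PlanarOn, Planar, ThreeCycleOn]

/-- The defect is additive and both parts are nonnegative, so it vanishes exactly if both parts do.
Each 3-cycle lies inside one orbit, hence on one side of a union of orbits. -/
lemma planarOn_blocks_iff {U T : Finset V} (hT : T ⊆ U) {τ : List (Perm V)} :
    ((∀ ω ∈ τ, ThreeCycleOn T ω ∨ ThreeCycleOn (U \ T) ω) ∧ PlanarOn T (restrictList T τ) ∧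
      PlanarOn (U \ T) (restrictList (U \ T) τ)) ↔
    PlanarOn U τ ∧ ∀ x ∈ T, cls (orb τ) x ⊆ T := by
  have hd : Disjoint T (U \ T) := disjoint_sdiff
  constructor
  · rintro ⟨h1, ⟨-, h2⟩, -, h3⟩
    refine ⟨⟨fun ω hω => ?_, ?_⟩, ?_⟩
    · rcases h1 ω hω with h | h
      · exact h.mono hT
      · exact h.mono sdiff_subset
    · rw [defect_eq_add hd h1, h2, h3, add_zero]
    · intro x hx y hy
      rw [cls_orb_restrictList hd h1 hx, mem_cls] at hy
      rcases supportedOn_orb threeCycleOn_of_mem_restrictList _ _ hy with rfl | h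
      · exact hx
      · exact h.2
  · rintro ⟨⟨h1, h2⟩, h3⟩
    have horb : ∀ τ' : List (Perm V), ∀ ω ∈ τ', sc ω ≤ orb τ' := by
      intro τ'
      induction τ' with
      | nil => simp
      | cons g τ' ih =>
        intro ω hω
        rcases List.mem_cons.1 hω with rfl | hω
        · exact le_sup_right
        · exact (ih ω hω).trans le_sup_left
    have h4 : ∀ ω ∈ τ, ThreeCycleOn T ω ∨ ThreeCycleOn (U \ T) ω := by
      intro ω hω
      by_cases h : ∃ x ∈ ω.support, x ∈ T
      · obtain ⟨x, hx, hxT⟩ := h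
        refine Or.inl ⟨(h1 ω hω).1, fun y hy => h3 x hxT (mem_cls.2 (horb τ ω hω ?_))⟩
        exact (h1 ω hω).1.isCycle.sameCycle (mem_support.1 hx) (mem_support.1 hy)
      · push Not at h
        exact Or.inr ⟨(h1 ω hω).1, fun x hx => mem_sdiff.2 ⟨(h1 ω hω).2 hx, h x hx⟩⟩
    have h5 := defect_eq_add hd h4
    have h6 := defect_nonneg (τ := restrictList T τ)
      fun ω hω => (threeCycleOn_of_mem_restrictList ω hω).1
    have h7 := defect_nonneg (τ := restrictList (U \ T) τ)
      fun ω hω => (threeCycleOn_of_mem_restrictList ω hω).1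
    exact ⟨h4, ⟨threeCycleOn_of_mem_restrictList, by omega⟩,
      threeCycleOn_of_mem_restrictList, by omega⟩

end Blocks

/-! ### Products of arrays of numbers and products of statistics on lists. -/

section Representation

variable {V : Type*} [Fintype V] [DecidableEq V] {R : Type*} [CommSemiring R]

/-- A statistic `θ U s r` depends only on the classes of the points of `U`. -/
def IsLocal (θ : Finset V → Setoid V → Setoid V → R) : Prop :=
  ∀ U s r s' r', (∀ x ∈ U, cls s x = cls s' x) → (∀ x ∈ U, cls r x = cls r' x) →
    θ U s r = θ U s' r'

open Classical in
/-- A statistic of the orbits and the cycles of the product, for the planar lists on `U`. -/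
noncomputable def planarStat (θ : Finset V → Setoid V → Setoid V → R) (U : Finset V)
    (τ : List (Perm V)) : R :=
  if PlanarOn U τ then θ U (orb τ) (sc τ.prod) else 0

/-- The array `A` counts the planar lists on the subsets of `V` with weight `θ`. -/
def Represents (A : ℕ → ℕ → R) (θ : Finset V → Setoid V → Setoid V → R) : Prop :=
  ∀ S m, A #S m = listSum m (planarStat θ S)

/-- The coefficients of the product of two exponential generating functions in two variables. -/
def conv (A B : ℕ → ℕ → R) (n m : ℕ) : R :=
  ∑ x ∈ antidiagonal n, n.choose x.1 • binConv (A x.1) (B x.2) m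

open Classical in
/-- The product of two statistics. -/
noncomputable def statMul (θ₁ θ₂ : Finset V → Setoid V → Setoid V → R) (U : Finset V)
    (s r : Setoid V) : R :=
  ∑ T ∈ U.powerset, if ∀ x ∈ T, cls s x ⊆ T then θ₁ T s r * θ₂ (U \ T) s r else 0

lemma IsLocal.statMul {θ₁ θ₂ : Finset V → Setoid V → Setoid V → R} (h₁ : IsLocal θ₁)
    (h₂ : IsLocal θ₂) : IsLocal (statMul θ₁ θ₂) := by
  intro U s r s' r' hs hr
  refine sum_congr rfl fun T hT => ?_
  have hTU := mem_powerset.1 hT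
  rw [h₁ T s r s' r' (fun x hx => hs x (hTU hx)) (fun x hx => hr x (hTU hx)),
    h₂ (U \ T) s r s' r' (fun x hx => hs x (sdiff_subset hx)) (fun x hx => hr x (sdiff_subset hx))]
  refine if_congr ?_ rfl rfl
  exact forall₂_congr fun x hx => by rw [hs x (hTU hx)]

lemma conv_card (A B : ℕ → ℕ → R) (S : Finset V) (m : ℕ) :
    conv A B #S m = ∑ T ∈ S.powerset, binConv (A #T) (B #(S \ T)) m := by
  have : ∑ T ∈ S.powerset, binConv (A #T) (B #(S \ T)) m =
      ∑ T ∈ S.powerset, (fun k => binConv (A k) (B (#S - k)) m) #T :=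
    sum_congr rfl fun T hT => by rw [card_sdiff_of_subset (mem_powerset.1 hT)]
  rw [this, sum_powerset_apply_card (fun k => binConv (A k) (B (#S - k)) m), ThreeCycles.conv,
    Nat.sum_antidiagonal_eq_sum_range_succ (fun i j => (#S).choose i • binConv (A i) (B j) m)]

/-- The binomial coefficient in the number of points chooses the subset `T`, the one in the length
chooses the shuffle. Locality makes the statistics of the two restricted lists equal to those of the
shuffled list. -/
lemma Represents.conv {A B : ℕ → ℕ → R} {θ₁ θ₂ : Finset V → Setoid V → Setoid V → R}
    (hA : Represents A θ₁) (hB : Represents B θ₂) (h₁ : IsLocal θ₁) (h₂ : IsLocal θ₂) :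
    Represents (conv A B) (statMul θ₁ θ₂) := by
  classical
  intro S m
  rw [conv_card]
  have key : ∀ T ∈ S.powerset, binConv (A #T) (B #(S \ T)) m =
      listSum m fun τ => if ∀ ω ∈ τ, ThreeCycleOn T ω ∨ ThreeCycleOn (S \ T) ω then
        planarStat θ₁ T (restrictList T τ) * planarStat θ₂ (S \ T) (restrictList (S \ T) τ)
        else 0 := by
    intro T hT
    have zero : ∀ (θ : Finset V → Setoid V → Setoid V → R) (U : Finset V) (l : List (Perm V)),
        (∃ a ∈ l, ¬ ThreeCycleOn U a) → planarStat θ U l = 0 := by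
      rintro θ U l ⟨a, ha, ha'⟩
      exact if_neg fun h => ha' (h.1 a ha)
    rw [show A #T = fun k => listSum k (planarStat θ₁ T) from funext fun k => hA T k,
      show B #(S \ T) = fun k => listSum k (planarStat θ₂ (S \ T)) from funext fun k => hB _ k,
      ← listSum_shuffle (fun a => ThreeCycleOn.not_of_disjoint disjoint_sdiff) m
        (zero θ₁ T) (zero θ₂ (S \ T))]
    refine listSum_congr fun l => ?_
    simp only [restrictList]
    congr
  rw [sum_congr rfl key, ← listSum_sum]
  refine listSum_congr fun τ => ?_
  simp only [planarStat, statMul]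
  by_cases hP : PlanarOn S τ
  · rw [if_pos hP]
    refine sum_congr rfl fun T hT => ?_
    have hTS := mem_powerset.1 hT
    by_cases hsat : ∀ x ∈ T, cls (orb τ) x ⊆ T
    · obtain ⟨k1, k2, k3⟩ := (planarOn_blocks_iff hTS).2 ⟨hP, hsat⟩
      rw [if_pos hsat, if_pos k1, if_pos k2, if_pos k3]
      have hd : Disjoint T (S \ T) := disjoint_sdiff
      have k1' := fun ω hω => (k1 ω hω).symm
      congr 1
      · exact h₁ _ _ _ _ _ (fun x hx => (cls_orb_restrictList hd k1 hx).symm)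
          (fun x hx => (cls_sc_restrictList hd k1 hx).symm)
      · exact h₂ _ _ _ _ _ (fun x hx => (cls_orb_restrictList hd.symm k1' hx).symm)
          (fun x hx => (cls_sc_restrictList hd.symm k1' hx).symm)
    · rw [if_neg hsat]
      split_ifs with k1 k2 k3
      · exact absurd ((planarOn_blocks_iff hTS).1 ⟨k1, k2, k3⟩).2 hsat
      all_goals simp
  · rw [if_neg hP]
    refine sum_eq_zero fun T hT => ?_
    split_ifs with k1 k2 k3
    · exact absurd ((planarOn_blocks_iff (mem_powerset.1 hT)).1 ⟨k1, k2, k3⟩).1 hP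
    all_goals simp

lemma Represents.map {R' : Type*} [CommSemiring R'] {A : ℕ → ℕ → R}
    {θ : Finset V → Setoid V → Setoid V → R} (h : Represents A θ) (L : R →+ R') :
    Represents (fun n m => L (A n m)) (fun U s r => L (θ U s r)) := by
  intro S m
  simp only
  rw [h S m, map_listSum]
  refine listSum_congr fun τ => ?_
  unfold planarStat
  split_ifs
  · rfl
  · exact map_zero L

end Representation

/-! ### Transport of lists along a bijection onto a subset. -/

section Relabel

variable {V W : Type*} [Fintype V] [DecidableEq V] [Fintype W] [DecidableEq W] {S : Finset V}
  (f : W ≃ S)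

/-- `s'` is the extension of `s` along `f`, trivial outside the image of `f`. -/
def Extends (s : Setoid W) (s' : Setoid V) : Prop :=
  (∀ x y, s' (f x) (f y) ↔ s x y) ∧ SupportedOn s' S

variable {f}

lemma Extends.sup {s t : Setoid W} {s' t' : Setoid V} (hs : Extends f s s')
    (ht : Extends f t t') : Extends f (s ⊔ t) (s' ⊔ t') := by
  refine ⟨fun x y => ⟨fun h => ?_, fun h => ?_⟩, hs.2.sup ht.2⟩
  · let u : Setoid V :=
      { r := fun x y => x = y ∨ ∃ a b, x = f a ∧ y = f b ∧ (s ⊔ t) a b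
        iseqv := by
          refine ⟨fun x => Or.inl rfl, ?_, ?_⟩
          · rintro x y (rfl | ⟨a, b, rfl, rfl, h⟩)
            · exact Or.inl rfl
            · exact Or.inr ⟨b, a, rfl, rfl, Setoid.symm' _ h⟩
          · rintro x y z (rfl | ⟨a, b, rfl, rfl, h⟩) h'
            · exact h'
            · rcases h' with rfl | ⟨c, d, h1, rfl, h2⟩
              · exact Or.inr ⟨a, b, rfl, rfl, h⟩
              · obtain rfl := f.injective (Subtype.ext h1)
                exact Or.inr ⟨a, d, rfl, rfl, Setoid.trans' _ h h2⟩ }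
    have aux : ∀ {r : Setoid W} {r' : Setoid V}, Extends f r r' → r ≤ s ⊔ t → r' ≤ u := by
      intro r r' hr hle x y hxy
      rcases hr.2 x y hxy with rfl | ⟨hx, hy⟩
      · exact Or.inl rfl
      · refine Or.inr ⟨f.symm ⟨x, hx⟩, f.symm ⟨y, hy⟩, by simp, by simp, hle ?_⟩
        rw [← hr.1]
        simpa using hxy
    rcases sup_le (aux hs le_sup_left) (aux ht le_sup_right) h with h | ⟨a, b, h1, h2, h3⟩
    · obtain rfl := f.injective (Subtype.ext h)
      exact Setoid.refl' _ x
    · obtain rfl := f.injective (Subtype.ext h1)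
      obtain rfl := f.injective (Subtype.ext h2)
      exact h3
  · have hle : s ⊔ t ≤ (s' ⊔ t').comap fun x => (f x : V) :=
      sup_le (fun x y h => le_sup_left (b := t') ((hs.1 x y).2 h))
        (fun x y h => le_sup_right (a := s') ((ht.1 x y).2 h))
    exact hle h

lemma Extends.wsum {M : Type*} [AddCommMonoid M] {s : Setoid W} {s' : Setoid V}
    (hs : Extends f s s') (w : ℕ → M) : wsum S s' w = wsum univ s w := by
  let g : W ↪ V := f.toEmbedding.trans (Function.Embedding.subtype _)
  have hcls : ∀ x, cls s' (g x) = (cls s x).map g := by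
    intro x
    ext y
    rw [mem_cls, mem_map]
    constructor
    · intro h
      have hy : y ∈ S := by
        rcases hs.2 _ _ h with rfl | h
        · exact (f x).2
        · exact h.2
      refine ⟨f.symm ⟨y, hy⟩, ?_, by simp [g]⟩
      rw [mem_cls, ← hs.1]
      simpa [g] using h
    · rintro ⟨z, hz, rfl⟩
      exact (hs.1 _ _).2 (mem_cls.1 hz)
  have hS : S = univ.map g := by
    ext x
    simp only [mem_map, mem_univ, true_and]
    constructor
    · exact fun hx => ⟨f.symm ⟨x, hx⟩, by simp [g]⟩
    · rintro ⟨y, rfl⟩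
      exact (f y).2
  unfold ThreeCycles.wsum
  have : S.image (cls s') = (univ.image (cls s)).map ⟨Finset.map g, Finset.map_injective g⟩ := by
    conv_lhs => rw [hS]
    rw [map_eq_image, map_eq_image, image_image, image_image]
    refine image_congr fun x _ => hcls x
  rw [this, sum_map]
  simp

lemma Extends.numCls {s : Setoid W} {s' : Setoid V} (hs : Extends f s s') :
    numCls s' + Fintype.card W = numCls s + Fintype.card V := by
  have hu : (univ : Finset V) = S ∪ Sᶜ := (union_compl S).symm
  have hc : Fintype.card W = #S := by rw [Fintype.card_congr f, Fintype.card_coe]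
  unfold ThreeCycles.numCls
  rw [hu, wsum_union, hs.wsum, wsum_singletons (S := Sᶜ)
    (fun x hx => cls_of_notMem hs.2 (mem_compl.1 hx)), hc, ← card_add_card_compl S]
  · simp only [smul_eq_mul, mul_one]
    ring
  · intro x hx y hy hxy
    rcases hs.2 x y hxy with rfl | h
    · exact mem_compl.1 hy hx
    · exact mem_compl.1 hy h.2

variable (f) in
/-- Extension of permutations along `f`. -/
noncomputable def extPerm : Perm W →* Perm V := Perm.extendDomainHom f

lemma extPerm_apply (σ : Perm W) (x : W) : extPerm f σ (f x) = f (σ x) :=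
  Perm.extendDomain_apply_image σ f x

lemma extPerm_of_notMem (σ : Perm W) {x : V} (hx : x ∉ S) : extPerm f σ x = x :=
  Perm.extendDomain_apply_not_subtype σ f hx

lemma extPerm_injective : Function.Injective (extPerm f) :=
  Perm.extendDomainHom_injective f

lemma extends_sc (σ : Perm W) : Extends f (sc σ) (sc (extPerm f σ)) :=
  ⟨fun _ _ => sameCycle_extendDomain, supportedOn_sc fun _ hx => extPerm_of_notMem σ hx⟩

lemma extends_orb (τ : List (Perm W)) : Extends f (orb τ) (orb (τ.map (extPerm f))) := by
  induction τ with
  | nil =>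
    refine ⟨fun x y => ?_, fun x y h => Or.inl h⟩
    change ((f x : V) = f y) ↔ x = y
    rw [SetLike.coe_eq_coe, f.apply_eq_iff_eq]
  | cons ω τ ih => exact ih.sup (extends_sc ω)

lemma defect_map_extPerm (τ : List (Perm W)) : defect (τ.map (extPerm f)) = defect τ := by
  have h1 := (extends_orb (f := f) τ).numCls
  have h2 := (extends_sc (f := f) τ.prod).numCls
  rw [map_list_prod] at h2
  unfold defect
  rw [List.length_map]
  omega

lemma threeCycleOn_extPerm {ω : Perm W} : ThreeCycleOn S (extPerm f ω) ↔ ω.IsThreeCycle := by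
  have h : (extPerm f ω).cycleType = ω.cycleType := cycleType_extendDomain f
  constructor
  · intro h'
    rw [IsThreeCycle, ← h]
    exact h'.1
  · intro h'
    refine ⟨h.trans h', fun x hx => ?_⟩
    by_contra hxS
    exact mem_support.1 hx (extPerm_of_notMem ω hxS)

lemma ThreeCycleOn.mem_range_extPerm {ω : Perm V} (h : ThreeCycleOn S ω) :
    ω ∈ Set.range (extPerm f) := by
  have hS : ∀ x, x ∈ S ↔ ω x ∈ S := by
    intro x
    by_cases hx : ω x = x
    · rw [hx]
    · exact ⟨fun _ => h.2 (apply_mem_support.2 (mem_support.2 hx)),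
        fun _ => h.2 (mem_support.2 hx)⟩
  refine ⟨f.symm.permCongr (ω.subtypePerm fun x => (hS x).symm), ?_⟩
  ext x
  by_cases hx : x ∈ S
  · obtain ⟨y, hy⟩ := f.surjective ⟨x, hx⟩
    have hxy : x = f y := by rw [hy]
    rw [hxy, extPerm_apply]
    simp
  · rw [extPerm_of_notMem _ hx, h.apply_of_notMem hx]

lemma planarOn_map_extPerm {τ : List (Perm W)} :
    PlanarOn S (τ.map (extPerm f)) ↔ PlanarOn univ τ := by
  rw [planarOn_univ, PlanarOn, Planar, defect_map_extPerm]
  simp [threeCycleOn_extPerm]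

/-- Planar lists on `S` correspond to planar lists on `W`, if `W` and `S` are in bijection. -/
lemma listSum_planarStat_extPerm {R : Type*} [CommSemiring R]
    {θ : Finset V → Setoid V → Setoid V → R} {θ' : Finset W → Setoid W → Setoid W → R}
    (h : ∀ s r s' r', Extends f s s' → Extends f r r' → θ S s' r' = θ' univ s r) (m : ℕ) :
    listSum m (planarStat θ S) = listSum m (planarStat θ' univ) := by
  rw [listSum_map (extPerm_injective (f := f))]
  · refine listSum_congr fun τ => ?_
    classical
    refine if_congr planarOn_map_extPerm ?_ rfl
    rw [← map_list_prod]
    exact h _ _ _ _ (extends_orb τ) (extends_sc _)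
  · rintro l ⟨ω, hω, hω'⟩
    exact if_neg fun h => hω' ((h.1 ω hω).mem_range_extPerm)

end Relabel

/-! ### Cycle-type monomials, marked points, and the operators `i ∂/∂pᵢ`. -/

section Weights

variable {V : Type*} [Fintype V] [DecidableEq V] (K : Type*) [Field K]

/-- The exponent vector of the cycle type of `r` on `U`. -/
noncomputable def expo (U : Finset V) (r : Setoid V) : ℕ+ →₀ ℕ :=
  wsum U r fun k => Finsupp.single k.toPNat' 1

/-- The monomial with exponent `e`. -/
noncomputable abbrev mon (e : ℕ+ →₀ ℕ) : MvPolynomial ℕ+ K := MvPolynomial.monomial e 1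

lemma mon_mul_mon (e e' : ℕ+ →₀ ℕ) : mon K e * mon K e' = mon K (e + e') := by
  simp [mon, MvPolynomial.monomial_mul]

lemma X_eq_mon (i : ℕ+) : (MvPolynomial.X i : MvPolynomial ℕ+ K) = mon K (Finsupp.single i 1) := rfl

/-- `U` is a single class of `s`. -/
def IsBlock (U : Finset V) (s : Setoid V) : Prop := U.Nonempty ∧ ∀ x ∈ U, cls s x = U

open Classical in
/-- The weight of a connected structure. -/
noncomputable def connStat (U : Finset V) (s r : Setoid V) : MvPolynomial ℕ+ K :=
  if IsBlock U s then mon K (expo U r) else 0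

lemma isLocal_connStat : IsLocal (connStat (V := V) K) := by
  intro U s r s' r' hs hr
  classical
  unfold connStat
  rw [expo, expo, wsum_congr hr]
  refine if_congr (and_congr_right fun _ => forall₂_congr fun x hx => ?_) rfl rfl
  rw [hs x hx]

/-- The generating polynomials of the minimal transitive factorizations of length `m` on `n`
points. -/
noncomputable def totalWt (n m : ℕ) : MvPolynomial ℕ+ K :=
  listSum m (planarStat (connStat K) (univ : Finset (Fin n)))

/-- `totalWt` counts on `Fin n` only; relabelling gives the same count on every subset of size `n`
of any finite set. -/
lemma represents_totalWt : Represents (totalWt K) (connStat (V := V) K) := by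
  intro S m
  rw [totalWt]
  refine (listSum_planarStat_extPerm (f := S.equivFin.symm) ?_ m).symm
  intro s r s' r' hs hr
  classical
  unfold connStat
  rw [expo, hr.wsum]
  refine if_congr (and_congr ?_ ?_) rfl rfl
  · constructor
    · rintro ⟨x, hx⟩
      exact ⟨S.equivFin ⟨x, hx⟩, mem_univ _⟩
    · rintro ⟨y, -⟩
      exact ⟨_, (S.equivFin.symm y).2⟩
  · constructor
    · intro h y _
      ext z
      simp only [mem_cls, mem_univ, iff_true]
      rw [← hs.1]
      rw [← mem_cls, h _ (S.equivFin.symm y).2]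
      exact (S.equivFin.symm z).2
    · intro h x hx
      ext y
      rw [mem_cls]
      constructor
      · intro hxy
        rcases hs.2 x y hxy with rfl | h'
        · exact hx
        · exact h'.2
      · intro hy
        have := hs.1 (S.equivFin ⟨x, hx⟩) (S.equivFin ⟨y, hy⟩)
        simp only [Equiv.symm_apply_apply] at this
        rw [this, ← mem_cls, h _ (mem_univ _)]
        exact mem_univ _

/-- The operator `i ∂/∂pᵢ`. -/
noncomputable def markOp (i : ℕ+) : MvPolynomial ℕ+ K →+ MvPolynomial ℕ+ K :=
  (i : ℕ) • (MvPolynomial.pderiv i).toLinearMap.toAddMonoidHom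

lemma markOp_apply (i : ℕ+) (f : MvPolynomial ℕ+ K) :
    markOp K i f = (i : ℕ) • MvPolynomial.pderiv i f := rfl

/-- The weight of a connected structure with a marked point on a cycle of length `i`. -/
noncomputable def markStat (i : ℕ+) (U : Finset V) (s r : Setoid V) : MvPolynomial ℕ+ K :=
  markOp K i (connStat K U s r)

lemma isLocal_markStat (i : ℕ+) : IsLocal (markStat (V := V) K i) := by
  intro U s r s' r' hs hr
  rw [markStat, markStat, isLocal_connStat K U s r s' r' hs hr]

/-- The coefficients of `i ∂F/∂pᵢ`. -/
noncomputable def markWt (i : ℕ+) (n m : ℕ) : MvPolynomial ℕ+ K := markOp K i (totalWt K n m)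

lemma represents_markWt (i : ℕ+) : Represents (markWt K i) (markStat (V := V) K i) :=
  (represents_totalWt K).map (markOp K i)

lemma toPNat'_card_cls (r : Setoid V) (v : V) : ((#(cls r v)).toPNat' : ℕ) = #(cls r v) := by
  rw [Nat.toPNat'_coe, if_pos (card_pos.2 ⟨v, self_mem_cls r v⟩)]

lemma expo_apply (U : Finset V) (r : Setoid V) (i : ℕ+) :
    expo U r i = wsum U r fun j => if j = (i : ℕ) then 1 else 0 := by
  unfold expo wsum
  rw [Finsupp.finsetSum_apply]
  refine sum_congr rfl fun C hC => ?_
  obtain ⟨x, -, rfl⟩ := mem_image.1 hC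
  rw [Finsupp.single_apply]
  exact if_congr (by rw [← PNat.coe_inj, toPNat'_card_cls]) rfl rfl

lemma expo_eq_add {U : Finset V} {r : Setoid V} (hU : ∀ x ∈ U, cls r x ⊆ U) {v : V} (hv : v ∈ U) :
    expo U r = Finsupp.single (#(cls r v)).toPNat' 1 + expo (U \ cls r v) r := by
  conv_lhs => rw [← union_sdiff_of_subset (hU v hv)]
  rw [expo, wsum_union, wsum_cls]
  · rfl
  · intro x hx y hy hxy
    exact (mem_sdiff.1 hy).2 (mem_cls.2 (Setoid.trans' _ (mem_cls.1 hx) hxy))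

/-- If `m` cycles have length `i`, then `i ∂/∂pᵢ` removes one `pᵢ` and multiplies by `i m`, which is
the number of points on these cycles. So the operator marks a point and drops the weight of its
cycle. -/
lemma markOp_mon_expo {U : Finset V} {r : Setoid V} (hU : ∀ x ∈ U, cls r x ⊆ U) (i : ℕ+) :
    markOp K i (mon K (expo U r)) =
      ∑ v ∈ U, if (#(cls r v)).toPNat' = i then mon K (expo (U \ cls r v) r) else 0 := by
  have h1 : ∀ v ∈ U, (if (#(cls r v)).toPNat' = i then mon K (expo (U \ cls r v) r) else 0) =
      if (#(cls r v)).toPNat' = i then mon K (expo U r - Finsupp.single i 1) else 0 := by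
    intro v hv
    split_ifs with h
    · rw [expo_eq_add hU hv, h, add_tsub_cancel_left]
    · rfl
  rw [sum_congr rfl h1, ← sum_filter, sum_const, markOp_apply, MvPolynomial.pderiv_monomial,
    one_mul]
  have h2 : #{v ∈ U | (#(cls r v)).toPNat' = i} = i * expo U r i := by
    rw [expo_apply, ← card_filter_card_cls U r hU]
    congr 1
    refine filter_congr fun v _ => ?_
    rw [← PNat.coe_inj, toPNat'_card_cls]
  rw [h2, mul_smul]
  congr 1
  rw [← map_nsmul, nsmul_one]

/-- The weight of the other cycles in the block of a marked point. -/
noncomputable def restWt (s r : Setoid V) (v : V) : MvPolynomial ℕ+ K :=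
  mon K (expo (cls s v \ cls r v) r)

variable {s r : Setoid V}

lemma cls_subset_cls (hrs : r ≤ s) {x y : V} (h : x ∈ cls s y) : cls r x ⊆ cls s y := by
  intro z hz
  exact mem_cls.2 (Setoid.trans' _ (mem_cls.1 h) (hrs (mem_cls.1 hz)))

-- A marked point determines its block, so `U` being a block is expressed through the class of `v`.
open Classical in
lemma markStat_eq (hrs : r ≤ s) (i : ℕ+) (U : Finset V) :
    markStat K i U s r = ∑ v, if cls s v = U ∧ (#(cls r v)).toPNat' = i then
      restWt K s r v else 0 := by
  unfold markStat connStat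
  split_ifs with h
  · obtain ⟨⟨x, hx⟩, h⟩ := h
    rw [markOp_mon_expo K (fun y hy => by
      rw [← h x hx] at hy ⊢
      exact cls_subset_cls hrs hy), ← sum_subset (subset_univ U)]
    · refine sum_congr rfl fun v hv => ?_
      rw [restWt, h v hv]
      exact if_congr (by simp) rfl rfl
    · intro v _ hv
      refine if_neg fun h' => hv ?_
      rw [← h'.1]
      exact self_mem_cls s v
  · rw [map_zero]
    refine (sum_eq_zero fun v _ => if_neg fun h' => h ?_).symm
    rw [← h'.1]
    exact ⟨⟨v, self_mem_cls s v⟩, fun x hx => cls_eq_iff.2 (Setoid.symm' _ (mem_cls.1 hx))⟩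

-- The sum over subsets `T` collapses: the marked point `v` forces `T` to be its class.
open Classical in
lemma statMul_markStat (hrs : r ≤ s) (i : ℕ+) (θ : Finset V → Setoid V → Setoid V → MvPolynomial ℕ+ K)
    (U : Finset V) : statMul (markStat K i) θ U s r =
      ∑ v, if cls s v ⊆ U ∧ (#(cls r v)).toPNat' = i then
        restWt K s r v * θ (U \ cls s v) s r else 0 := by
  unfold statMul
  simp only [markStat_eq K hrs]
  have : ∀ T ∈ U.powerset, (if ∀ x ∈ T, cls s x ⊆ T then
      (∑ v, if cls s v = T ∧ (#(cls r v)).toPNat' = i then restWt K s r v else 0) *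
        θ (U \ T) s r else 0) =
      ∑ v, if cls s v = T ∧ (#(cls r v)).toPNat' = i then restWt K s r v * θ (U \ cls s v) s r
        else 0 := by
    intro T hT
    rw [sum_mul]
    split_ifs with h
    · refine sum_congr rfl fun v _ => ?_
      rw [ite_mul, zero_mul]
      split_ifs with h'
      · rw [h'.1]
      · rfl
    · refine (sum_eq_zero fun v _ => if_neg fun h' => h ?_).symm
      rw [← h'.1]
      intro x hx
      rw [cls_eq_iff.2 (Setoid.symm' _ (mem_cls.1 hx))]
  rw [sum_congr rfl this, sum_comm]
  refine sum_congr rfl fun v _ => ?_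
  by_cases hv : cls s v ⊆ U
  · rw [sum_eq_single_of_mem (cls s v) (mem_powerset.2 hv)]
    · exact if_congr (by simp [hv]) rfl rfl
    · intro T _ hT
      exact if_neg fun h => hT h.1.symm
  · rw [if_neg fun h => hv h.1]
    refine sum_eq_zero fun T hT => if_neg fun h => hv ?_
    rw [h.1]
    exact mem_powerset.1 hT

/-- A bound for the lengths of cycles on `n` points. -/
def lengthBox (n : ℕ) : Finset ℕ+ := Icc 1 n.succPNat

/-- The box reaches up to `n + 1`, which is a positive integer also for `n = 0`. It only has to be
finite and contain all cycle lengths. -/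
lemma mem_lengthBox {n : ℕ} {i : ℕ+} (h : (i : ℕ) ≤ n) : i ∈ lengthBox n := by
  rw [lengthBox, mem_Icc, ← PNat.coe_le_coe, ← PNat.coe_le_coe, Nat.succPNat_coe]
  exact ⟨i.2, by omega⟩

lemma card_cls_mem_lengthBox (r : Setoid V) (v : V) :
    (#(cls r v)).toPNat' ∈ lengthBox (Fintype.card V) := by
  apply mem_lengthBox
  rw [toPNat'_card_cls]
  exact card_le_univ _

lemma disjoint_cover_two (s : Setoid V) (a c : V) :
    cls s c = univ \ cls s a ↔ ¬ s a c ∧ ∀ x, s a x ∨ s c x := by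
  simp only [Finset.ext_iff, mem_cls, mem_sdiff, mem_univ, true_and]
  constructor
  · intro h
    exact ⟨(h c).1 (Setoid.refl' _ _), fun x => by have := h x; tauto⟩
  · rintro ⟨h1, h2⟩ x
    constructor
    · exact fun h h' => h1 (Setoid.trans' _ h' (Setoid.symm' _ h))
    · intro h
      have := h2 x
      tauto

lemma disjoint_cover_three (s : Setoid V) (a b c : V) :
    cls s b ⊆ univ \ cls s a ∧ cls s c = (univ \ cls s a) \ cls s b ↔
      (¬ s a b ∧ ¬ s b c ∧ ¬ s a c) ∧ ∀ x, s a x ∨ s b x ∨ s c x := by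
  simp only [Finset.ext_iff, subset_iff, mem_cls, mem_sdiff, mem_univ, true_and]
  constructor
  · rintro ⟨h1, h2⟩
    have h3 := (h2 c).1 (Setoid.refl' _ _)
    exact ⟨⟨h1 (Setoid.refl' _ b), h3.2, h3.1⟩, fun x => by have := h2 x; tauto⟩
  · rintro ⟨⟨h1, h2, h3⟩, h4⟩
    refine ⟨fun x h h' => h1 (Setoid.trans' _ h' (Setoid.symm' _ h)), fun x => ⟨fun h => ⟨fun h' =>
      h3 (Setoid.trans' _ h' (Setoid.symm' _ h)), fun h' =>
      h2 (Setoid.trans' _ h' (Setoid.symm' _ h))⟩, fun h => ?_⟩⟩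
    have := h4 x
    tauto

end Weights

/-! ### Positions of the points of a 3-cycle and the resulting cycle types. -/

section Identities

variable {V : Type*} [Fintype V] [DecidableEq V] (K : Type*) [Field K]

/-- The three ways in which `(a b c)` can split off from `σ`. -/
def SplitType (i : Fin 3) (σ : Perm V) (a b c : V) : Prop :=
  match i with
  | 0 => CyclicOrder σ a b c
  | 1 => sc σ b a ∧ ¬ sc σ c b
  | 2 => ¬ sc σ a b ∧ ¬ sc σ b c ∧ ¬ sc σ a c

/-- `ω :: τ` has defect 0 and is transitive, and `ω` splits off from the product with type `i`. -/
def IsStep (i : Fin 3) (τ : List (Perm V)) (ω : Perm V) : Prop :=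
  (Planar (ω :: τ) ∧ orb (ω :: τ) = ⊤) ∧ HasForm (SplitType i (ω * τ.prod)) ω

/-- The cyclic length of the class of `v`. -/
noncomputable abbrev clen (r : Setoid V) (v : V) : ℕ+ := (#(cls r v)).toPNat'

lemma clen_sc (σ : Perm V) (v : V) : clen (sc σ) v = (len σ v).toPNat' := by
  rw [clen, card_cls_sc]

lemma coe_clen_sc (σ : Perm V) (v : V) : (clen (sc σ) v : ℕ) = len σ v := by
  rw [clen, toPNat'_card_cls, card_cls_sc]

/-- The weight of a permutation. -/
noncomputable def permWt (σ : Perm V) : MvPolynomial ℕ+ K := mon K (expo univ (sc σ))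

section Forms

variable {τ : List (Perm V)} {ω : Perm V}

lemma isStep_iff_hasForm {i : Fin 3} {Q : V → V → V → Prop}
    (h : ∀ a b c, Distinct a b c → ((Planar (tri a b c :: τ) ∧ orb (tri a b c :: τ) = ⊤) ∧
      SplitType i (tri a b c * τ.prod) a b c ↔ Q a b c)) :
    IsStep i τ ω ↔ HasForm Q ω := by
  constructor
  · rintro ⟨h1, a, b, c, hd, rfl, h2⟩
    exact ⟨a, b, c, hd, rfl, (h a b c hd).1 ⟨h1, h2⟩⟩
  · rintro ⟨a, b, c, hd, rfl, h2⟩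
    obtain ⟨h3, h4⟩ := (h a b c hd).2 h2
    exact ⟨h3, a, b, c, hd, rfl, h4⟩

/-- Three points in three blocks that cover everything. -/
def Separated (s : Setoid V) (a b c : V) : Prop :=
  (¬ s a b ∧ ¬ s b c ∧ ¬ s a c) ∧ ∀ x, s a x ∨ s b x ∨ s c x

lemma isStep_zero_iff : IsStep 0 τ ω ↔
    HasForm (fun a b c => Planar τ ∧ Separated (orb τ) a b c) ω :=
  isStep_iff_hasForm fun _ _ _ hd => step_join hd.1 hd.2.1 hd.2.2

lemma isStep_one_iff : IsStep 1 τ ω ↔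
    HasForm (fun a b c => Planar τ ∧ sc τ.prod c b ∧ ¬ orb τ a c ∧
      ∀ x, orb τ a x ∨ orb τ c x) ω :=
  isStep_iff_hasForm fun _ _ _ hd => step_exchange hd.1 hd.2.1 hd.2.2

lemma isStep_two_iff : IsStep 2 τ ω ↔
    HasForm (fun a b c => (Planar τ ∧ orb τ = ⊤) ∧ CyclicOrder τ.prod c b a) ω :=
  isStep_iff_hasForm fun _ _ _ hd => step_cut hd.1 hd.2.1 hd.2.2

end Forms

section Positions

variable {M : Type*} [AddCommMonoid M]

-- A second point on the cycle of `c` is a splitting of the cycle length into two positive parts,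
-- the first being the distance from `c`.
open Classical in
lemma sum_sameCycle_eq (σ : Perm V) (c : V) (F : V → M) :
    (∑ b, if sc σ c b ∧ b ≠ c then F b else 0) =
      ∑ x ∈ lengthBox (Fintype.card V) ×ˢ lengthBox (Fintype.card V),
        if clen (sc σ) c = x.1 + x.2 then F ((σ ^ (x.1 : ℕ)) c) else 0 := by
  have hle : len σ c ≤ Fintype.card V := by
    rw [← card_cls_sc]; exact card_le_univ _
  rw [← sum_filter, ← sum_filter]
  symm
  have hl : ∀ x : ℕ+ × ℕ+, clen (sc σ) c = x.1 + x.2 ↔ len σ c = x.1 + x.2 := by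
    intro x
    rw [← PNat.coe_inj, coe_clen_sc, PNat.add_coe]
  refine sum_bij (fun x _ => (σ ^ (x.1 : ℕ)) c) ?_ ?_ ?_ fun _ _ => rfl
  · intro x hx
    have hx := (hl x).1 (mem_filter.1 hx).2
    refine mem_filter.2 ⟨mem_univ _, sc_pow_apply _ _ _, fun h => ?_⟩
    have h2 := x.2.pos
    have := pow_apply_injOn (i := x.1) (j := 0) (by omega) (len_pos _ _) h
    exact x.1.ne_zero this
  · intro x hx y hy h
    have hx := (hl x).1 (mem_filter.1 hx).2
    have hy := (hl y).1 (mem_filter.1 hy).2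
    have h1 := x.2.pos
    have h2 := y.2.pos
    have h3 := pow_apply_injOn (by omega) (by omega) h
    exact Prod.ext (PNat.eq h3) (PNat.eq (by omega))
  · intro b hb
    obtain ⟨h1, h2⟩ := (mem_filter.1 hb).2
    obtain ⟨i, hi, rfl⟩ := exists_pow_lt_len h1
    have hi0 : 0 < i := by
      rcases Nat.eq_zero_or_pos i with rfl | h
      · exact absurd rfl h2
      · exact h
    refine ⟨(⟨i, hi0⟩, ⟨len σ c - i, by omega⟩), mem_filter.2 ⟨mem_product.2 ⟨mem_lengthBox ?_,
      mem_lengthBox ?_⟩, (hl _).2 ?_⟩, rfl⟩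
    · change i ≤ _
      omega
    · change len σ c - i ≤ _
      omega
    · change len σ c = i + (len σ c - i)
      omega

-- Two further points in the order `c, b, a` are a splitting of the cycle length into three positive
-- parts.
open Classical in
lemma sum_cyclicOrder_eq (σ : Perm V) (c : V) (F : V → V → M) :
    (∑ x : V × V, if CyclicOrder σ c x.2 x.1 then F x.1 x.2 else 0) =
      ∑ x ∈ lengthBox (Fintype.card V) ×ˢ lengthBox (Fintype.card V) ×ˢ lengthBox (Fintype.card V),
        if clen (sc σ) c = x.1 + x.2.1 + x.2.2 then
          F ((σ ^ (x.1 + x.2.1 : ℕ)) c) ((σ ^ (x.1 : ℕ)) c) else 0 := by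
  have hle : len σ c ≤ Fintype.card V := by
    rw [← card_cls_sc]; exact card_le_univ _
  rw [← sum_filter, ← sum_filter]
  symm
  have hl : ∀ x : ℕ+ × ℕ+ × ℕ+, clen (sc σ) c = x.1 + x.2.1 + x.2.2 ↔
      len σ c = x.1 + x.2.1 + x.2.2 := by
    intro x
    rw [← PNat.coe_inj, coe_clen_sc, PNat.add_coe, PNat.add_coe]
  refine sum_bij (fun x _ => ((σ ^ (x.1 + x.2.1 : ℕ)) c, (σ ^ (x.1 : ℕ)) c)) ?_ ?_ ?_
    fun _ _ => rfl
  · intro x hx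
    have hx := (hl x).1 (mem_filter.1 hx).2
    have h0 := x.1.pos
    have h1 := x.2.1.pos
    have h2 := x.2.2.pos
    exact mem_filter.2 ⟨mem_univ _, x.1, x.1 + x.2.1, h0, by omega, by omega, rfl, rfl⟩
  · intro x hx y hy h
    have hx := (hl x).1 (mem_filter.1 hx).2
    have hy := (hl y).1 (mem_filter.1 hy).2
    have h1 := x.2.2.pos
    have h2 := y.2.2.pos
    have h3 := pow_apply_injOn (by omega) (by omega) (congrArg Prod.fst h)
    have h4 := pow_apply_injOn (by omega) (by omega) (congrArg Prod.snd h)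
    exact Prod.ext (PNat.eq h4) (Prod.ext (PNat.eq (by omega)) (PNat.eq (by omega)))
  · rintro ⟨a, b⟩ hx
    obtain ⟨s, t, hs, hst, ht, rfl, rfl⟩ := (mem_filter.1 hx).2
    refine ⟨(⟨s, hs⟩, ⟨t - s, by omega⟩, ⟨len σ c - t, by omega⟩),
      mem_filter.2 ⟨mem_product.2 ⟨mem_lengthBox ?_, mem_product.2 ⟨mem_lengthBox ?_,
      mem_lengthBox ?_⟩⟩, (hl _).2 ?_⟩, ?_⟩
    · change s ≤ _
      omega
    · change t - s ≤ _
      omega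
    · change len σ c - t ≤ _
      omega
    · change len σ c = s + (t - s) + (len σ c - t)
      omega
    · change ((σ ^ (s + (t - s))) c, (σ ^ s) c) = _
      rw [show s + (t - s) = t by omega]

end Positions

section Weights

variable {K} {s : Setoid V} {σ : Perm V}

lemma expo_cls (hσ : sc σ ≤ s) (a : V) : expo (cls s a) (sc σ) =
    Finsupp.single (clen (sc σ) a) 1 + expo (cls s a \ cls (sc σ) a) (sc σ) :=
  expo_eq_add (fun _ hx => cls_subset_cls hσ hx) (self_mem_cls s a)

lemma toPNat'_add {m n : ℕ} (hm : 0 < m) (hn : 0 < n) :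
    (m + n).toPNat' = m.toPNat' + n.toPNat' := by
  apply PNat.eq
  rw [PNat.add_coe, Nat.toPNat'_coe, Nat.toPNat'_coe, Nat.toPNat'_coe, if_pos hm, if_pos hn,
    if_pos (by omega)]

/-- All cycles but the three marked ones survive and make up the three factors `restWt`; the marked
ones become a single cycle. The exponents are compared after adding back the marked cycles, because
exponent vectors have no subtraction. -/
lemma permWt_tri_of_separated (hσ : sc σ ≤ s) {a b c : V} (h : Separated s a b c) :
    permWt K (tri a b c * σ) = MvPolynomial.X (clen (sc σ) a + clen (sc σ) b + clen (sc σ) c) *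
      (restWt K s (sc σ) a * (restWt K s (sc σ) b * restWt K s (sc σ) c)) := by
  obtain ⟨⟨hab, hbc, hac⟩, hcov⟩ := h
  have h1 := wsum_tri_of_not (σ := σ) (fun h => hab (hσ h)) (fun h => hbc (hσ h))
    (fun h => hac (hσ h)) fun k => Finsupp.single k.toPNat' 1
  have hu : (univ : Finset V) = cls s a ∪ (cls s b ∪ cls s c) := by
    ext x
    simpa using hcov x
  have d : ∀ {a b : V}, ¬ s a b → ∀ x ∈ cls s a, ∀ y ∈ cls s b, ¬ sc σ x y := by
    intro a b hab x hx y hy hxy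
    exact hab (Setoid.trans' _ (mem_cls.1 hx) (Setoid.trans' _ (hσ hxy)
      (Setoid.symm' _ (mem_cls.1 hy))))
  have h2 : expo univ (sc σ) = expo (cls s a) (sc σ) + (expo (cls s b) (sc σ) +
      expo (cls s c) (sc σ)) := by
    conv_lhs => rw [hu]
    rw [expo, wsum_union, wsum_union (d hbc)]
    · rfl
    · intro x hx y hy
      rcases mem_union.1 hy with hy | hy
      · exact d hab x hx y hy
      · exact d hac x hx y hy
  rw [expo_cls hσ, expo_cls hσ, expo_cls hσ] at h2
  rw [toPNat'_add (by have := len_pos σ a; omega) (len_pos σ c),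
    toPNat'_add (len_pos σ a) (len_pos σ b), ← clen_sc, ← clen_sc, ← clen_sc] at h1
  change expo univ (sc (tri a b c * σ)) + _ + _ + _ = expo univ (sc σ) + _ at h1
  rw [permWt, X_eq_mon, restWt, restWt, restWt, mon_mul_mon, mon_mul_mon, mon_mul_mon]
  congr 1
  rw [h2] at h1
  apply add_right_cancel (b := Finsupp.single (clen (sc σ) a) 1 +
    Finsupp.single (clen (sc σ) b) 1 + Finsupp.single (clen (sc σ) c) 1)
  rw [← add_assoc, ← add_assoc, h1]
  abel

/-- Of the cycle of `c`, of length `j + k`, an arc of length `j` closes up and the arc of length `k`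
goes to the cycle of `a`. -/
lemma permWt_tri_of_two (hσ : sc σ ≤ s) {a c : V} (hac : ¬ s a c)
    (hcov : ∀ x, s a x ∨ s c x) {j k : ℕ+} (hjk : clen (sc σ) c = j + k) :
    permWt K (tri a ((σ ^ (j : ℕ)) c) c * σ) =
      MvPolynomial.X (clen (sc σ) a + k) * MvPolynomial.X j *
      (restWt K s (sc σ) a * restWt K s (sc σ) c) := by
  have hlen : len σ c = j + k := by
    rw [← coe_clen_sc, hjk, PNat.add_coe]
  have hk := k.pos
  have h1 := wsum_tri_exchange (σ := σ) (a := a) j.pos (by omega) rfl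
    (fun h => hac (Setoid.symm' _ (hσ h))) fun k => Finsupp.single k.toPNat' 1
  have hu : (univ : Finset V) = cls s a ∪ cls s c := by
    ext x
    simpa using hcov x
  have h2 : expo univ (sc σ) = expo (cls s a) (sc σ) + expo (cls s c) (sc σ) := by
    conv_lhs => rw [hu]
    rw [expo, wsum_union]
    · rfl
    · intro x hx y hy hxy
      exact hac (Setoid.trans' _ (mem_cls.1 hx) (Setoid.trans' _ (hσ hxy)
        (Setoid.symm' _ (mem_cls.1 hy))))
  rw [expo_cls hσ, expo_cls hσ] at h2
  rw [show len σ c - j = k by omega, toPNat'_add (len_pos σ a) hk, ← clen_sc, ← clen_sc,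
    PNat.coe_toPNat', PNat.coe_toPNat'] at h1
  change expo univ (sc (tri a ((σ ^ (j : ℕ)) c) c * σ)) + _ + _ = expo univ (sc σ) + _ + _ at h1
  rw [permWt, X_eq_mon, X_eq_mon, restWt, restWt, mon_mul_mon, mon_mul_mon, mon_mul_mon]
  congr 1
  rw [h2] at h1
  apply add_right_cancel (b := Finsupp.single (clen (sc σ) a) 1 +
    Finsupp.single (clen (sc σ) c) 1)
  rw [← add_assoc, h1]
  abel

lemma permWt_tri_of_one (hσ : sc σ ≤ s) {c : V} (hcov : cls s c = univ) {i j k : ℕ+}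
    (hijk : clen (sc σ) c = i + j + k) :
    permWt K (tri ((σ ^ (i + j : ℕ)) c) ((σ ^ (i : ℕ)) c) c * σ) =
      MvPolynomial.X i * MvPolynomial.X j * MvPolynomial.X k * restWt K s (sc σ) c := by
  have hlen : len σ c = i + j + k := by
    rw [← coe_clen_sc, hijk, PNat.add_coe, PNat.add_coe]
  have hi := i.pos
  have hj := j.pos
  have hk := k.pos
  have h1 := wsum_tri_cut (σ := σ) (a := c) (s := i) (t := i + j) hi (by omega) (by omega) rfl rfl
    fun k => Finsupp.single k.toPNat' 1
  have h2 := expo_cls hσ c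
  rw [show len σ c - (i + j) = k by omega, show (i + j - i : ℕ) = j by omega, ← clen_sc,
    PNat.coe_toPNat', PNat.coe_toPNat', PNat.coe_toPNat'] at h1
  change expo univ (sc (tri _ _ c * σ)) + _ = expo univ (sc σ) + _ + _ + _ at h1
  rw [permWt, X_eq_mon, X_eq_mon, X_eq_mon, restWt, mon_mul_mon, mon_mul_mon, mon_mul_mon]
  congr 1
  rw [hcov] at h2 ⊢
  rw [h2] at h1
  apply add_right_cancel (b := Finsupp.single (clen (sc σ) c) 1)
  rw [h1]
  abel

end Weights

end Identities

lemma ite_iff {α : Type*} {p q : Prop} (h : p ↔ q) {_ : Decidable p} {_ : Decidable q} (a b : α) :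
    (if p then a else b) = if q then a else b := if_congr h rfl rfl

/-! ### Comparison of each type with a product of marked statistics, list by list. -/

section StepSums

variable {V : Type*} [Fintype V] [DecidableEq V] (K : Type*) [Field K]

open Classical in
/-- The total weight of the permutations that arise from `τ` in a step of type `i`. -/
noncomputable def stepSum (i : Fin 3) (τ : List (Perm V)) : MvPolynomial ℕ+ K :=
  ∑ ω, if IsStep i τ ω then permWt K (ω * τ.prod) else 0

variable {τ : List (Perm V)}

lemma Separated.distinct {s : Setoid V} {a b c : V} (h : Separated s a b c) : Distinct a b c := by
  obtain ⟨⟨h1, h2, h3⟩, -⟩ := h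
  refine ⟨?_, ?_, ?_⟩
  · rintro rfl; exact h1 (Setoid.refl' _ _)
  · rintro rfl; exact h3 (Setoid.refl' _ _)
  · rintro rfl; exact h2 (Setoid.refl' _ _)

lemma CyclicOrder.distinct {σ : Perm V} {a b c : V} (h : CyclicOrder σ c b a) :
    Distinct a b c := by
  obtain ⟨s, t, hs, hst, ht, rfl, rfl⟩ := h
  refine ⟨fun h => ?_, fun h => ?_, fun h => ?_⟩
  · have := pow_apply_injOn ht (hst.trans ht) h
    omega
  · have := pow_apply_injOn (j := 0) ht (len_pos _ _) h
    omega
  · have := pow_apply_injOn (j := 0) (hst.trans ht) (len_pos _ _) h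
    omega

/-- By `cyclicOrder_iff` the order is pairwise separation after multiplication by the 3-cycle, a
condition symmetric under rotation. -/
lemma CyclicOrder.rotate {σ : Perm V} {a b c : V} (h : CyclicOrder σ c b a) :
    CyclicOrder σ a c b := by
  obtain ⟨hab, hac, hbc⟩ := h.distinct
  have sy : ∀ {x y}, sc (tri a b c * σ) x y ↔ sc (tri a b c * σ) y x :=
    ⟨Setoid.symm' _, Setoid.symm' _⟩
  rw [cyclicOrder_iff] at h ⊢
  rw [← tri_rotate hab hac hbc, sy (x := c), sy (x := b) (y := a)]
  tauto

open Classical in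
lemma stepSum_zero_eq : 3 • stepSum K 0 τ = if Planar τ then
    ∑ y : V × V × V, if Separated (orb τ) y.1 y.2.1 y.2.2 then
      MvPolynomial.X (clen (sc τ.prod) y.1 + clen (sc τ.prod) y.2.1 + clen (sc τ.prod) y.2.2) *
      (restWt K (orb τ) (sc τ.prod) y.1 * (restWt K (orb τ) (sc τ.prod) y.2.1 *
        restWt K (orb τ) (sc τ.prod) y.2.2)) else 0 else 0 := by
  unfold stepSum
  simp only [isStep_zero_iff]
  rw [← sum_triples_of_rotate (F := fun ω => permWt K (ω * τ.prod))]
  · by_cases hP : Planar τ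
    · rw [if_pos hP]
      simp only [Fintype.sum_prod_type]
      refine sum_congr rfl fun a _ => sum_congr rfl fun b _ => sum_congr rfl fun c _ => ?_
      by_cases h : Separated (orb τ) a b c
      · rw [if_pos ⟨h.distinct, hP, h⟩, if_pos h, permWt_tri_of_separated (sc_prod_le_orb τ) h]
      · rw [if_neg fun h' => h h'.2.2, if_neg h]
    · simp [hP]
  · rintro a b c - ⟨hP, ⟨h1, h2, h3⟩, h4⟩
    refine ⟨hP, ⟨h2, fun h => h3 (Setoid.symm' _ h), fun h => h1 (Setoid.symm' _ h)⟩, fun x => ?_⟩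
    have := h4 x
    tauto

open Classical in
lemma stepSum_one_eq : stepSum K 1 τ = if Planar τ then
    ∑ y : V × V, if ¬ orb τ y.1 y.2 ∧ ∀ x, orb τ y.1 x ∨ orb τ y.2 x then
      ∑ x ∈ lengthBox (Fintype.card V) ×ˢ lengthBox (Fintype.card V),
        if clen (sc τ.prod) y.2 = x.1 + x.2 then
          MvPolynomial.X (clen (sc τ.prod) y.1 + x.2) * MvPolynomial.X x.1 *
          (restWt K (orb τ) (sc τ.prod) y.1 * restWt K (orb τ) (sc τ.prod) y.2) else 0
        else 0 else 0 := by
  unfold stepSum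
  simp only [isStep_one_iff]
  have hle := sc_prod_le_orb τ
  rw [← sum_triples_of_unique (F := fun ω => permWt K (ω * τ.prod))]
  · by_cases hP : Planar τ
    · rw [if_pos hP]
      simp only [Fintype.sum_prod_type]
      refine sum_congr rfl fun a _ => ?_
      -- The point `b` is to be summed last: `a` and `c` mark the two orbits, and `b` is a position
      -- on the cycle of `c`.
      rw [sum_comm]
      refine sum_congr rfl fun c _ => ?_
      split_ifs with h
      · have := sum_sameCycle_eq τ.prod c fun b => permWt K (tri a b c * τ.prod)
        trans ∑ b, if sc τ.prod c b ∧ b ≠ c then permWt K (tri a b c * τ.prod) else 0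
        · refine sum_congr rfl fun b _ => ite_iff ?_ _ _
          constructor
          · exact fun h' => ⟨h'.2.2.1, h'.1.2.2⟩
          · rintro ⟨h1, h2⟩
            refine ⟨⟨?_, ?_, h2⟩, hP, h1, h⟩
            · rintro rfl
              exact h.1 (Setoid.symm' _ (hle h1))
            · rintro rfl
              exact h.1 (Setoid.refl' _ _)
        · rw [this]
          refine sum_congr rfl fun x _ => ?_
          split_ifs with hx
          · exact permWt_tri_of_two hle h.1 h.2 hx
          · rfl
      · exact sum_eq_zero fun b _ => if_neg fun h' => h h'.2.2.2
    · simp [hP]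
  · rintro a b c - ⟨-, h1, h2, -⟩
    exact ⟨fun h => h2 (hle h.2.1), fun h => h.2.2.1 (hle h1)⟩

lemma cls_eq_univ_iff {s : Setoid V} (c : V) : cls s c = univ ↔ s = ⊤ := by
  constructor
  · intro h
    rw [eq_top_iff]
    have key : ∀ x, s c x := fun x => mem_cls.1 (h ▸ mem_univ x)
    exact fun x y _ => Setoid.trans' _ (Setoid.symm' _ (key x)) (key y)
  · rintro rfl
    ext x
    rw [mem_cls]
    exact ⟨fun _ => mem_univ _, fun _ => trivial⟩

open Classical in
lemma stepSum_two_eq : 3 • stepSum K 2 τ = if Planar τ then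
    ∑ c, if cls (orb τ) c = univ then
      ∑ x ∈ lengthBox (Fintype.card V) ×ˢ lengthBox (Fintype.card V) ×ˢ lengthBox (Fintype.card V),
        if clen (sc τ.prod) c = x.1 + x.2.1 + x.2.2 then
          MvPolynomial.X x.1 * MvPolynomial.X x.2.1 * MvPolynomial.X x.2.2 *
          restWt K (orb τ) (sc τ.prod) c else 0
        else 0 else 0 := by
  unfold stepSum
  simp only [isStep_two_iff]
  have hle := sc_prod_le_orb τ
  rw [← sum_triples_of_rotate (F := fun ω => permWt K (ω * τ.prod))]
  · by_cases hP : Planar τ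
    · rw [if_pos hP]
      trans ∑ c, ∑ x : V × V, if orb τ = ⊤ ∧ CyclicOrder τ.prod c x.2 x.1 then
        permWt K (tri x.1 x.2 c * τ.prod) else 0
      · simp only [Fintype.sum_prod_type]
        rw [sum_comm (s := univ) (t := univ)]
        rw [sum_comm]
        conv_rhs => rw [sum_comm]
        refine sum_congr rfl fun a _ => ?_
        rw [sum_comm]
        refine sum_congr rfl fun b _ => sum_congr rfl fun c _ => ite_iff ?_ _ _
        exact ⟨fun h => ⟨h.2.1.2, h.2.2⟩, fun h => ⟨h.2.distinct, ⟨hP, h.1⟩, h.2⟩⟩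
      · refine sum_congr rfl fun c _ => ?_
        split_ifs with h
        · have := sum_cyclicOrder_eq τ.prod c fun a b => permWt K (tri a b c * τ.prod)
          simp only [(cls_eq_univ_iff c).1 h, true_and]
          rw [this]
          refine sum_congr rfl fun x _ => ?_
          split_ifs with hx
          · rw [← (cls_eq_univ_iff c).1 h]
            exact permWt_tri_of_one hle h hx
          · rfl
        · exact sum_eq_zero fun x _ => if_neg fun h' => h ((cls_eq_univ_iff c).2 h'.1)
    · simp [hP]
  · rintro a b c - ⟨hP, h⟩
    exact ⟨hP, h.rotate⟩

section RightSides

variable {s r : Setoid V}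

-- Three nested products of marked statistics choose three points in three distinct blocks that
-- exhaust the set.
open Classical in
lemma statMul_three (hrs : r ≤ s) (i j k : ℕ+) :
    statMul (markStat K i) (statMul (markStat K j) (markStat K k)) univ s r =
      ∑ y : V × V × V, if Separated s y.1 y.2.1 y.2.2 ∧
        (clen r y.1, clen r y.2.1, clen r y.2.2) = (i, j, k) then
        restWt K s r y.1 * (restWt K s r y.2.1 * restWt K s r y.2.2) else 0 := by
  simp only [statMul_markStat K hrs, markStat_eq K hrs, Fintype.sum_prod_type, mul_sum]
  refine sum_congr rfl fun a _ => ?_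
  rw [ite_sum_zero]
  refine sum_congr rfl fun b _ => ?_
  rw [mul_ite, mul_zero, ← ite_and, mul_sum, ite_sum_zero]
  refine sum_congr rfl fun c _ => ?_
  rw [mul_ite, mul_zero, mul_ite, mul_zero, ← ite_and]
  refine if_congr ?_ rfl rfl
  have := disjoint_cover_three s a b c
  simp only [Prod.mk.injEq, subset_univ, true_and, Separated, ← this]
  tauto

open Classical in
lemma statMul_two (hrs : r ≤ s) (i k : ℕ+) :
    statMul (markStat K i) (markStat K k) univ s r =
      ∑ y : V × V, if (¬ s y.1 y.2 ∧ ∀ x, s y.1 x ∨ s y.2 x) ∧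
        (clen r y.1 = i ∧ clen r y.2 = k) then
        restWt K s r y.1 * restWt K s r y.2 else 0 := by
  simp only [statMul_markStat K hrs, markStat_eq K hrs, Fintype.sum_prod_type, mul_sum]
  refine sum_congr rfl fun a _ => ?_
  rw [ite_sum_zero]
  refine sum_congr rfl fun c _ => ?_
  rw [mul_ite, mul_zero, ← ite_and]
  refine if_congr ?_ rfl rfl
  rw [disjoint_cover_two]
  simp only [subset_univ, true_and]
  tauto

variable (V) in
/-- The triples of possible cycle lengths on `V`. -/
abbrev tripleBox : Finset (ℕ+ × ℕ+ × ℕ+) :=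
  lengthBox (Fintype.card V) ×ˢ lengthBox (Fintype.card V) ×ˢ lengthBox (Fintype.card V)

lemma sum_ite_eq_mem {ι M : Type*} [DecidableEq ι] [AddCommMonoid M] {B : Finset ι} {l : ι}
    (hl : l ∈ B) (p : Prop) [Decidable p] (f : ι → M) :
    (∑ i ∈ B, if p ∧ l = i then f i else 0) = if p then f l else 0 := by
  by_cases hp : p
  · simp [hp, hl]
  · simp [hp]

-- Every marked triple has one triple of cycle lengths and it lies in the box, so summing over `i,
-- j, k` just removes the condition on lengths.
open Classical in
lemma sum_statMul_three (hrs : r ≤ s) :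
    ∑ x ∈ tripleBox V, MvPolynomial.X (x.1 + x.2.1 + x.2.2) *
      statMul (markStat K x.1) (statMul (markStat K x.2.1) (markStat K x.2.2)) univ s r =
    ∑ y : V × V × V, if Separated s y.1 y.2.1 y.2.2 then
      MvPolynomial.X (clen r y.1 + clen r y.2.1 + clen r y.2.2) *
      (restWt K s r y.1 * (restWt K s r y.2.1 * restWt K s r y.2.2)) else 0 := by
  simp only [statMul_three K hrs, mul_sum]
  rw [sum_comm]
  refine sum_congr rfl fun y _ => ?_
  have hy : (clen r y.1, clen r y.2.1, clen r y.2.2) ∈ tripleBox V :=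
    mem_product.2 ⟨card_cls_mem_lengthBox _ _, mem_product.2
      ⟨card_cls_mem_lengthBox _ _, card_cls_mem_lengthBox _ _⟩⟩
  rw [← sum_ite_eq_mem hy _ fun x : ℕ+ × ℕ+ × ℕ+ => MvPolynomial.X (x.1 + x.2.1 + x.2.2) *
      (restWt K s r y.1 * (restWt K s r y.2.1 * restWt K s r y.2.2))]
  refine sum_congr rfl fun x _ => ?_
  rw [mul_ite, mul_zero]

-- The first length is removed by summation, but `j` and `k` are tied to the second marked cycle
-- only through their sum; what is left is the sum over splittings of its length.
open Classical in
lemma sum_statMul_two (hrs : r ≤ s) :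
    ∑ x ∈ tripleBox V, MvPolynomial.X (x.1 + x.2.2) * MvPolynomial.X x.2.1 *
      statMul (markStat K x.1) (markStat K (x.2.1 + x.2.2)) univ s r =
    ∑ y : V × V, if ¬ s y.1 y.2 ∧ ∀ x, s y.1 x ∨ s y.2 x then
      ∑ x ∈ lengthBox (Fintype.card V) ×ˢ lengthBox (Fintype.card V),
        if clen r y.2 = x.1 + x.2 then MvPolynomial.X (clen r y.1 + x.2) * MvPolynomial.X x.1 *
          (restWt K s r y.1 * restWt K s r y.2) else 0 else 0 := by
  simp only [statMul_two K hrs, mul_sum]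
  rw [sum_comm]
  refine sum_congr rfl fun y _ => ?_
  rw [sum_product_right, ite_sum_zero]
  refine sum_congr rfl fun x _ => ?_
  rw [← ite_and, ← sum_ite_eq_mem (card_cls_mem_lengthBox r y.1) _ fun i : ℕ+ =>
    MvPolynomial.X (i + x.2) * MvPolynomial.X x.1 * (restWt K s r y.1 * restWt K s r y.2)]
  refine sum_congr rfl fun i _ => ?_
  rw [mul_ite, mul_zero]
  exact if_congr (by tauto) rfl rfl

open Classical in
lemma sum_markStat (hrs : r ≤ s) :
    ∑ x ∈ tripleBox V, MvPolynomial.X x.1 * MvPolynomial.X x.2.1 * MvPolynomial.X x.2.2 *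
      markStat K (x.1 + x.2.1 + x.2.2) univ s r =
    ∑ c, if cls s c = univ then
      ∑ x ∈ tripleBox V, if clen r c = x.1 + x.2.1 + x.2.2 then
        MvPolynomial.X x.1 * MvPolynomial.X x.2.1 * MvPolynomial.X x.2.2 *
          restWt K s r c else 0 else 0 := by
  simp only [markStat_eq K hrs, mul_sum]
  rw [sum_comm]
  refine sum_congr rfl fun y _ => ?_
  rw [ite_sum_zero]
  refine sum_congr rfl fun x _ => ?_
  rw [mul_ite, mul_zero, ite_and]

end RightSides

end StepSums

/-! ### The three identities for arrays of polynomials. -/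

section Arrays

variable (K : Type*) [Field K]

/-- The generating polynomials of the elements of type `i` of length `m + 1` on `n` points. -/
noncomputable def typeWt (i : Fin 3) (n m : ℕ) : MvPolynomial ℕ+ K :=
  listSum m fun τ : List (Perm (Fin n)) => stepSum K i τ

/-- The triples of possible cycle lengths on `n` points. -/
abbrev lengthTriples (n : ℕ) : Finset (ℕ+ × ℕ+ × ℕ+) :=
  lengthBox n ×ˢ lengthBox n ×ˢ lengthBox n

lemma smul_listSum {α M : Type*} [Fintype α] [AddCommMonoid M] (k m : ℕ) (f : List α → M) :
    k • listSum m f = listSum m fun l => k • f l :=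
  map_listSum (nsmulAddMonoidHom k) m f

lemma mul_listSum {α R : Type*} [Fintype α] [CommSemiring R] (a : R) (m : ℕ) (f : List α → R) :
    a * listSum m f = listSum m fun l => a * f l :=
  map_listSum (AddMonoidHom.mulLeft a) m f

lemma Represents.apply_univ {A : ℕ → ℕ → MvPolynomial ℕ+ K} {n : ℕ}
    {θ : Finset (Fin n) → Setoid (Fin n) → Setoid (Fin n) → MvPolynomial ℕ+ K}
    (h : Represents A θ) (m : ℕ) : A n m = listSum m (planarStat θ univ) := by
  have := h univ m
  rwa [card_univ, Fintype.card_fin] at this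

variable {K} in
lemma sum_array_eq {n : ℕ} (A : ℕ+ × ℕ+ × ℕ+ → ℕ → ℕ → MvPolynomial ℕ+ K)
    (θ : ℕ+ × ℕ+ × ℕ+ → Finset (Fin n) → Setoid (Fin n) → Setoid (Fin n) → MvPolynomial ℕ+ K)
    (h : ∀ x, Represents (A x) (θ x)) (f : ℕ+ × ℕ+ × ℕ+ → MvPolynomial ℕ+ K) (m : ℕ) :
    ∑ x ∈ lengthTriples n, f x * A x n m = listSum m fun τ =>
      ∑ x ∈ lengthTriples n, f x * planarStat (θ x) univ τ := by
  rw [listSum_sum]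
  refine sum_congr rfl fun x _ => ?_
  rw [(h x).apply_univ, mul_listSum]

open Classical in
variable {K} in
lemma sum_planarStat_eq {n : ℕ}
    (θ : ℕ+ × ℕ+ × ℕ+ → Finset (Fin n) → Setoid (Fin n) → Setoid (Fin n) → MvPolynomial ℕ+ K)
    (f : ℕ+ × ℕ+ × ℕ+ → MvPolynomial ℕ+ K) (τ : List (Perm (Fin n))) :
    ∑ x ∈ lengthTriples n, f x * planarStat (θ x) univ τ =
      if Planar τ then ∑ x ∈ tripleBox (Fin n), f x * θ x univ (orb τ) (sc τ.prod) else 0 := by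
  unfold planarStat
  simp only [planarOn_univ]
  split_ifs
  · rw [tripleBox, Fintype.card_fin]
  · simp

/-- Both sides are sums over the same lists, those left after removal of the first 3-cycle, and they
agree list by list. -/
lemma three_smul_typeWt_zero (n m : ℕ) : 3 • typeWt K 0 n m = ∑ x ∈ lengthTriples n,
    MvPolynomial.X (x.1 + x.2.1 + x.2.2) *
      conv (markWt K x.1) (conv (markWt K x.2.1) (markWt K x.2.2)) n m := by
  rw [typeWt, smul_listSum, sum_array_eq (fun x => conv (markWt K x.1) (conv (markWt K x.2.1)
    (markWt K x.2.2))) _ fun x => (represents_markWt K x.1).conv ((represents_markWt K x.2.1).conv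
      (represents_markWt K x.2.2) (isLocal_markStat K _) (isLocal_markStat K _))
      (isLocal_markStat K _) ((isLocal_markStat K _).statMul (isLocal_markStat K _))]
  refine listSum_congr fun τ => ?_
  rw [stepSum_zero_eq, sum_planarStat_eq, sum_statMul_three K (sc_prod_le_orb τ)]

lemma typeWt_one (n m : ℕ) : typeWt K 1 n m = ∑ x ∈ lengthTriples n,
    MvPolynomial.X (x.1 + x.2.2) * MvPolynomial.X x.2.1 *
      conv (markWt K x.1) (markWt K (x.2.1 + x.2.2)) n m := by
  rw [typeWt, sum_array_eq (fun x => conv (markWt K x.1) (markWt K (x.2.1 + x.2.2))) _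
    fun x => (represents_markWt K x.1).conv (represents_markWt K (x.2.1 + x.2.2))
      (isLocal_markStat K _) (isLocal_markStat K _)]
  refine listSum_congr fun τ => ?_
  rw [stepSum_one_eq, sum_planarStat_eq, sum_statMul_two K (sc_prod_le_orb τ)]

lemma three_smul_typeWt_two (n m : ℕ) : 3 • typeWt K 2 n m = ∑ x ∈ lengthTriples n,
    MvPolynomial.X x.1 * MvPolynomial.X x.2.1 * MvPolynomial.X x.2.2 *
      markWt K (x.1 + x.2.1 + x.2.2) n m := by
  rw [typeWt, smul_listSum, sum_array_eq (fun x => markWt K (x.1 + x.2.1 + x.2.2)) _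
    fun x => represents_markWt K (x.1 + x.2.1 + x.2.2)]
  refine listSum_congr fun τ => ?_
  rw [stepSum_two_eq, sum_planarStat_eq, sum_markStat K (sc_prod_le_orb τ)]

lemma clen_eq_mem {n : ℕ} {r : Setoid (Fin n)} {v : Fin n} {i : ℕ+} (h : clen r v = i) :
    i ∈ lengthBox n := by
  have := card_cls_mem_lengthBox r v
  rwa [Fintype.card_fin, ← clen, h] at this

lemma add_mem_lengthBox {n : ℕ} {i j : ℕ+} (h : i + j ∈ lengthBox n) :
    i ∈ lengthBox n ∧ j ∈ lengthBox n := by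
  rw [lengthBox, mem_Icc, ← PNat.coe_le_coe, ← PNat.coe_le_coe, PNat.add_coe] at h
  simp only [lengthBox, mem_Icc, ← PNat.coe_le_coe]
  have := i.pos
  have := j.pos
  refine ⟨⟨i.pos, by omega⟩, j.pos, by omega⟩

/-- On `n` points no cycle has a length outside the box. This makes the families summable and
reduces their formal sums to finite ones for each power of `z`. -/
lemma conv_three_eq_zero {n : ℕ} (m : ℕ) {x : ℕ+ × ℕ+ × ℕ+} (hx : x ∉ lengthTriples n) :
    conv (markWt K x.1) (conv (markWt K x.2.1) (markWt K x.2.2)) n m = 0 := by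
  classical
  rw [((represents_markWt K x.1).conv ((represents_markWt K x.2.1).conv
      (represents_markWt K x.2.2) (isLocal_markStat K _) (isLocal_markStat K _))
      (isLocal_markStat K _) ((isLocal_markStat K _).statMul (isLocal_markStat K _))).apply_univ K,
    ← listSum_zero (α := Perm (Fin n)) m]
  refine listSum_congr fun τ => ?_
  unfold planarStat
  rw [ite_eq_right_iff]
  intro _
  rw [statMul_three K (sc_prod_le_orb τ)]
  refine sum_eq_zero fun y _ => if_neg ?_
  rintro ⟨-, h⟩
  simp only [Prod.mk.injEq] at h
  exact hx (mem_product.2 ⟨clen_eq_mem h.1, mem_product.2 ⟨clen_eq_mem h.2.1, clen_eq_mem h.2.2⟩⟩)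

lemma conv_two_eq_zero {n : ℕ} (m : ℕ) {x : ℕ+ × ℕ+ × ℕ+} (hx : x ∉ lengthTriples n) :
    conv (markWt K x.1) (markWt K (x.2.1 + x.2.2)) n m = 0 := by
  classical
  rw [((represents_markWt K x.1).conv (represents_markWt K (x.2.1 + x.2.2))
      (isLocal_markStat K _) (isLocal_markStat K _)).apply_univ K,
    ← listSum_zero (α := Perm (Fin n)) m]
  refine listSum_congr fun τ => ?_
  unfold planarStat
  rw [ite_eq_right_iff]
  intro _
  rw [statMul_two K (sc_prod_le_orb τ)]
  refine sum_eq_zero fun y _ => if_neg ?_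
  rintro ⟨-, h1, h2⟩
  exact hx (mem_product.2 ⟨clen_eq_mem h1, mem_product.2 (add_mem_lengthBox (clen_eq_mem h2))⟩)

lemma markWt_eq_zero {n : ℕ} (m : ℕ) {x : ℕ+ × ℕ+ × ℕ+} (hx : x ∉ lengthTriples n) :
    markWt K (x.1 + x.2.1 + x.2.2) n m = 0 := by
  classical
  rw [(represents_markWt K (x.1 + x.2.1 + x.2.2)).apply_univ K,
    ← listSum_zero (α := Perm (Fin n)) m]
  refine listSum_congr fun τ => ?_
  unfold planarStat
  rw [ite_eq_right_iff]
  intro _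
  rw [markStat_eq K (sc_prod_le_orb τ)]
  refine sum_eq_zero fun y _ => if_neg ?_
  rintro ⟨-, h⟩
  have h1 := add_mem_lengthBox (clen_eq_mem h)
  have h2 := add_mem_lengthBox h1.1
  exact hx (mem_product.2 ⟨h2.1, mem_product.2 ⟨h2.2, h1.2⟩⟩)

end Arrays

/-! ### Cycle types as partitions, and the number `mu3`. -/

section CycleType

variable {V : Type*} [Fintype V] [DecidableEq V]

/-- The classes inside the support are the supports of the cycle factors; each fixed point is a
class of its own and gives a part 1. -/
lemma wsum_sc_eq {M : Type*} [AddCommMonoid M] (σ : Perm V) (w : ℕ → M) :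
    wsum univ (sc σ) w = (σ.partition.parts.map w).sum := by
  rw [parts_partition, Multiset.map_add, Multiset.sum_add, Multiset.map_replicate,
    Multiset.sum_replicate, ← card_compl]
  conv_lhs => rw [← union_compl σ.support]
  rw [wsum_union]
  · congr 1
    · have himg : σ.support.image (cls (sc σ)) = σ.cycleFactorsFinset.image support := by
        have hcls : ∀ x ∈ σ.support, cls (sc σ) x = (σ.cycleOf x).support := by
          intro x hx
          ext y
          rw [mem_cls, mem_support_cycleOf_iff, and_iff_left hx]
          exact sc_apply
        ext C
        simp only [mem_image]
        constructor
        · rintro ⟨x, hx, rfl⟩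
          exact ⟨σ.cycleOf x, cycleOf_mem_cycleFactorsFinset_iff.2 hx, (hcls x hx).symm⟩
        · rintro ⟨c, hc, rfl⟩
          obtain ⟨x, hx⟩ := (mem_cycleFactorsFinset_iff.1 hc).1.nonempty_support
          have hxσ := mem_cycleFactorsFinset_support_le hc hx
          refine ⟨x, hxσ, ?_⟩
          rw [hcls x hxσ, ← cycle_is_cycleOf hx hc]
      rw [wsum, himg, sum_image, cycleType_def, Multiset.map_map]
      · rfl
      · intro c hc d hd h
        obtain ⟨x, hx⟩ := (mem_cycleFactorsFinset_iff.1 hc).1.nonempty_support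
        rw [cycle_is_cycleOf hx hc, cycle_is_cycleOf (h ▸ hx) hd]
    · apply wsum_singletons
      intro x hx
      ext y
      rw [mem_cls, mem_singleton]
      have hx' : σ x = x := by simpa using hx
      constructor
      · exact fun h => (eq_of_sc_of_fixed hx' h).symm
      · rintro rfl
        exact Setoid.refl' _ _
  · intro x hx y hy hxy
    have hy' : σ y = y := by simpa using hy
    have := eq_of_sc_of_fixed hy' (Setoid.symm' _ hxy)
    rw [← this] at hx
    exact mem_support.1 hx hy'

/-- The exponent vector of a partition. -/
noncomputable def partExpo {n : ℕ} (α : Nat.Partition n) : ℕ+ →₀ ℕ :=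
  (α.parts.map fun k => Finsupp.single k.toPNat' 1).sum

variable {n : ℕ}

lemma expo_eq_partExpo {σ : Perm (Fin n)} {α : Nat.Partition n} (h : HasType σ α) :
    expo univ (sc σ) = partExpo α := by
  rw [expo, wsum_sc_eq, h, partExpo]

lemma numCls_eq_card_parts {σ : Perm (Fin n)} {α : Nat.Partition n} (h : HasType σ α) :
    numCls (sc σ) = α.parts.card := by
  rw [numCls, wsum_sc_eq, h]
  simp

/-- The cycle type of a permutation of `Fin n`, as a partition of `n`. -/
def typeOf (σ : Perm (Fin n)) : Nat.Partition n where
  parts := σ.partition.parts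
  parts_pos := σ.partition.parts_pos
  parts_sum := σ.partition.parts_sum.trans (Fintype.card_fin n)

lemma hasType_iff {σ : Perm (Fin n)} {α : Nat.Partition n} : HasType σ α ↔ typeOf σ = α := by
  rw [Nat.Partition.ext_iff]
  rfl

open Classical in
lemma permWt_eq_sum (K : Type*) [Field K] (σ : Perm (Fin n)) :
    permWt K σ = ∑ α : Nat.Partition n, if HasType σ α then mon K (partExpo α) else 0 := by
  simp only [hasType_iff]
  rw [sum_ite_eq, if_pos (mem_univ _), permWt, expo_eq_partExpo (hasType_iff.2 rfl)]

/-- For a transitive list the defect depends on the product only through its number of cycles, that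
is through `α`. Hence a list of defect 0 is shortest among the factorizations of all permutations of
type `α`. -/
lemma length_eq_of_mem_setA (hn : 0 < n) {α : Nat.Partition n} {x} (hx : x ∈ setA α) :
    x.1.length = mu3 α := by
  have : Nonempty (Fin n) := ⟨⟨0, hn⟩⟩
  obtain ⟨hα, hmin⟩ := hx
  have hmin' := (isMinimal_iff hn _ _).1 hmin
  obtain ⟨-, h2, h3, h4⟩ := hmin'
  have hd : ∀ (δ : List (Perm (Fin n))) (σ : Perm (Fin n)), HasType σ α → δ.prod = σ →
      orb δ = ⊤ → defect δ = 2 * δ.length + 2 - n - α.parts.card := by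
    intro δ σ h1 h2 h3
    rw [defect, h2, h3, numCls_eq_one_of_top, numCls_eq_card_parts h1]
    simp
  have hmem : x.1.length ∈ {k | ∃ (δ : List (Perm (Fin n))) (σ : Perm (Fin n)),
      HasType σ α ∧ IsTransitiveFactorization δ σ ∧ δ.length = k} :=
    ⟨x.1, x.2, hα, hmin.1, rfl⟩
  refine le_antisymm (le_csInf ⟨_, hmem⟩ ?_) (Nat.sInf_le hmem)
  rintro k ⟨δ, σ, k1, k2, rfl⟩
  obtain ⟨k3, k4, k5⟩ := (IsTransitiveFactorization.iff_orb _ _).1 k2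
  have e1 := hd _ _ hα h2 h3
  have e2 := hd _ _ k1 k4 k5
  have := defect_nonneg k3
  omega

lemma mem_setA_iff (hn : 0 < n) {α : Nat.Partition n} {x} :
    x ∈ setA α ↔ HasType x.2 α ∧ x.1.prod = x.2 ∧ Planar x.1 ∧ orb x.1 = ⊤ := by
  rw [setA, Set.mem_ofPred_eq, isMinimal_iff hn, Planar]
  tauto

end CycleType

/-! ### The arrays of polynomials count the sets in the statement. -/

section Counting

variable (K : Type*) [Field K] {n : ℕ}

open Classical in
lemma listSum_permWt_eq (m : ℕ) (p : List (Perm (Fin n)) → Prop) :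
    listSum m (fun δ => if p δ then permWt K δ.prod else 0) =
      ∑ α : Nat.Partition n,
        {δ : List (Perm (Fin n)) | δ.length = m ∧ p δ ∧ HasType δ.prod α}.ncard •
          mon K (partExpo α) := by
  have : ∀ δ : List (Perm (Fin n)), (if p δ then permWt K δ.prod else 0) =
      ∑ α : Nat.Partition n, if p δ ∧ HasType δ.prod α then mon K (partExpo α) else 0 := by
    intro δ
    rw [permWt_eq_sum]
    split_ifs with h
    · exact sum_congr rfl fun α _ => ite_iff (by tauto) _ _
    · exact (sum_eq_zero fun α _ => if_neg fun h' => h h'.1).symm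
  rw [listSum_congr this, listSum_sum]
  exact sum_congr rfl fun α _ =>
    (listSum_congr fun l => ite_iff Iff.rfl _ _).trans (listSum_ite_eq_ncard _ _ _)

lemma isBlock_univ_iff {V : Type*} [Fintype V] [DecidableEq V] [Nonempty V] {s : Setoid V} :
    IsBlock univ s ↔ s = ⊤ := by
  obtain ⟨a⟩ := ‹Nonempty V›
  constructor
  · intro h
    exact (cls_eq_univ_iff a).1 (h.2 a (mem_univ a))
  · intro h
    exact ⟨⟨a, mem_univ a⟩, fun x _ => (cls_eq_univ_iff x).2 h⟩

open Classical in
lemma planarStat_connStat {V : Type*} [Fintype V] [DecidableEq V] [Nonempty V]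
    (τ : List (Perm V)) : planarStat (connStat K) univ τ =
      if Planar τ ∧ orb τ = ⊤ then permWt K τ.prod else 0 := by
  unfold planarStat connStat
  simp only [planarOn_univ, isBlock_univ_iff, ← ite_and]
  exact ite_iff Iff.rfl _ _

/-- Blocks are nonempty by definition; accordingly the series begin with `n = 1`. -/
lemma totalWt_zero (m : ℕ) : totalWt K 0 m = 0 := by
  rw [totalWt]
  refine (listSum_congr fun τ => ?_).trans (listSum_zero m)
  have : ¬ IsBlock (univ : Finset (Fin 0)) (orb τ) := fun h => by
    obtain ⟨x, -⟩ := h.1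
    exact x.elim0
  unfold planarStat connStat
  rw [if_neg this, ite_self]

lemma totalWt_eq (hn : 0 < n) (m : ℕ) : totalWt K n m = ∑ α : Nat.Partition n,
    if mu3 α = m then (setA α).ncard • mon K (partExpo α) else 0 := by
  classical
  have : Nonempty (Fin n) := ⟨⟨0, hn⟩⟩
  rw [totalWt]
  refine ((listSum_congr fun δ => (planarStat_connStat K δ).trans (ite_iff Iff.rfl _ _)).trans
    (listSum_permWt_eq K m fun δ => Planar δ ∧ orb δ = ⊤)).trans ?_
  refine sum_congr rfl fun α _ => ?_
  have hmem : ∀ {δ : List (Perm (Fin n))}, (Planar δ ∧ orb δ = ⊤) ∧ HasType δ.prod α →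
      (δ, δ.prod) ∈ setA α := fun h => (mem_setA_iff hn).2 ⟨h.2, rfl, h.1⟩
  split_ifs with h
  · congr 1
    -- The second component of a member of `setA α` is the product of the first, so the pairs are
    -- the image of the lists.
    rw [← Set.ncard_image_of_injective (f := fun δ : List (Perm (Fin n)) => (δ, δ.prod)) _
      fun _ _ h => congrArg Prod.fst h]
    congr 1
    ext ⟨δ, σ⟩
    constructor
    · rintro ⟨δ', ⟨-, h2⟩, h3⟩
      rw [← h3]
      exact hmem h2
    · intro h'
      obtain ⟨h1, h2, h3⟩ := (mem_setA_iff hn).1 h'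
      simp only at h1 h2 h3
      subst h2
      exact ⟨δ, ⟨(length_eq_of_mem_setA hn h').trans h, h3, h1⟩, rfl⟩
  · have : {δ : List (Perm (Fin n)) | δ.length = m ∧ (Planar δ ∧ orb δ = ⊤) ∧
        HasType δ.prod α} = ∅ := by
      ext δ
      simp only [Set.mem_ofPred_eq, Set.mem_empty_iff_false, iff_false]
      rintro ⟨h1, h2⟩
      exact h ((length_eq_of_mem_setA hn (hmem h2)).symm.trans h1)
    rw [this, Set.ncard_empty, zero_smul]

/-- The points correspond by `(j₃, j₂, j₁) = (a, b, c)`. -/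
lemma isOfType_iff {i : Fin 3} {σ ω : Perm (Fin n)} :
    IsOfType i σ ω ↔ HasForm (SplitType i σ) ω := by
  have hd : ∀ a b c : Fin n, [a, b, c].Nodup ↔ Distinct a b c := by
    intro a b c
    simp [Distinct]
    tauto
  constructor
  · rintro ⟨c, b, a, h1, h2, h3⟩
    refine ⟨a, b, c, (hd a b c).1 h1, by rw [h2, formPerm_eq_tri], ?_⟩
    fin_cases i
    · exact h3
    · exact h3
    · exact ⟨fun h => h3.2.1 (Setoid.symm' _ h), fun h => h3.1 (Setoid.symm' _ h),
        fun h => h3.2.2 (Setoid.symm' _ h)⟩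
  · rintro ⟨a, b, c, h1, h2, h3⟩
    refine ⟨c, b, a, (hd a b c).2 h1, by rw [h2, formPerm_eq_tri], ?_⟩
    fin_cases i
    · exact h3
    · exact h3
    · exact ⟨fun h => h3.2.1 (Setoid.symm' _ h), fun h => h3.1 (Setoid.symm' _ h),
        fun h => h3.2.2 (Setoid.symm' _ h)⟩

/-- `IsStep` for a nonempty list. -/
def IsStepList (i : Fin 3) (δ : List (Perm (Fin n))) : Prop :=
  ∃ ω τ, δ = ω :: τ ∧ IsStep i τ ω

open Classical in
lemma typeWt_eq_listSum (i : Fin 3) (m : ℕ) : typeWt K i n m =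
    listSum (m + 1) fun δ : List (Perm (Fin n)) =>
      if IsStepList i δ then permWt K δ.prod else 0 := by
  rw [typeWt, listSum, ← listSum_sum]
  refine listSum_congr fun τ => ?_
  unfold stepSum
  refine sum_congr rfl fun ω _ => ?_
  rw [List.prod_cons]
  refine ite_iff ⟨fun h => ⟨ω, τ, rfl, h⟩, ?_⟩ _ _
  rintro ⟨ω', τ', h1, h2⟩
  obtain ⟨rfl, rfl⟩ := List.cons.inj h1
  exact h2

lemma typeWt_eq (hn : 0 < n) (i : Fin 3) (m : ℕ) : typeWt K i n m = ∑ α : Nat.Partition n,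
    if mu3 α - 1 = m then (setAtildei i α).ncard • mon K (partExpo α) else 0 := by
  classical
  rw [typeWt_eq_listSum, listSum_permWt_eq]
  refine sum_congr rfl fun α _ => ?_
  have hmem : ∀ {δ : List (Perm (Fin n))}, IsStepList i δ ∧ HasType δ.prod α →
      (δ, δ.prod) ∈ setA α := by
    rintro δ ⟨⟨ω, τ, rfl, h1, -⟩, h2⟩
    exact (mem_setA_iff hn).2 ⟨h2, rfl, h1⟩
  have hpos : ∀ {δ : List (Perm (Fin n))}, IsStepList i δ → 0 < δ.length := by
    rintro δ ⟨ω, τ, rfl, -⟩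
    exact Nat.succ_pos _
  split_ifs with h
  · congr 1
    -- Dropping the first member loses nothing, because it is recovered from the product and the
    -- tail.
    rw [← Set.InjOn.ncard_image (f := fun δ : List (Perm (Fin n)) => (δ.tail, δ.prod))]
    · congr 1
      ext ⟨τ, σ⟩
      constructor
      · rintro ⟨δ, ⟨-, h2, h3⟩, h4⟩
        have hA := hmem ⟨h2, h3⟩
        obtain ⟨ω, τ', rfl, h5, h6⟩ := h2
        obtain ⟨rfl, rfl⟩ := Prod.mk.inj h4
        have e : (ω :: τ').prod * τ'.prod⁻¹ = ω := by rw [List.prod_cons, mul_inv_cancel_right]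
        change (((ω :: τ').prod * τ'.prod⁻¹) :: τ', _) ∈ setAi i α
        rw [e]
        refine ⟨hA, ω, τ', rfl, isOfType_iff.2 ?_⟩
        simpa only [List.prod_cons] using h6
      · rintro ⟨h1, ω, τ', h2, h3⟩
        obtain ⟨h4, h5⟩ := List.cons.inj h2
        simp only at h4 h5 h3 h1
        subst h5
        rw [h4] at h1
        obtain ⟨k1, k2, k3⟩ := (mem_setA_iff hn).1 h1
        simp only at k1 k2 k3
        have hl := length_eq_of_mem_setA hn h1
        subst k2
        refine ⟨ω :: τ, ⟨?_, ⟨ω, τ, rfl, k3, ?_⟩, k1⟩, rfl⟩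
        -- `mu3 α` is the length of a nonempty list, so the truncated subtraction `mu3 α - 1` is
        -- exact here.
        · rw [List.length_cons] at hl ⊢
          omega
        · have := isOfType_iff.1 h3
          simpa only [List.prod_cons] using this
    · rintro _ ⟨-, ⟨ω, τ, rfl, -⟩, -⟩ _ ⟨-, ⟨ω', τ', rfl, -⟩, -⟩ h
      obtain ⟨h1, h2⟩ := Prod.mk.inj h
      simp only [List.tail_cons] at h1
      subst h1
      rw [List.prod_cons, List.prod_cons, mul_left_inj] at h2
      rw [h2]
  · have : {δ : List (Perm (Fin n)) | δ.length = m + 1 ∧ IsStepList i δ ∧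
        HasType δ.prod α} = ∅ := by
      ext δ
      simp only [Set.mem_ofPred_eq, Set.mem_empty_iff_false, iff_false]
      rintro ⟨h1, h2⟩
      have := length_eq_of_mem_setA hn (hmem h2)
      simp only at this
      omega
    rw [this, Set.ncard_empty, zero_smul]

end Counting

/-! ### Every step has exactly one type. -/

section Exhaustion

variable {V : Type*} [Fintype V] [DecidableEq V] {σ ω : Perm V}

/-- The types are told apart by whether the three moved points lie on one, two or three cycles of
`σ`, which does not depend on the way `ω` is written. -/
lemma HasForm.sc_of_zero (h : HasForm (SplitType 0 σ) ω) :
    ∀ x ∈ ω.support, ∀ y ∈ ω.support, sc σ x y := by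
  obtain ⟨a, b, c, ⟨hab, hac, hbc⟩, rfl, h⟩ := h
  have key : ∀ x ∈ (tri a b c).support, sc σ a x := by
    intro x hx
    rcases (mem_support_tri hab hac hbc).1 hx with rfl | rfl | rfl
    · exact Setoid.refl' _ _
    · exact CyclicOrder.sc_left h
    · exact CyclicOrder.sc_right h
  exact fun x hx y hy => Setoid.trans' _ (Setoid.symm' _ (key x hx)) (key y hy)

lemma HasForm.exists_of_one (h : HasForm (SplitType 1 σ) ω) :
    (∃ x ∈ ω.support, ∃ y ∈ ω.support, x ≠ y ∧ sc σ x y) ∧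
      ∃ x ∈ ω.support, ∃ y ∈ ω.support, ¬ sc σ x y := by
  obtain ⟨a, b, c, ⟨hab, hac, hbc⟩, rfl, h1, h2⟩ := h
  have ha : a ∈ (tri a b c).support := (mem_support_tri hab hac hbc).2 (by simp)
  have hb : b ∈ (tri a b c).support := (mem_support_tri hab hac hbc).2 (by simp)
  have hc : c ∈ (tri a b c).support := (mem_support_tri hab hac hbc).2 (by simp)
  exact ⟨⟨b, hb, a, ha, hab.symm, h1⟩, c, hc, b, hb, h2⟩

lemma HasForm.not_sc_of_two (h : HasForm (SplitType 2 σ) ω) :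
    ∀ x ∈ ω.support, ∀ y ∈ ω.support, x ≠ y → ¬ sc σ x y := by
  obtain ⟨a, b, c, ⟨hab, hac, hbc⟩, rfl, h1, h2, h3⟩ := h
  intro x hx y hy hxy h
  have h' := Setoid.symm' _ h
  rcases (mem_support_tri hab hac hbc).1 hx with rfl | rfl | rfl <;>
  rcases (mem_support_tri hab hac hbc).1 hy with rfl | rfl | rfl <;>
  first
  | exact hxy rfl
  | exact h1 h
  | exact h2 h
  | exact h3 h
  | exact h1 h'
  | exact h2 h'
  | exact h3 h'

lemma HasForm.type_unique {i j : Fin 3} (hi : HasForm (SplitType i σ) ω)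
    (hj : HasForm (SplitType j σ) ω) : i = j := by
  have hne : ∀ {i}, HasForm (SplitType i σ) ω →
      ∃ x ∈ ω.support, ∃ y ∈ ω.support, x ≠ y := by
    rintro i ⟨a, b, c, ⟨hab, hac, hbc⟩, rfl, -⟩
    exact ⟨a, (mem_support_tri hab hac hbc).2 (by simp), b,
      (mem_support_tri hab hac hbc).2 (by simp), hab⟩
  have h01 : HasForm (SplitType 0 σ) ω → HasForm (SplitType 1 σ) ω → False := by
    intro h h'
    obtain ⟨x, hx, y, hy, hxy⟩ := h'.exists_of_one.2
    exact hxy (h.sc_of_zero x hx y hy)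
  have h02 : HasForm (SplitType 0 σ) ω → HasForm (SplitType 2 σ) ω → False := by
    intro h h'
    obtain ⟨x, hx, y, hy, hxy⟩ := hne h
    exact h'.not_sc_of_two x hx y hy hxy (h.sc_of_zero x hx y hy)
  have h12 : HasForm (SplitType 1 σ) ω → HasForm (SplitType 2 σ) ω → False := by
    intro h h'
    obtain ⟨x, hx, y, hy, hxy, hs⟩ := h.exists_of_one.1
    exact h'.not_sc_of_two x hx y hy hxy hs
  fin_cases i <;> fin_cases j
  · rfl
  · exact (h01 hi hj).elim
  · exact (h02 hi hj).elim
  · exact (h01 hj hi).elim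
  · rfl
  · exact (h12 hi hj).elim
  · exact (h02 hj hi).elim
  · exact (h12 hj hi).elim
  · rfl

lemma exists_type {τ : List (Perm V)} (h : Planar (ω :: τ)) :
    ∃ i, HasForm (SplitType i (ω * τ.prod)) ω := by
  obtain ⟨a, b, c, hab, hac, hbc, rfl⟩ := exists_tri (h.1 ω List.mem_cons_self)
  have ht := (planar_tri_cons hab hac hbc).1 h
  have r1 := tri_rotate hab hac hbc
  have r2 := tri_rotate hbc hab.symm hac.symm
  rcases tight_cases (sc_prod_le_orb τ) hab hbc ht.2 with h | h | h | h | h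
  · exact ⟨0, a, b, c, ⟨hab, hac, hbc⟩, rfl, cyclicOrder_tri_mul.2 h⟩
  · exact ⟨1, a, b, c, ⟨hab, hac, hbc⟩, rfl, ((sc_tri_mul_exchange hbc).2 h).1⟩
  · refine ⟨1, b, c, a, ⟨hbc, hab.symm, hac.symm⟩, r1, ?_⟩
    rw [r1]
    exact ((sc_tri_mul_exchange hac.symm).2 h).1
  · refine ⟨1, c, a, b, ⟨hac.symm, hbc.symm, hab⟩, r1.trans r2, ?_⟩
    rw [r1, r2]
    exact ((sc_tri_mul_exchange hab).2 ⟨h.1, h.2⟩).1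
  · exact ⟨2, a, b, c, ⟨hab, hac, hbc⟩, rfl, cyclicOrder_iff.1 h⟩

lemma typeWt_zero_left (K : Type*) [Field K] (i : Fin 3) (m : ℕ) : typeWt K i 0 m = 0 := by
  classical
  rw [typeWt]
  refine (listSum_congr fun τ => sum_eq_zero fun ω _ => if_neg ?_).trans (listSum_zero m)
  rintro ⟨-, a, -⟩
  exact a.elim0

/-- Splitting off the first member of each list: if the list is minimal and transitive, exactly one
of the three types applies, and otherwise none does. -/
lemma totalWt_succ (K : Type*) [Field K] (n m : ℕ) :
    totalWt K n (m + 1) = typeWt K 0 n m + typeWt K 1 n m + typeWt K 2 n m := by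
  classical
  rcases Nat.eq_zero_or_pos n with rfl | hn
  · simp only [totalWt_zero, typeWt_zero_left, add_zero]
  have : Nonempty (Fin n) := ⟨⟨0, hn⟩⟩
  rw [totalWt, listSum, ← listSum_sum, typeWt, typeWt, typeWt, ← listSum_add, ← listSum_add]
  refine listSum_congr fun τ => ?_
  unfold stepSum
  rw [← sum_add_distrib, ← sum_add_distrib]
  refine sum_congr rfl fun ω _ => ?_
  rw [planarStat_connStat, List.prod_cons]
  by_cases hP : Planar (ω :: τ) ∧ orb (ω :: τ) = ⊤
  · obtain ⟨i, hi⟩ := exists_type hP.1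
    have hs : ∀ j, IsStep j τ ω ↔ i = j := fun j =>
      ⟨fun h => hi.type_unique h.2, fun h => ⟨hP, h ▸ hi⟩⟩
    simp only [hs, if_pos hP]
    fin_cases i <;> simp
  · have hs : ∀ j, ¬ IsStep j τ ω := fun j h => hP h.1
    simp [hs, hP]

end Exhaustion

/-! ### Monomials as triples of exponents in `z`, in `u` and in the `pᵢ`. -/

section Exponents

lemma p_injective : Function.Injective Var.p := fun _ _ h => Var.p.inj h

/-- The exponent vector of `p₁, p₂, …` in a monomial. -/
noncomputable def pexp (M : Var →₀ ℕ) : ℕ+ →₀ ℕ := M.comapDomain Var.p p_injective.injOn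

/-- The exponent vector of `zᵃ uᵇ p^β`. -/
noncomputable def joinExpo (a b : ℕ) (β : ℕ+ →₀ ℕ) : Var →₀ ℕ :=
  Finsupp.single Var.z a + Finsupp.single Var.u b + β.mapDomain Var.p

lemma pexp_apply (M : Var →₀ ℕ) (i : ℕ+) : pexp M i = M (Var.p i) := rfl

lemma pexp_add (M N : Var →₀ ℕ) : pexp (M + N) = pexp M + pexp N := by
  ext i
  simp [pexp_apply]

lemma notMem_range_p {v : Var} (h : ∀ i, v ≠ Var.p i) : v ∉ Set.range Var.p := by
  rintro ⟨i, hi⟩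
  exact h i hi.symm

lemma joinExpo_z (a b : ℕ) (β : ℕ+ →₀ ℕ) : joinExpo a b β Var.z = a := by
  simp [joinExpo, Finsupp.mapDomain_of_notMem_range β Var.z (notMem_range_p fun _ => by simp)]

lemma joinExpo_u (a b : ℕ) (β : ℕ+ →₀ ℕ) : joinExpo a b β Var.u = b := by
  simp [joinExpo, Finsupp.mapDomain_of_notMem_range β Var.u (notMem_range_p fun _ => by simp)]

lemma pexp_joinExpo (a b : ℕ) (β : ℕ+ →₀ ℕ) : pexp (joinExpo a b β) = β := by
  ext i
  simp [pexp_apply, joinExpo, Finsupp.mapDomain_apply p_injective]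

lemma expo_ext {M N : Var →₀ ℕ} (hz : M Var.z = N Var.z) (hu : M Var.u = N Var.u)
    (hp : pexp M = pexp N) : M = N := by
  ext v
  cases v with
  | z => exact hz
  | u => exact hu
  | p i => exact DFunLike.congr_fun hp i

lemma eq_joinExpo_iff {M : Var →₀ ℕ} {a b : ℕ} {β : ℕ+ →₀ ℕ} :
    M = joinExpo a b β ↔ M Var.z = a ∧ M Var.u = b ∧ pexp M = β := by
  constructor
  · rintro rfl
    exact ⟨joinExpo_z _ _ _, joinExpo_u _ _ _, pexp_joinExpo _ _ _⟩
  · rintro ⟨h1, h2, h3⟩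
    refine expo_ext ?_ ?_ ?_
    · rw [h1, joinExpo_z]
    · rw [h2, joinExpo_u]
    · rw [h3, pexp_joinExpo]

lemma joinExpo_add (a b a' b' : ℕ) (β β' : ℕ+ →₀ ℕ) :
    joinExpo (a + a') (b + b') (β + β') = joinExpo a b β + joinExpo a' b' β' := by
  symm
  rw [eq_joinExpo_iff]
  simp [joinExpo_z, joinExpo_u, pexp_joinExpo, pexp_add]

open Classical in
lemma sum_antidiagonal_expo {R : Type*} [AddCommMonoid R] (M : Var →₀ ℕ)
    (f : ℕ × ℕ → ℕ × ℕ → (ℕ+ →₀ ℕ) × (ℕ+ →₀ ℕ) → R) :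
    ∑ x ∈ antidiagonal M,
        f (x.1 Var.z, x.2 Var.z) (x.1 Var.u, x.2 Var.u) (pexp x.1, pexp x.2) =
      ∑ a ∈ antidiagonal (M Var.z), ∑ b ∈ antidiagonal (M Var.u),
        ∑ c ∈ antidiagonal (pexp M), f a b c := by
  simp only [← sum_product']
  refine sum_bij' (fun x _ => ((x.1 Var.z, x.2 Var.z), (x.1 Var.u, x.2 Var.u),
      (pexp x.1, pexp x.2)))
    (fun y _ => (joinExpo y.1.1 y.2.1.1 y.2.2.1, joinExpo y.1.2 y.2.1.2 y.2.2.2))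
    ?_ ?_ ?_ ?_ ?_
  · intro x hx
    rw [HasAntidiagonal.mem_antidiagonal] at hx
    simp only [mem_product, HasAntidiagonal.mem_antidiagonal, ← hx, pexp_add, Finsupp.add_apply, and_self]
  · intro y hy
    simp only [mem_product, HasAntidiagonal.mem_antidiagonal] at hy ⊢
    rw [← joinExpo_add, hy.1, hy.2.1, hy.2.2]
    exact (eq_joinExpo_iff.2 ⟨rfl, rfl, rfl⟩).symm
  · intro x _
    exact Prod.ext (eq_joinExpo_iff.2 ⟨rfl, rfl, rfl⟩).symm
      (eq_joinExpo_iff.2 ⟨rfl, rfl, rfl⟩).symm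
  · intro y _
    simp only [joinExpo_z, joinExpo_u, pexp_joinExpo]
  · intro x _
    rfl

end Exponents

/-! ### From arrays to power series. -/

section GeneratingSeries

variable (K : Type*) [Field K]

/-- The generating series `∑ Aₙₘ zⁿ / n! uᵐ / m!` of an array of polynomials in `p₁, p₂, …`. -/
noncomputable def egf (A : ℕ → ℕ → MvPolynomial ℕ+ K) : Series K := fun M =>
  (A (M Var.z) (M Var.u)).coeff (pexp M) / ((M Var.z).factorial * (M Var.u).factorial)

variable {K}

lemma coeff_egf (A : ℕ → ℕ → MvPolynomial ℕ+ K) (M : Var →₀ ℕ) :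
    MvPowerSeries.coeff M (egf K A) = (A (M Var.z) (M Var.u)).coeff (pexp M) /
      ((M Var.z).factorial * (M Var.u).factorial) := rfl

lemma egf_add (A B : ℕ → ℕ → MvPolynomial ℕ+ K) :
    egf K (fun n m => A n m + B n m) = egf K A + egf K B := by
  ext M
  rw [map_add, coeff_egf, coeff_egf, coeff_egf, MvPolynomial.coeff_add, add_div]

lemma egf_nsmul (k : ℕ) (A : ℕ → ℕ → MvPolynomial ℕ+ K) :
    egf K (fun n m => k • A n m) = k • egf K A := by
  ext M
  rw [map_nsmul, coeff_egf, coeff_egf, MvPolynomial.coeff_smul, smul_div_assoc]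

lemma pVar_mul_egf (i : ℕ+) (A : ℕ → ℕ → MvPolynomial ℕ+ K) :
    pVar K i * egf K A = egf K fun n m => MvPolynomial.X i * A n m := by
  classical
  ext M
  rw [pVar, MvPowerSeries.X_def, MvPowerSeries.coeff_monomial_mul]
  simp only [coeff_egf, MvPolynomial.coeff_X_mul']
  have hle : Finsupp.single (Var.p i) 1 ≤ M ↔ i ∈ (pexp M).support := by
    rw [Finsupp.single_le_iff, Finsupp.mem_support_iff, pexp_apply, Nat.one_le_iff_ne_zero]
  split_ifs with h1 h2 h2
  · have hz : (M - Finsupp.single (Var.p i) 1 : Var →₀ ℕ) Var.z = M Var.z := by simp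
    have hu : (M - Finsupp.single (Var.p i) 1 : Var →₀ ℕ) Var.u = M Var.u := by simp
    have hp : pexp (M - Finsupp.single (Var.p i) 1) = pexp M - Finsupp.single i 1 := by
      ext j
      simp [pexp_apply, Finsupp.single_apply_left p_injective]
    rw [one_mul, hz, hu, hp]
  · exact (h2 (hle.1 h1)).elim
  · exact (h1 (hle.2 h2)).elim
  · rw [zero_div]

lemma pderiv_p_egf (i : ℕ+) (A : ℕ → ℕ → MvPolynomial ℕ+ K) :
    MvPowerSeries.pderiv K (Var.p i) (egf K A) =
      egf K fun n m => MvPolynomial.pderiv i (A n m) := by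
  ext M
  have hp : pexp (M + Finsupp.single (Var.p i) 1) = pexp M + Finsupp.single i 1 := by
    ext j
    simp [pexp_apply, Finsupp.single_apply_left p_injective]
  rw [MvPowerSeries.coeff_pderiv, coeff_egf, coeff_egf, MvPolynomial.coeff_pderiv, hp]
  simp only [Finsupp.add_apply, pexp_apply, ne_eq, reduceCtorEq, not_false_eq_true,
    Finsupp.single_eq_of_ne, add_zero]
  rw [div_mul_eq_mul_div]

variable [CharZero K]

/-- The factor `m + 1` from the derivative turns `1/(m+1)!` into `1/m!`. -/
lemma pderiv_u_egf (A : ℕ → ℕ → MvPolynomial ℕ+ K) :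
    MvPowerSeries.pderiv K Var.u (egf K A) = egf K fun n m => A n (m + 1) := by
  ext M
  have hp : pexp (M + Finsupp.single Var.u 1) = pexp M := by
    ext j
    simp [pexp_apply]
  rw [MvPowerSeries.coeff_pderiv, coeff_egf, coeff_egf, hp]
  simp only [Finsupp.add_apply, ne_eq, reduceCtorEq, not_false_eq_true,
    Finsupp.single_eq_of_ne, add_zero, Finsupp.single_eq_same]
  have h1 := Nat.cast_ne_zero (R := K).2 (M Var.z).factorial_ne_zero
  have h2 := Nat.cast_ne_zero (R := K).2 (M Var.u).factorial_ne_zero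
  have h3 : ((M Var.u : K) + 1) ≠ 0 := Nat.cast_add_one_ne_zero _
  rw [Nat.factorial_succ]
  push_cast
  field_simp

lemma choose_div_factorial {x : ℕ × ℕ} {n : ℕ} (h : x ∈ antidiagonal n) :
    (n.choose x.1 : K) / n.factorial = 1 / (x.1.factorial * x.2.factorial) := by
  rw [HasAntidiagonal.mem_antidiagonal] at h
  have := Nat.choose_mul_factorial_mul_factorial (Nat.le.intro h)
  rw [Nat.sub_eq_of_eq_add' h.symm] at this
  have h0 := Nat.cast_ne_zero (R := K).2 n.factorial_ne_zero
  have h1 := Nat.cast_ne_zero (R := K).2 x.1.factorial_ne_zero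
  have h2 := Nat.cast_ne_zero (R := K).2 x.2.factorial_ne_zero
  rw [div_eq_div_iff h0 (mul_ne_zero h1 h2), one_mul, ← mul_assoc]
  exact_mod_cast this

/-- The usual product formula for exponential generating functions, in `z` and in `u`
simultaneously; in the `pᵢ` it is the ordinary product of polynomials. -/
lemma egf_mul (A B : ℕ → ℕ → MvPolynomial ℕ+ K) : egf K A * egf K B = egf K (conv A B) := by
  classical
  ext M
  rw [MvPowerSeries.coeff_mul]
  simp only [coeff_egf]
  rw [sum_antidiagonal_expo M fun a b c =>
    (A a.1 b.1).coeff c.1 / (a.1.factorial * b.1.factorial) *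
      ((B a.2 b.2).coeff c.2 / (a.2.factorial * b.2.factorial))]
  unfold conv binConv
  simp only [MvPolynomial.coeff_sum, MvPolynomial.coeff_smul, MvPolynomial.coeff_mul, sum_div,
    smul_sum]
  refine sum_congr rfl fun a ha => sum_congr rfl fun b hb => sum_congr rfl fun c _ => ?_
  have e1 := choose_div_factorial (K := K) ha
  have e2 := choose_div_factorial (K := K) hb
  calc _ = 1 / (a.1.factorial * a.2.factorial : K) * (1 / (b.1.factorial * b.2.factorial)) *
        ((A a.1 b.1).coeff c.1 * (B a.2 b.2).coeff c.2) := by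
        simp only [div_eq_mul_inv, mul_inv]
        ring
    _ = _ := by
        rw [← e1, ← e2]
        simp only [nsmul_eq_mul, div_eq_mul_inv, mul_inv]
        ring

-- The finite set of relevant indices depends only on the exponent of `z`, so every coefficient of
-- the formal sum is a finite sum.
omit [CharZero K] in
lemma formalSum_egf {ι : Type*} {f : ι → Series K} {A : ι → ℕ → ℕ → MvPolynomial ℕ+ K}
    {s : ℕ → Finset ι} (hf : ∀ x, f x = egf K (A x)) (hA : ∀ n m, ∀ x ∉ s n, A x n m = 0) :
    FormallySummable f ∧ formalSum f = egf K fun n m => ∑ x ∈ s n, A x n m := by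
  have hs : ∀ M : Var →₀ ℕ, (Function.support fun i => MvPowerSeries.coeff M (f i)) ⊆
      (s (M Var.z) : Set ι) := by
    intro M x hx
    by_contra h
    refine hx ?_
    change MvPowerSeries.coeff M (f x) = 0
    rw [hf, coeff_egf, hA _ _ x h, MvPolynomial.coeff_zero, zero_div]
  refine ⟨fun M => (finite_toSet _).subset (hs M), ?_⟩
  ext M
  change ∑ᶠ i, MvPowerSeries.coeff M (f i) = _
  rw [finsum_eq_sum_of_support_subset _ (hs M), coeff_egf, MvPolynomial.coeff_sum, sum_div]
  exact sum_congr rfl fun x _ => by rw [hf, coeff_egf]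

omit [CharZero K] in
lemma pPart_eq {n : ℕ} (α : Nat.Partition n) :
    pPart K α = MvPowerSeries.monomial ((partExpo α).mapDomain Var.p) 1 := by
  unfold pPart partExpo
  induction α.parts using Multiset.induction_on with
  | empty => simp
  | cons a s ih =>
    rw [Multiset.map_cons, Multiset.prod_cons, ih, pVar, MvPowerSeries.X_def,
      MvPowerSeries.monomial_mul_monomial, one_mul, Multiset.map_cons, Multiset.sum_cons,
      Finsupp.mapDomain_add, Finsupp.mapDomain_single]

open Classical in
omit [CharZero K] in
lemma coeff_genTerm {n : ℕ} (c e : ℕ) (α : Nat.Partition n) (M : Var →₀ ℕ) :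
    MvPowerSeries.coeff M (genTerm K c e α) =
      if M Var.z = n ∧ M Var.u = e ∧ pexp M = partExpo α
      then (c : K) / (n.factorial * e.factorial) else 0 := by
  rw [genTerm, pPart_eq, MvPowerSeries.X_pow_eq, MvPowerSeries.X_pow_eq,
    MvPowerSeries.monomial_mul_monomial, MvPowerSeries.monomial_mul_monomial, one_mul, one_mul,
    MvPowerSeries.coeff_smul, MvPowerSeries.coeff_monomial, mul_ite, mul_one, mul_zero]
  exact ite_iff eq_joinExpo_iff _ _

-- The exponent of `z` selects `n`, and the sum over all partitions becomes a finite sum over the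
-- partitions of `n`. The summation index has `n ≥ 1`, so `A` must vanish at `n = 0`.
omit [CharZero K] in
lemma formalSum_genTerm {c e : ∀ {n : ℕ}, Nat.Partition n → ℕ} {A : ℕ → ℕ → MvPolynomial ℕ+ K}
    (h0 : ∀ m, A 0 m = 0) (hA : ∀ n, 0 < n → ∀ m, A n m = ∑ α : Nat.Partition n,
      if e α = m then c α • mon K (partExpo α) else 0) :
    formalSum (fun x : (n : ℕ+) × Nat.Partition (n : ℕ) => genTerm K (c x.2) (e x.2) x.2) =
      egf K A := by
  classical
  ext M
  change ∑ᶠ x : (n : ℕ+) × Nat.Partition (n : ℕ), MvPowerSeries.coeff M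
    (genTerm K (c x.2) (e x.2) x.2) = _
  simp only [coeff_genTerm, coeff_egf]
  rcases Nat.eq_zero_or_pos (M Var.z) with hz | hz
  · rw [hz, h0, MvPolynomial.coeff_zero, zero_div]
    exact finsum_eq_zero_of_forall_eq_zero fun x => if_neg fun h => x.1.ne_zero h.1.symm
  · obtain ⟨N, hN⟩ : ∃ N : ℕ+, (N : ℕ) = M Var.z := ⟨⟨M Var.z, hz⟩, rfl⟩
    rw [finsum_eq_sum_of_support_subset (s := univ.map (Function.Embedding.sigmaMk N)), sum_map,
      ← hN, hA _ N.pos, MvPolynomial.coeff_sum, sum_div]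
    · refine sum_congr rfl fun α _ => ?_
      change (if (N : ℕ) = N ∧ M Var.u = e α ∧ pexp M = partExpo α then
        (c α : K) / ((N : ℕ).factorial * (e α).factorial) else 0) = _
      by_cases h1 : e α = M Var.u
      · rw [if_pos h1, MvPolynomial.coeff_smul, MvPolynomial.coeff_monomial, h1]
        by_cases h2 : partExpo α = pexp M
        · rw [if_pos ⟨rfl, rfl, h2.symm⟩, if_pos h2, nsmul_eq_mul, mul_one]
        · rw [if_neg fun h => h2 h.2.2.symm, if_neg h2, nsmul_zero, zero_div]
      · rw [if_neg fun h => h1 h.2.1.symm, if_neg h1, MvPolynomial.coeff_zero, zero_div]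
    · rintro ⟨n, α⟩ hx
      rw [Function.mem_support, ne_eq, ite_eq_right_iff, Classical.not_imp] at hx
      obtain rfl : n = N := PNat.coe_injective (hx.1.1.symm.trans hN.symm)
      simp

end GeneratingSeries

/-! ### The series in the statement as generating series of arrays. -/

section MainIdentities

variable (K : Type*) [Field K]

lemma Ftilde3_eq : Ftilde3 K = egf K (totalWt K) :=
  formalSum_genTerm (c := fun α => (setA α).ncard) (e := mu3) (totalWt_zero K)
    fun _ hn m => totalWt_eq K hn m

lemma dFtilde3_eq (i : Fin 3) : dFtilde3 K i = egf K (typeWt K i) :=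
  formalSum_genTerm (c := fun α => (setAtildei i α).ncard) (e := fun α => mu3 α - 1)
    (typeWt_zero_left K i) fun _ hn m => typeWt_eq K hn i m

lemma smul_Fp (i : ℕ+) : (i : ℕ) • Fp K i = egf K (markWt K i) := by
  rw [Fp, Ftilde3_eq, pderiv_p_egf, ← egf_nsmul]
  rfl

lemma summand3_eq (x : ℕ+ × ℕ+ × ℕ+) : summand3 K x = egf K fun n m =>
    MvPolynomial.X x.1 * MvPolynomial.X x.2.1 * MvPolynomial.X x.2.2 *
      markWt K (x.1 + x.2.1 + x.2.2) n m := by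
  obtain ⟨i, j, k⟩ := x
  simp only [mul_assoc]
  rw [← pVar_mul_egf, ← pVar_mul_egf, ← pVar_mul_egf, ← smul_Fp]
  simp only [summand3, nsmul_eq_mul]
  ring

variable [CharZero K]

lemma summand1_eq (x : ℕ+ × ℕ+ × ℕ+) : summand1 K x = egf K fun n m =>
    MvPolynomial.X (x.1 + x.2.1 + x.2.2) *
      conv (markWt K x.1) (conv (markWt K x.2.1) (markWt K x.2.2)) n m := by
  obtain ⟨i, j, k⟩ := x
  rw [← pVar_mul_egf, ← egf_mul, ← egf_mul, ← smul_Fp, ← smul_Fp, ← smul_Fp]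
  simp only [summand1, nsmul_eq_mul, PNat.mul_coe, Nat.cast_mul]
  ring

lemma summand2_eq (x : ℕ+ × ℕ+ × ℕ+) : summand2 K x = egf K fun n m =>
    MvPolynomial.X (x.1 + x.2.2) * MvPolynomial.X x.2.1 *
      conv (markWt K x.1) (markWt K (x.2.1 + x.2.2)) n m := by
  obtain ⟨i, j, k⟩ := x
  simp only [mul_assoc]
  rw [← pVar_mul_egf, ← pVar_mul_egf, ← egf_mul, ← smul_Fp, ← smul_Fp]
  simp only [summand2, nsmul_eq_mul, PNat.mul_coe, Nat.cast_mul]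
  ring

lemma eq_third_smul {a b : Series K} (h : 3 • a = b) : a = (1 / 3 : K) • b := by
  rw [← h, ← Nat.cast_smul_eq_nsmul K 3 a, smul_smul]
  norm_num

end MainIdentities

end ThreeCycles

open ThreeCycles in
theorem lemma5p9 (K : Type*) [Field K] [CharZero K] :
    (FormallySummable (summand1 K) ∧ FormallySummable (summand2 K) ∧
      FormallySummable (summand3 K)) ∧
    MvPowerSeries.pderiv K Var.u (Ftilde3 K) =
      dFtilde3 K 0 + dFtilde3 K 1 + dFtilde3 K 2 ∧
    dFtilde3 K 0 = (1 / 3 : K) • formalSum (summand1 K) ∧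
    dFtilde3 K 1 = formalSum (summand2 K) ∧
    dFtilde3 K 2 = (1 / 3 : K) • formalSum (summand3 K) ∧
    MvPowerSeries.pderiv K Var.u (Ftilde3 K) =
      (1 / 3 : K) • formalSum (summand1 K) + formalSum (summand2 K) +
        (1 / 3 : K) • formalSum (summand3 K) := by
  obtain ⟨s1, e1⟩ := formalSum_egf (s := lengthTriples) (summand1_eq K)
    fun n m x hx => by rw [conv_three_eq_zero K m hx, mul_zero]
  obtain ⟨s2, e2⟩ := formalSum_egf (s := lengthTriples) (summand2_eq K)
    fun n m x hx => by rw [conv_two_eq_zero K m hx, mul_zero]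
  obtain ⟨s3, e3⟩ := formalSum_egf (s := lengthTriples) (summand3_eq K)
    fun n m x hx => by rw [markWt_eq_zero K m hx, mul_zero]
  have h : MvPowerSeries.pderiv K Var.u (Ftilde3 K) =
      dFtilde3 K 0 + dFtilde3 K 1 + dFtilde3 K 2 := by
    rw [Ftilde3_eq, pderiv_u_egf, dFtilde3_eq, dFtilde3_eq, dFtilde3_eq, ← egf_add, ← egf_add]
    simp only [totalWt_succ]
  have h1 : dFtilde3 K 0 = (1 / 3 : K) • formalSum (summand1 K) := by
    refine eq_third_smul K ?_
    rw [e1, dFtilde3_eq, ← egf_nsmul]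
    simp only [three_smul_typeWt_zero]
  have h2 : dFtilde3 K 1 = formalSum (summand2 K) := by
    rw [e2, dFtilde3_eq]
    congr 1
    funext n m
    exact typeWt_one K n m
  have h3 : dFtilde3 K 2 = (1 / 3 : K) • formalSum (summand3 K) := by
    refine eq_third_smul K ?_
    rw [e3, dFtilde3_eq, ← egf_nsmul]
    simp only [three_smul_typeWt_two]
  refine ⟨⟨s1, s2, s3⟩, h, h1, h2, h3, ?_⟩
  rw [h, h1, h2, h3]
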